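/- **Setting.** Consider the plant $x(t+1)=Ax(t)+Bu(t)+w(t)$, $y(t)=Cx(t)+v(t)$, $t\ge 0$, $x(0)=0$, with $x,w\in\mathbb R^{n_x}$, $u\in\mathbb R^{n_u}$, $y,v\in\mathbb R^{n_y}$, where $(A,B)$ is stabilizable, $(A,C)$ is observable, and $d(t)=(w(t),v(t))$ is i.i.d. $\mathcal N(0,\mathrm{diag}(V_w,V_v))$ with $V_w\ge 0$, $V_v>0$. Let $Q>0$, $R>0$. For a dynamic controller $\mathbf K$: $\xi(t+1)=G\xi(t)+Hy(t)$, $u(t)=F\xi(t)$, put $$J_{\rm dyn}(\mathbf K)=\lim_{T\to\infty}\mathbb E\Big[\tfrac1T\sum_{t=0}^{T}y(t)^\top Qy(t)+u(t)^\top Ru(t)\Big].$$ It is called stabilizing if $\begin{bmatrix}A&BF\\HC&G\end{bmatrix}$ is Schur stable. Let $\mathbf K_{\rm LQG}$ be the LQG controller $F=-(R+B^\top XB)^{-1}B^\top XA$, $H=AYC^\top(CYC^\top+V_v)^{-1}$, $G=A+BF-HC$, where $X,Y\ge 0$ are the stabilizing solutions of the Riccati equations $X=A^\top XA-A^\top XB(R+B^\top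 XB)^{-1}B^\top XA+C^\top QC$ and $Y=AYA^\top-AYC^\top(CYC^\top+V_v)^{-1}CYA^\top+V_w$ (that is, $A+BF$ and $A-HC$ are Schur stable). Fix $L\in\mathbb N$. Write $\mathcal O_L(A,C)=[C;CA;\dots;CA^{L-1}]$, $\mathcal R_L(A,B)=[A^{L-1}B,\dots,B]$, and let $\mathcal H_L(A,B,C)$ have blocks $CA^{i-j-1}B$ for $i>j$ and $0$ otherwise. A system with state matrix $A'$ and output matrix $C'$ is $L$-step observable if $\mathcal O_L(A',C')$ has full column rank. With $z(t)=(u(t-L),\dots,u(t-1),y(t-L),\dots,y(t-1))$, $e(t)=(w(t-L),\dots,w(t-1),v(t-L),\dots,v(t-1))$ and $h=(z,e)$, the history dynamics are, for $t\ge L$, $$h(t+1)=\Theta h(t)+\Pi_d d(t)+\Pi_u u(t),\quad y(t)=\Psi h(t)+v(t),\quad z(t)=\Gamma h(t),$$ where $\Psi=C[M_1,M_2,M_3,M_4]$, $M_2=-M_4=A^L\mathcal O_L(A,C)^\dagger$, $M_1=\mathcal R_L(A,B)-M_2\mathcal H_L(A,B,C)$, $M_3=\mathcal R_L(A,I)-M_2\mathcal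 H_L(A,I,C)$, $\Gamma=[I,0]$, and $\Theta,\Pi_d,\Pi_u$ are the matrices that shift each of the four stacks by one block and append $u(t)$, $y(t)=\Psi h(t)+v(t)$, $w(t)$, $v(t)$ respectively. The initial value $h(L)$ is the history of the plant over $0,\dots,L-1$ under arbitrary fixed inputs. For an IOH gain $K\in\mathbb R^{n_u\times L(n_u+n_y)}$, i.e. $u(t)=Kz(t)$ for $t\ge L$, let $$J(K)=\lim_{T\to\infty}\mathbb E\Big[\tfrac1T\sum_{t=L}^{T}y(t)^\top Qy(t)+u(t)^\top Ru(t)\Big],\qquad \mathbb K=\{K:\Theta+\Pi_uK\Gamma\text{ is Schur stable}\}.$$ (Where a limit does not exist, it is read as the lower limit in $[0,\infty]$.) For $K=[K^u_L,\dots,K^u_1,K^y_L,\dots,K^y_1]$ the rebuilt controller is the one of state dimension $Ln_u$ for which $G$ has identity blocks on the first block subdiagonal, to which a last block column $[K^u_L;\dots;K^u_1]$ is added, $H=[K^y_L;\dots;K^y_1]$ and $F=[0,\dots,0,I]$. **Theorem.** Suppose that $\mathbb K\neq\emptyset$, that the plant is $L$-step observable, and that a minimal realization of $\mathbf K_{\rm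 LQG}$ is $L$-step observable. Then on $\mathbb K$ the limit $J$ exists and is finite, and $J$ attains its minimum over $\mathbb K$. Let $K_\star$ be any minimizer of $J$ over $\mathbb K$ and $\mathbf K_\star$ the controller rebuilt from it. Then $$J(K)\ \ge\ J(K_\star)=J_{\rm dyn}(\mathbf K_\star)=J_{\rm dyn}(\mathbf K_{\rm LQG})$$ for every $K\in\mathbb K$, and, if $(A,V_w^{1/2})$ is stabilizable, for every $K\in\mathbb R^{n_u\times L(n_u+n_y)}$. The limits defining $J_{\rm dyn}(\mathbf K_\star)$ and $J_{\rm dyn}(\mathbf K_{\rm LQG})$ exist, and the equalities hold for all square-integrable initial controller states. Moreover, when $n_u=1$, the $L$-dimensional controller $\mathbf K_\star$ satisfies $J_{\rm dyn}(\mathbf K_\star)\le J_{\rm dyn}(\mathbf K)$ for every stabilizing controller $\mathbf K$ of state dimension $L$, and, if $(A,V_w^{1/2})$ is stabilizable, for every controller $\mathbf K$ of state dimension $L$ (for any deterministic initial state of $\mathbf K$). -/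

import Mathlib

open MeasureTheory ProbabilityTheory Filter Topology
open scoped ENNReal Matrix

namespace IOH

noncomputable section

/-! ### Matrix notions from linear systems theory -/

section LinearSystems

variable {n p q : Type} [Fintype n] [DecidableEq n] [Fintype p] [DecidableEq p]
  [Fintype q] [DecidableEq q]

/-- A real square matrix is Schur stable if all its complex eigenvalues lie in the open unit
disk. -/
def IsSchur (A : Matrix n n ℝ) : Prop :=
  ∀ z ∈ spectrum ℂ (A.map (algebraMap ℝ ℂ)), ‖z‖ < 1

/-- The pair `(A, B)` is stabilizable. -/
def IsStabilizable (A : Matrix n n ℝ) (B : Matrix n p ℝ) : Prop :=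
  ∃ F : Matrix p n ℝ, IsSchur (A + B * F)

/-- `R_L(A, B) = [A^(L-1) B, …, A B, B]`. -/
def reachMat (L : ℕ) (A : Matrix n n ℝ) (B : Matrix n p ℝ) : Matrix n (Fin L × p) ℝ :=
  Matrix.of fun i kj => (A ^ (L - 1 - (kj.1 : ℕ)) * B) i kj.2

/-- `O_L(A, C) = [C; C A; …; C A^(L-1)]`. -/
def obsMat (L : ℕ) (A : Matrix n n ℝ) (C : Matrix q n ℝ) : Matrix (Fin L × q) n ℝ :=
  Matrix.of fun ki j => (C * A ^ (ki.1 : ℕ)) ki.2 j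

/-- `H_L(A, B, C)`: the block matrix with blocks `C A^(i-j-1) B` strictly below the diagonal and
zero blocks elsewhere. -/
def toepMat (L : ℕ) (A : Matrix n n ℝ) (B : Matrix n p ℝ) (C : Matrix q n ℝ) :
    Matrix (Fin L × q) (Fin L × p) ℝ :=
  Matrix.of fun ki lj =>
    if lj.1 < ki.1 then (C * A ^ ((ki.1 : ℕ) - (lj.1 : ℕ) - 1) * B) ki.2 lj.2 else 0

/-- `L`-step observability: the `L`-step observability matrix has full column rank. -/
def IsStepObservable (L : ℕ) (A : Matrix n n ℝ) (C : Matrix q n ℝ) : Prop :=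
  (obsMat L A C).rank = Fintype.card n

/-- Observability of the pair `(A, C)`. -/
def IsObservable (A : Matrix n n ℝ) (C : Matrix q n ℝ) : Prop :=
  IsStepObservable (Fintype.card n) A C

/-- The block shift `J` on `L` blocks (identity blocks on the first block superdiagonal). -/
def shiftMat (L : ℕ) (p : Type) [DecidableEq p] : Matrix (Fin L × p) (Fin L × p) ℝ :=
  Matrix.of fun k l => if (k.1 : ℕ) + 1 = (l.1 : ℕ) ∧ k.2 = l.2 then 1 else 0

/-- The block column `E = [0; …; 0; I]` with `L` blocks. -/
def lastMat (L : ℕ) (p : Type) [DecidableEq p] : Matrix (Fin L × p) p ℝ :=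
  Matrix.of fun k j => if (k.1 : ℕ) + 1 = L ∧ k.2 = j then 1 else 0

/-- `X` satisfies the four Penrose equations for `M`. -/
structure IsMoorePenrose (M : Matrix p n ℝ) (X : Matrix n p ℝ) : Prop where
  mul_mul_self : M * X * M = M
  mul_mul_inv : X * M * X = X
  symm_left : (M * X)ᵀ = M * X
  symm_right : (X * M)ᵀ = X * M

open Classical in
/-- The Moore–Penrose inverse of a real matrix. -/
def pinv (M : Matrix p n ℝ) : Matrix n p ℝ :=
  if h : ∃ X, IsMoorePenrose M X then h.choose else 0

/-- The Penrose equations determine `X`. -/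
theorem IsMoorePenrose.unique {M : Matrix p n ℝ} {X Y : Matrix n p ℝ}
    (hX : IsMoorePenrose M X) (hY : IsMoorePenrose M Y) : X = Y := by
  have h1 : M * X = M * Y := by
    have e : (M * X)ᵀ = (M * Y * (M * X))ᵀ := by
      rw [← Matrix.mul_assoc, hY.mul_mul_self]
    rw [hX.symm_left, Matrix.transpose_mul (M * Y), hX.symm_left, hY.symm_left,
      ← Matrix.mul_assoc, hX.mul_mul_self] at e
    exact e
  have h2 : X * M = Y * M := by
    have e : (X * M)ᵀ = (X * M * (Y * M))ᵀ := by
      rw [Matrix.mul_assoc, ← Matrix.mul_assoc M, hY.mul_mul_self]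
    rw [hX.symm_right, Matrix.transpose_mul (X * M), hX.symm_right, hY.symm_right,
      Matrix.mul_assoc Y, ← Matrix.mul_assoc M X M, hX.mul_mul_self] at e
    exact e
  rw [← hX.mul_mul_inv, h2, Matrix.mul_assoc, h1, ← Matrix.mul_assoc, hY.mul_mul_inv]

/-- For a matrix of full column rank the Moore–Penrose inverse is `(Mᵀ M)⁻¹ Mᵀ`. -/
theorem pinv_eq_of_isUnit {M : Matrix p n ℝ} (h : IsUnit (Mᵀ * M).det) :
    pinv M = (Mᵀ * M)⁻¹ * Mᵀ := by
  have hM : IsMoorePenrose M ((Mᵀ * M)⁻¹ * Mᵀ) := by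
    have h0 : (Mᵀ * M)⁻¹ * Mᵀ * M = 1 := by
      rw [Matrix.mul_assoc, Matrix.nonsing_inv_mul _ h]
    refine ⟨?_, ?_, ?_, ?_⟩
    · rw [Matrix.mul_assoc, h0, Matrix.mul_one]
    · rw [h0, Matrix.one_mul]
    · simp [Matrix.transpose_mul, Matrix.transpose_nonsing_inv, Matrix.mul_assoc]
    · rw [h0, Matrix.transpose_one]
  have hex : ∃ X, IsMoorePenrose M X := ⟨_, hM⟩
  rw [pinv, dif_pos hex]
  exact hex.choose_spec.unique hM

end LinearSystems

/-! ### The control problem -/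

/-- The matrices of an LQG problem: plant `(A, B, C)`, noise covariances `Vw`, `Vv`, and cost
weights `Qy`, `Ru`. -/
structure LQGData (nx nu ny : ℕ) where
  A : Matrix (Fin nx) (Fin nx) ℝ
  B : Matrix (Fin nx) (Fin nu) ℝ
  C : Matrix (Fin ny) (Fin nx) ℝ
  Vw : Matrix (Fin nx) (Fin nx) ℝ
  Vv : Matrix (Fin ny) (Fin ny) ℝ
  Qy : Matrix (Fin ny) (Fin ny) ℝ
  Ru : Matrix (Fin nu) (Fin nu) ℝ

/-- A value `d = (w, v)` of the joint process and measurement noise. -/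
abbrev Noise (nx ny : ℕ) : Type := EuclideanSpace ℝ (Fin nx ⊕ Fin ny)

/-- The process noise component. -/
def Noise.w {nx ny : ℕ} (d : Noise nx ny) : Fin nx → ℝ := fun i => d (Sum.inl i)

/-- The measurement noise component. -/
def Noise.v {nx ny : ℕ} (d : Noise nx ny) : Fin ny → ℝ := fun i => d (Sum.inr i)

/-- The dynamic output-feedback controller `ξ(t+1) = G ξ(t) + H y(t)`, `u(t) = F ξ(t)`, with
state coordinates indexed by `ι`. -/
structure DynController (ι : Type) (nu ny : ℕ) where
  G : Matrix ι ι ℝ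
  H : Matrix ι (Fin ny) ℝ
  F : Matrix (Fin nu) ι ℝ

/-- Index type of the input-output history `z(t)`: the block `k` of the first (second) component
is `u(t-L+k)` (`y(t-L+k)`). -/
abbrev ZIdx (L nu ny : ℕ) : Type := (Fin L × Fin nu) ⊕ (Fin L × Fin ny)

/-- Index type of the full history `h(t) = (z(t), e(t))`, where `e(t)` stacks the last `L` values
of `w` and of `v`. -/
abbrev HIdx (L nx nu ny : ℕ) : Type := ZIdx L nu ny ⊕ ((Fin L × Fin nx) ⊕ (Fin L × Fin ny))

/-- The expected averages `E[(1/T) ∑_{t = t₀}^{T} r(t)]` of a nonnegative running cost `r`. -/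
def avgCost {Ω : Type*} [MeasurableSpace Ω] (P : Measure Ω) (r : Ω → ℕ → ℝ) (t₀ T : ℕ) : ℝ≥0∞ :=
  ∫⁻ ω, ENNReal.ofReal ((1 / (T : ℝ)) * ∑ t ∈ Finset.Icc t₀ T, r ω t) ∂P

namespace DynController

variable {ι ι' : Type} [Fintype ι] [DecidableEq ι] [Fintype ι'] [DecidableEq ι'] {nu ny : ℕ}

/-- Two controllers have the same input-output behaviour (equal Markov parameters, that is, equal
transfer functions). -/
def SameBehaviour (c : DynController ι nu ny) (c' : DynController ι' nu ny) : Prop :=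
  ∀ k : ℕ, c.F * c.G ^ k * c.H = c'.F * c'.G ^ k * c'.H

/-- `c'` is a minimal realization of `c`: a realization of the same input-output behaviour of
least state dimension. -/
def IsMinimalRealization {m : ℕ} (c' : DynController (Fin m) nu ny) (c : DynController ι nu ny) :
    Prop :=
  c'.SameBehaviour c ∧ ∀ (m' : ℕ) (c'' : DynController (Fin m') nu ny), c''.SameBehaviour c → m ≤ m'

/-- The dynamic controller rebuilt from an IOH gain `K`: with
`K = [K^u_L, …, K^u_1, K^y_L, …, K^y_1]`, the matrix `G` has identity blocks below the diagonal
and last block column `(K^u_L, …, K^u_1)`, `H` is the block column `(K^y_L, …, K^y_1)`, and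
`F = [0, …, 0, I]`. -/
def ofGain {L : ℕ} (K : Matrix (Fin nu) (ZIdx L nu ny) ℝ) :
    DynController (Fin L × Fin nu) nu ny where
  G := (shiftMat L (Fin nu))ᵀ + Matrix.of fun ki lj =>
    if (lj.1 : ℕ) + 1 = L then K ki.2 (Sum.inl (ki.1, lj.2)) else 0
  H := Matrix.of fun ki j => K ki.2 (Sum.inr (ki.1, j))
  F := (lastMat L (Fin nu))ᵀ

end DynController

namespace LQGData

variable {nx nu ny : ℕ} (S : LQGData nx nu ny)

/-- The running cost `yᵀ Q y + uᵀ R u`. -/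
def stage (y : Fin ny → ℝ) (u : Fin nu → ℝ) : ℝ :=
  y ⬝ᵥ (S.Qy *ᵥ y) + u ⬝ᵥ (S.Ru *ᵥ u)

/-! #### Dynamic controllers -/

section Dynamic

variable {ι : Type} [Fintype ι] [DecidableEq ι] (c : DynController ι nu ny)

/-- The state `(x(t), ξ(t))` of the closed loop of the plant (with `x(0) = 0`) and the controller
`c` (with `ξ(0) = ξ₀`) along the noise path `d`. -/
def loopState (ξ₀ : ι → ℝ) (d : ℕ → Noise nx ny) : ℕ → (Fin nx → ℝ) × (ι → ℝ)
  | 0 => (0, ξ₀)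
  | t + 1 =>
    let s := loopState ξ₀ d t
    (S.A *ᵥ s.1 + S.B *ᵥ (c.F *ᵥ s.2) + (d t).w, c.G *ᵥ s.2 + c.H *ᵥ (S.C *ᵥ s.1 + (d t).v))

/-- The running cost at time `t` of the closed loop with `c`. -/
def loopStage (ξ₀ : ι → ℝ) (d : ℕ → Noise nx ny) (t : ℕ) : ℝ :=
  let s := S.loopState c ξ₀ d t
  S.stage (S.C *ᵥ s.1 + (d t).v) (c.F *ᵥ s.2)

/-- The averages whose limit is the cost of `c`: `E[(1/T) ∑_{t=0}^{T} y(t)ᵀQy(t) + u(t)ᵀRu(t)]`. -/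
def dynAvg {Ω : Type*} [MeasurableSpace Ω] (P : Measure Ω) (d : ℕ → Ω → Noise nx ny)
    (ξ₀ : Ω → ι → ℝ) (T : ℕ) : ℝ≥0∞ :=
  avgCost P (fun ω => S.loopStage c (ξ₀ ω) (fun t => d t ω)) 0 T

/-- The cost of the dynamic controller `c` started at `ξ(0) = ξ₀`: the limit of the averages
(the lower limit, which is the limit whenever the latter exists). -/
def dynCost {Ω : Type*} [MeasurableSpace Ω] (P : Measure Ω) (d : ℕ → Ω → Noise nx ny)
    (ξ₀ : Ω → ι → ℝ) : ℝ≥0∞ :=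
  liminf (S.dynAvg c P d ξ₀) atTop

/-- `c` internally stabilizes the plant. -/
def IsStabilizing : Prop :=
  IsSchur (Matrix.fromBlocks S.A (S.B * c.F) (c.H * S.C) c.G)

end Dynamic

/-! #### The LQG controller -/

/-- The state-feedback gain `F = -(R + Bᵀ X B)⁻¹ Bᵀ X A` associated with a solution `X` of a
discrete-time algebraic Riccati equation. -/
def riccatiGain {n p : Type} [Fintype n] [DecidableEq n] [Fintype p] [DecidableEq p]
    (A : Matrix n n ℝ) (B : Matrix n p ℝ) (R : Matrix p p ℝ) (X : Matrix n n ℝ) : Matrix p n ℝ :=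
  -((R + Bᵀ * X * B)⁻¹ * Bᵀ * X * A)

/-- `X` is the stabilizing positive semidefinite solution of the Riccati equation
`X = Aᵀ X A - Aᵀ X B (R + Bᵀ X B)⁻¹ Bᵀ X A + W`. -/
structure IsStabilizingRiccati {n p : Type} [Fintype n] [DecidableEq n] [Fintype p]
    [DecidableEq p] (A : Matrix n n ℝ) (B : Matrix n p ℝ) (W : Matrix n n ℝ) (R : Matrix p p ℝ)
    (X : Matrix n n ℝ) : Prop where
  posSemidef : X.PosSemidef
  eq : X = Aᵀ * X * A - Aᵀ * X * B * (R + Bᵀ * X * B)⁻¹ * Bᵀ * X * A + W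
  schur : IsSchur (A + B * riccatiGain A B R X)

/-- The LQG controller `ξ(t+1) = (A + B F - H C) ξ(t) + H y(t)`, `u(t) = F ξ(t)` built from the
solution `X` of the control Riccati equation and the solution `Y` of the filter Riccati equation:
`F = -(R + Bᵀ X B)⁻¹ Bᵀ X A` and `H = A Y Cᵀ (C Y Cᵀ + Vv)⁻¹`. -/
def lqgController (X Y : Matrix (Fin nx) (Fin nx) ℝ) : DynController (Fin nx) nu ny where
  G := S.A + S.B * riccatiGain S.A S.B S.Ru X
    - S.A * Y * S.Cᵀ * (S.C * Y * S.Cᵀ + S.Vv)⁻¹ * S.C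
  H := S.A * Y * S.Cᵀ * (S.C * Y * S.Cᵀ + S.Vv)⁻¹
  F := riccatiGain S.A S.B S.Ru X

/-! #### The history dynamics and IOH gains -/

section History

variable (L : ℕ)

/-- `M = [M₁, M₂, M₃, M₄]`. -/
def histM : Matrix (Fin nx) (HIdx L nx nu ny) ℝ :=
  let N := S.A ^ L * pinv (obsMat L S.A S.C)
  Matrix.fromCols
    (Matrix.fromCols (reachMat L S.A S.B - N * toepMat L S.A S.B S.C) N)
    (Matrix.fromCols (reachMat L S.A 1 - N * toepMat L S.A 1 S.C) (-N))

/-- `Ψ = C [M₁, M₂, M₃, M₄]`. -/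
def histPsi : Matrix (Fin ny) (HIdx L nx nu ny) ℝ := S.C * S.histM L

/-- `Θ`. -/
def histTheta : Matrix (HIdx L nx nu ny) (HIdx L nx nu ny) ℝ :=
  Matrix.fromBlocks
    (Matrix.fromBlocks (shiftMat L (Fin nu)) 0 0 (shiftMat L (Fin ny))) 0 0
    (Matrix.fromBlocks (shiftMat L (Fin nx)) 0 0 (shiftMat L (Fin ny)))
  + Matrix.fromRows (Matrix.fromRows 0 (lastMat L (Fin ny) * S.histPsi L)) (Matrix.fromRows 0 0)

/-- `Π_d`. -/
def histPid (nx nu ny : ℕ) : Matrix (HIdx L nx nu ny) (Fin nx ⊕ Fin ny) ℝ :=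
  Matrix.fromRows
    (Matrix.fromRows 0 (Matrix.fromCols 0 (lastMat L (Fin ny))))
    (Matrix.fromBlocks (lastMat L (Fin nx)) 0 0 (lastMat L (Fin ny)))

/-- `Π_u`. -/
def histPiu (nx nu ny : ℕ) : Matrix (HIdx L nx nu ny) (Fin nu) ℝ :=
  Matrix.fromRows (Matrix.fromRows (lastMat L (Fin nu)) 0) 0

/-- `Γ = [I, 0]`, so that `z = Γ h`. -/
def histGamma (nx nu ny : ℕ) : Matrix (ZIdx L nu ny) (HIdx L nx nu ny) ℝ :=
  Matrix.fromCols 1 0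

/-- The set `𝕂` of stabilizing IOH gains: `Θ + Π_u K Γ` is Schur stable. -/
def stabGains : Set (Matrix (Fin nu) (ZIdx L nu ny) ℝ) :=
  {K | IsSchur (S.histTheta L + histPiu L nx nu ny * K * histGamma L nx nu ny)}

/-- The plant state under the open-loop input `u₀`, with `x(0) = 0`. -/
def initState (u₀ : ℕ → Fin nu → ℝ) (d : ℕ → Noise nx ny) : ℕ → Fin nx → ℝ
  | 0 => 0
  | t + 1 => S.A *ᵥ initState u₀ d t + S.B *ᵥ u₀ t + (d t).w

/-- The history `h(L)` of `(u, y, w, v)` over the times `0, …, L-1` when the inputs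
`u₀ 0, …, u₀ (L-1)` are applied to the plant. -/
def initHist (u₀ : ℕ → Fin nu → ℝ) (d : ℕ → Noise nx ny) : HIdx L nx nu ny → ℝ :=
  Sum.elim
    (Sum.elim (fun k => u₀ k.1 k.2)
      (fun k => (S.C *ᵥ S.initState u₀ d k.1 + (d k.1).v) k.2))
    (Sum.elim (fun k => (d k.1).w k.2) (fun k => (d k.1).v k.2))

variable {L}

/-- `histState K u₀ d s` is the state `h(L + s)` of the closed loop of the history dynamics
`h(t+1) = Θ h(t) + Π_d d(t) + Π_u u(t)`, `t ≥ L`, with `u(t) = K z(t) = K Γ h(t)`. -/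
def histState (K : Matrix (Fin nu) (ZIdx L nu ny) ℝ) (u₀ : ℕ → Fin nu → ℝ)
    (d : ℕ → Noise nx ny) : ℕ → HIdx L nx nu ny → ℝ
  | 0 => S.initHist L u₀ d
  | s + 1 =>
    let h := histState K u₀ d s
    S.histTheta L *ᵥ h + histPid L nx nu ny *ᵥ (d (L + s)).ofLp
      + histPiu L nx nu ny *ᵥ (K *ᵥ (histGamma L nx nu ny *ᵥ h))

/-- The running cost at time `t ≥ L` of the closed loop with the gain `K`, where
`y(t) = Ψ h(t) + v(t)` and `u(t) = K Γ h(t)`. -/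
def histStage (K : Matrix (Fin nu) (ZIdx L nu ny) ℝ) (u₀ : ℕ → Fin nu → ℝ)
    (d : ℕ → Noise nx ny) (t : ℕ) : ℝ :=
  let h := S.histState K u₀ d (t - L)
  S.stage (S.histPsi L *ᵥ h + (d t).v) (K *ᵥ (histGamma L nx nu ny *ᵥ h))

/-- The averages whose limit is `J(K)`: `E[(1/T) ∑_{t=L}^{T} y(t)ᵀQy(t) + u(t)ᵀRu(t)]`. -/
def gainAvg {Ω : Type*} [MeasurableSpace Ω] (P : Measure Ω) (d : ℕ → Ω → Noise nx ny)
    (u₀ : ℕ → Fin nu → ℝ) (K : Matrix (Fin nu) (ZIdx L nu ny) ℝ) (T : ℕ) : ℝ≥0∞ :=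
  avgCost P (fun ω => S.histStage K u₀ (fun t => d t ω)) L T

/-- The cost `J(K)` of an IOH gain: the limit of the averages (the lower limit, which is the limit
whenever the latter exists). -/
def gainCost {Ω : Type*} [MeasurableSpace Ω] (P : Measure Ω) (d : ℕ → Ω → Noise nx ny)
    (u₀ : ℕ → Fin nu → ℝ) (K : Matrix (Fin nu) (ZIdx L nu ny) ℝ) : ℝ≥0∞ :=
  liminf (S.gainAvg P d u₀ K) atTop

end History

end LQGData

end

end IOH

open IOH

/-! Every cost in the statement is compared with one number, `optimalCost S X Y`. It bounds the cost
of the competing controllers from below, the LQG controller attains it, and some stabilizing IOH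
gain produces the same inputs as the LQG controller. That gain is a minimizer, so existence needs no
compactness argument, and any other minimizer has the same cost.

Lower bound. The control Riccati equation completes the square (`integral_stage_eq`): the expected
running cost is a constant, plus a telescoping difference of E xᵀXx, plus the expected square of u -
Fx weighted by R + BᵀXB. Split x into its estimate and the Kalman error e. Since e is orthogonal to
all that the controller knows, that square is at least the one of Fe. For a stabilizing controller
the stationary filter suffices: orthogonality holds in the limit and the telescoping term dies out
(`optimalCost_le_of_isStabilizing`). For an arbitrary linear controller the time-varying filter
gives exact orthogonality; its covariance tends to Y if (A, Vw) is stabilizable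
(`kalmanCov_tendsto`), and E xᵀXx is dominated by the cost itself, which keeps the telescoping term
harmless (`eventually_le_sum_of_dissipation`).

Realization (`exists_stabGain_realizing`). The input window, less its response to the outputs inside
the window, is Oθ, where θ is the controller state at the start of the window and O the
observability matrix of the controller. Observability makes the next input a linear function of this
residual, which fixes the gain on consistent windows. Elsewhere the gain is free, and a deadbeat
extension (`exists_deadbeat`) makes every window consistent after L steps. What remains is the
stable loop of plant and controller, driven by the part of the output window that no plant state
explains. That hidden part evolves by a map independent of the gain, so it decays as soon as one
stabilizing gain exists (`hidden_tendsto`).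

Rebuilt controller. From time L on it applies u = Kz, whatever its initial state (`ofGain_run`).
Under a stabilizing gain all runs obeying this law have the same limiting cost
(`exists_gain_limit`), so both costs agree. -/

namespace IOH

set_option linter.unusedSectionVars false

open LQGData

/-! ### Schur stability: power bounds, driven recursions, Sylvester recursions. -/

section Schur

variable {n p : Type} [Fintype n] [DecidableEq n] [Fintype p] [DecidableEq p]

section Gelfand

attribute [local instance] Matrix.linftyOpNormedRing Matrix.linftyOpNormedAlgebra

theorem norm_entry_le_linftyOp (a : Matrix n n ℂ) (i j : n) : ‖a i j‖ ≤ ‖a‖ := by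
  rw [Matrix.linfty_opNorm_def, ← coe_nnnorm, NNReal.coe_le_coe]
  refine le_trans ?_ (Finset.le_sup (f := fun i => ∑ j, ‖a i j‖₊) (Finset.mem_univ i))
  exact Finset.single_le_sum (f := fun j => ‖a i j‖₊) (fun _ _ => zero_le) (Finset.mem_univ j)

/-- Gelfand's formula gives the bound ρ ^ k for all large k, for any ρ between the spectral radius
and 1; the finitely many other powers only enlarge the constant. -/
theorem exists_norm_pow_le_of_spectrum (a : Matrix n n ℂ) (h : ∀ z ∈ spectrum ℂ a, ‖z‖ < 1) :
    ∃ c ρ : ℝ, 0 ≤ c ∧ 0 ≤ ρ ∧ ρ < 1 ∧ ∀ k, ‖a ^ k‖ ≤ c * ρ ^ k := by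
  classical
  rcases isEmpty_or_nonempty n with hn | hn
  · refine ⟨0, 0, le_rfl, le_rfl, one_pos, fun k => ?_⟩
    have : a ^ k = 0 := Subsingleton.elim _ _
    simp [this]
  have hr : spectralRadius ℂ a < (1 : NNReal) :=
    spectrum.spectralRadius_lt_of_forall_lt a fun z hz => by
      rw [← NNReal.coe_lt_coe]; simpa using h z hz
  obtain ⟨ρ, h1, h2⟩ := ENNReal.lt_iff_exists_nnreal_btwn.1 hr
  have hρ1 : (ρ : ℝ) < 1 := by exact_mod_cast h2
  have hρ0 : (0 : ℝ) < ρ := by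
    have : (0 : ℝ≥0∞) < ρ := lt_of_le_of_lt zero_le h1
    exact_mod_cast this
  have hev := (spectrum.pow_nnnorm_pow_one_div_tendsto_nhds_spectralRadius a).eventually_lt_const h1
  obtain ⟨N, hN⟩ := eventually_atTop.1 hev
  have hb : ∀ k, N + 1 ≤ k → ‖a ^ k‖ ≤ (ρ : ℝ) ^ k := by
    intro k hk
    have hk0 : (k : ℝ) ≠ 0 := by
      have : k ≠ 0 := by omega
      exact_mod_cast this
    have h3 := (hN k (by omega)).le
    have h4 : ((‖a ^ k‖₊ : ℝ≥0∞) ^ (1 / k : ℝ)) ^ (k : ℝ) ≤ (ρ : ℝ≥0∞) ^ (k : ℝ) :=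
      ENNReal.rpow_le_rpow h3 (by positivity)
    rw [← ENNReal.rpow_mul, one_div, inv_mul_cancel₀ hk0, ENNReal.rpow_one,
      ENNReal.rpow_natCast] at h4
    have h5 : ‖a ^ k‖₊ ≤ ρ ^ k := by exact_mod_cast h4
    exact_mod_cast h5
  have hs : ∀ k ∈ Finset.range (N + 1), 0 ≤ ‖a ^ k‖ / (ρ : ℝ) ^ k := fun k _ => by positivity
  refine ⟨1 + ∑ k ∈ Finset.range (N + 1), ‖a ^ k‖ / (ρ : ℝ) ^ k, ρ, ?_, hρ0.le, hρ1, fun k => ?_⟩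
  · have := Finset.sum_nonneg hs
    linarith
  have hk : (0 : ℝ) < (ρ : ℝ) ^ k := by positivity
  rcases lt_or_ge k (N + 1) with hlt | hge
  · have h6 := Finset.single_le_sum hs (Finset.mem_range.2 hlt)
    have h7 : ‖a ^ k‖ = ‖a ^ k‖ / (ρ : ℝ) ^ k * (ρ : ℝ) ^ k := by field_simp
    rw [h7]
    exact mul_le_mul_of_nonneg_right (by linarith) hk.le
  · refine (hb k hge).trans ?_
    have := Finset.sum_nonneg hs
    nlinarith

end Gelfand

theorem IsSchur.exists_pow_bound {M : Matrix n n ℝ} (hM : IsSchur M) :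
    ∃ c ρ : ℝ, 0 ≤ c ∧ 0 ≤ ρ ∧ ρ < 1 ∧ ∀ k i j, |(M ^ k) i j| ≤ c * ρ ^ k := by
  obtain ⟨c, ρ, hc, h0, h1, h⟩ := exists_norm_pow_le_of_spectrum _ hM
  refine ⟨c, ρ, hc, h0, h1, fun k i j => ?_⟩
  refine le_trans (le_of_eq ?_) ((norm_entry_le_linftyOp _ i j).trans (h k))
  have : (M.map (algebraMap ℝ ℂ)) ^ k = (M ^ k).map (algebraMap ℝ ℂ) :=
    (map_pow (algebraMap ℝ ℂ).mapMatrix M k).symm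
  rw [this]
  simp

theorem norm_mulVec_le (M : Matrix n p ℝ) {b : ℝ} (hb : ∀ i j, |M i j| ≤ b) (hb0 : 0 ≤ b)
    (v : p → ℝ) : ‖M *ᵥ v‖ ≤ Fintype.card p * b * ‖v‖ := by
  rw [pi_norm_le_iff_of_nonneg (by positivity)]
  intro i
  calc ‖(M *ᵥ v) i‖ ≤ ∑ j, ‖M i j * v j‖ := norm_sum_le _ _
    _ ≤ ∑ _j : p, b * ‖v‖ := by
        refine Finset.sum_le_sum fun j _ => ?_
        rw [norm_mul]
        exact mul_le_mul (hb i j) (norm_le_pi_norm v j) (norm_nonneg _) hb0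
    _ = _ := by simp; ring

theorem IsSchur.exists_norm_pow_mulVec_le {M : Matrix n n ℝ} (hM : IsSchur M) :
    ∃ c ρ : ℝ, 0 ≤ c ∧ 0 ≤ ρ ∧ ρ < 1 ∧ ∀ k v, ‖M ^ k *ᵥ v‖ ≤ c * ρ ^ k * ‖v‖ := by
  obtain ⟨c, ρ, hc, h0, h1, h⟩ := hM.exists_pow_bound
  refine ⟨Fintype.card n * c, ρ, by positivity, h0, h1, fun k v => ?_⟩
  have := norm_mulVec_le (M ^ k) (h k) (by positivity) v
  rwa [← mul_assoc] at this

/-- On an eigenvector for z, vanishing of M ^ k forces z ^ k → 0. With this entrywise test,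
stability of transposes and Kronecker products is immediate. -/
theorem isSchur_of_entries {M : Matrix n n ℝ}
    (h : ∀ i j, Tendsto (fun k => (M ^ k) i j) atTop (𝓝 0)) : IsSchur M := by
  intro z hz
  rw [← Matrix.spectrum_toLin', ← Module.End.hasEigenvalue_iff_mem_spectrum] at hz
  obtain ⟨v, hv⟩ := hz.exists_hasEigenvector
  have hv0 := hv.2
  have hv1 : M.map (algebraMap ℝ ℂ) *ᵥ v = z • v := by simpa using hv.apply_eq_smul
  have hpow : ∀ k, (M.map (algebraMap ℝ ℂ)) ^ k *ᵥ v = z ^ k • v := by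
    intro k
    induction k with
    | zero => simp
    | succ k ih => rw [pow_succ, ← Matrix.mulVec_mulVec, hv1, Matrix.mulVec_smul, ih, smul_smul,
        pow_succ']
  obtain ⟨i, hi⟩ := Function.ne_iff.1 hv0
  have ht : Tendsto (fun k => z ^ k * v i) atTop (𝓝 0) := by
    have h1 : ∀ k, z ^ k * v i = ∑ j, (((M ^ k) i j : ℝ) : ℂ) * v j := by
      intro k
      have h2 := congrFun (hpow k) i
      have h3 : (M.map (algebraMap ℝ ℂ)) ^ k = (M ^ k).map (algebraMap ℝ ℂ) :=
        (map_pow (algebraMap ℝ ℂ).mapMatrix M k).symm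
      rw [h3] at h2
      simpa [Matrix.mulVec, dotProduct] using h2.symm
    simp_rw [h1]
    have : (0 : ℂ) = ∑ j : n, ((0 : ℝ) : ℂ) * v j := by simp
    rw [this]
    refine tendsto_finsetSum _ fun j _ => Tendsto.mul_const _ ?_
    exact (Complex.continuous_ofReal.tendsto 0).comp (h i j)
  have ht2 : Tendsto (fun k => z ^ k) atTop (𝓝 0) := by
    have := ht.mul_const (v i)⁻¹
    simpa [mul_assoc, mul_inv_cancel₀ hi] using this
  have ht3 := ht2.norm
  simp only [norm_pow, norm_zero] at ht3
  by_contra hcon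
  push Not at hcon
  have : (1 : ℝ) ≤ 0 := ge_of_tendsto' ht3 fun k => one_le_pow₀ hcon
  linarith

theorem isSchur_of_tendsto {M : Matrix n n ℝ}
    (h : ∀ v, Tendsto (fun k => M ^ k *ᵥ v) atTop (𝓝 0)) : IsSchur M := by
  refine isSchur_of_entries fun i j => ?_
  have := tendsto_pi_nhds.1 (h (Pi.single j 1)) i
  simpa using this

theorem isSchur_of_trajectories {M : Matrix n n ℝ}
    (h : ∀ z : ℕ → n → ℝ, (∀ t, z (t + 1) = M *ᵥ z t) → Tendsto z atTop (𝓝 0)) : IsSchur M :=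
  isSchur_of_tendsto fun v => h _ fun t => by rw [pow_succ', Matrix.mulVec_mulVec]

theorem IsSchur.tendsto_pow_entry {M : Matrix n n ℝ} (hM : IsSchur M) (i j : n) :
    Tendsto (fun k => (M ^ k) i j) atTop (𝓝 0) := by
  obtain ⟨c, ρ, hc, h0, h1, h⟩ := hM.exists_pow_bound
  refine squeeze_zero_norm (h · i j) ?_
  simpa using (tendsto_pow_atTop_nhds_zero_of_lt_one h0 h1).const_mul c

theorem IsSchur.transpose {M : Matrix n n ℝ} (hM : IsSchur M) : IsSchur Mᵀ :=
  isSchur_of_entries fun i j => by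
    simpa [← Matrix.transpose_pow] using hM.tendsto_pow_entry j i

theorem kronecker_pow (M : Matrix n n ℝ) (N : Matrix p p ℝ) (k : ℕ) :
    (Matrix.kronecker M N) ^ k = Matrix.kronecker (M ^ k) (N ^ k) := by
  induction k with
  | zero => simp
  | succ k ih =>
    rw [pow_succ, ih, pow_succ, pow_succ]
    exact (Matrix.mul_kronecker_mul _ _ _ _).symm

theorem IsSchur.kronecker {M : Matrix n n ℝ} {N : Matrix p p ℝ} (hM : IsSchur M)
    (hN : IsSchur N) : IsSchur (Matrix.kronecker M N) :=
  isSchur_of_entries fun i j => by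
    simp_rw [kronecker_pow]
    simpa [Matrix.kronecker, Matrix.kroneckerMap_apply] using
      (hM.tendsto_pow_entry i.1 j.1).mul (hN.tendsto_pow_entry i.2 j.2)

theorem recursion_eq_sum {M : Matrix n n ℝ} {z b : ℕ → n → ℝ}
    (hz : ∀ t, z (t + 1) = M *ᵥ z t + b t) (t : ℕ) :
    z t = M ^ t *ᵥ z 0 + ∑ k ∈ Finset.range t, M ^ k *ᵥ b (t - 1 - k) := by
  induction t with
  | zero => simp
  | succ t ih =>
    rw [hz, ih, Finset.sum_range_succ', Matrix.mulVec_add, Matrix.mulVec_mulVec, ← pow_succ',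
      Matrix.mulVec_sum]
    simp only [Matrix.mulVec_mulVec, ← pow_succ', pow_zero, Matrix.one_mulVec,
      Nat.add_sub_cancel, Nat.sub_zero, add_assoc]
    congr 2
    refine Finset.sum_congr rfl fun k _ => ?_
    rw [show t - (k + 1) = t - 1 - k by omega]

/-- Variation of constants, then dominated convergence with a geometric majorant. The limit does not
involve `z 0`; all independence of initial states later on comes from here. -/
theorem IsSchur.tendsto_of_recursion {M : Matrix n n ℝ} (hM : IsSchur M) {b : ℕ → n → ℝ}
    {β : n → ℝ} (hb : Tendsto b atTop (𝓝 β)) {z : ℕ → n → ℝ}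
    (hz : ∀ t, z (t + 1) = M *ᵥ z t + b t) :
    Tendsto z atTop (𝓝 (∑' k, M ^ k *ᵥ β)) := by
  obtain ⟨c, ρ, hc, h0, h1, h⟩ := hM.exists_norm_pow_mulVec_le
  have hpow := tendsto_pow_atTop_nhds_zero_of_lt_one h0 h1
  obtain ⟨B, hB⟩ : ∃ B, ∀ t, ‖b t‖ ≤ B := by
    obtain ⟨B, hB⟩ := hb.norm.bddAbove_range
    exact ⟨B, fun t => hB ⟨t, rfl⟩⟩
  have hB0 : 0 ≤ B := (norm_nonneg _).trans (hB 0)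
  have e1 : z = fun t => M ^ t *ᵥ z 0 +
      ∑' k, if k < t then M ^ k *ᵥ b (t - 1 - k) else 0 := by
    funext t
    rw [recursion_eq_sum hz t, tsum_eq_sum (s := Finset.range t)]
    · congr 1
      refine Finset.sum_congr rfl fun k hk => ?_
      rw [if_pos (Finset.mem_range.1 hk)]
    · intro k hk
      rw [if_neg (by simpa using hk)]
  have t1 : Tendsto (fun t => M ^ t *ᵥ z 0) atTop (𝓝 0) := by
    refine squeeze_zero_norm (fun t => h t (z 0)) ?_
    simpa using (hpow.const_mul c).mul_const ‖z 0‖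
  have t2 : Tendsto (fun t => ∑' k, if k < t then M ^ k *ᵥ b (t - 1 - k) else 0) atTop
      (𝓝 (∑' k, M ^ k *ᵥ β)) := by
    refine tendsto_tsum_of_dominated_convergence (bound := fun k => c * B * ρ ^ k)
      ((summable_geometric_of_lt_one h0 h1).mul_left _) (fun k => ?_) (Eventually.of_forall ?_)
    · have hcont : Continuous fun v : n → ℝ => M ^ k *ᵥ v := by fun_prop
      have h3 : Tendsto (fun t => M ^ k *ᵥ b (t - (1 + k))) atTop (𝓝 (M ^ k *ᵥ β)) :=
        (hcont.tendsto β).comp (hb.comp (tendsto_sub_atTop_nat (1 + k)))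
      refine h3.congr' ?_
      filter_upwards [eventually_gt_atTop k] with t ht
      rw [if_pos ht, Nat.sub_sub]
    · intro t k
      split_ifs
      · refine (h k _).trans ?_
        have := mul_le_mul_of_nonneg_left (hB (t - 1 - k)) (by positivity : 0 ≤ c * ρ ^ k)
        linarith
      · simp; positivity
  rw [e1]
  simpa using t1.add t2

theorem IsSchur.tendsto_zero_of_recursion {M : Matrix n n ℝ} (hM : IsSchur M) {b : ℕ → n → ℝ}
    (hb : Tendsto b atTop (𝓝 0)) {z : ℕ → n → ℝ} (hz : ∀ t, z (t + 1) = M *ᵥ z t + b t) :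
    Tendsto z atTop (𝓝 0) := by
  simpa using hM.tendsto_of_recursion hb hz

/-- Stacking columns turns X ↦ M X Nᵀ into a Kronecker product, which is again Schur. The limit is
quantified first: it depends neither on the start nor on how the forcing approaches V. -/
theorem IsSchur.exists_tendsto_sylvester {M : Matrix n n ℝ} {N : Matrix p p ℝ} (hM : IsSchur M)
    (hN : IsSchur N) (V : Matrix n p ℝ) :
    ∃ Z : Matrix n p ℝ, ∀ W X : ℕ → Matrix n p ℝ, Tendsto W atTop (𝓝 V) →
      (∀ t, X (t + 1) = M * X t * Nᵀ + W t) → Tendsto X atTop (𝓝 Z) := by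
  refine ⟨Matrix.of fun i j => (∑' k, (Matrix.kronecker N M) ^ k *ᵥ V.vec) (j, i),
    fun W X hW hX => ?_⟩
  have h1 : Tendsto (fun t => (W t).vec) atTop (𝓝 V.vec) := by
    rw [tendsto_pi_nhds]
    rintro ⟨j, i⟩
    exact tendsto_pi_nhds.1 (tendsto_pi_nhds.1 hW i) j
  have h2 := (hN.kronecker hM).tendsto_of_recursion h1 (z := fun t => (X t).vec) (fun t => by
    rw [hX, Matrix.vec_add]
    congr 1
    exact (Matrix.kronecker_mulVec_vec M (X t) N).symm)
  refine tendsto_pi_nhds.2 fun i => tendsto_pi_nhds.2 fun j => ?_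
  exact tendsto_pi_nhds.1 h2 (j, i)

/-- The constant sequence Y is one of the solutions, and all solutions share their limit. -/
theorem IsSchur.tendsto_sylvester_of_fixed {M : Matrix n n ℝ} {N : Matrix p p ℝ} (hM : IsSchur M)
    (hN : IsSchur N) {V Y : Matrix n p ℝ} (hY : Y = M * Y * Nᵀ + V) {W X : ℕ → Matrix n p ℝ}
    (hW : Tendsto W atTop (𝓝 V)) (hX : ∀ t, X (t + 1) = M * X t * Nᵀ + W t) :
    Tendsto X atTop (𝓝 Y) := by
  obtain ⟨Z, hZ⟩ := hM.exists_tendsto_sylvester hN V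
  have h1 := hZ _ (fun _ => Y) tendsto_const_nhds fun _ => hY
  rw [tendsto_nhds_unique tendsto_const_nhds h1]
  exact hZ _ _ hW hX

end Schur

/-! ### Shift registers, windows of signals, and residuals of a window. -/

section Windows

variable {n p q : Type} [Fintype n] [DecidableEq n] [Fintype p] [DecidableEq p]
  [Fintype q] [DecidableEq q] {L : ℕ}

/-- The stack of the `L` values of a signal from time `t` on. -/
def stack (L : ℕ) (s : ℕ → p → ℝ) (t : ℕ) : Fin L × p → ℝ := fun k => s (t + k.1) k.2

theorem shiftMat_mulVec (f : Fin L × p → ℝ) (k : Fin L × p) :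
    (shiftMat L p *ᵥ f) k = if h : (k.1 : ℕ) + 1 < L then f (⟨k.1 + 1, h⟩, k.2) else 0 := by
  simp only [Matrix.mulVec, dotProduct, shiftMat, Matrix.of_apply, ite_mul, one_mul, zero_mul]
  split_ifs with h
  · rw [Finset.sum_eq_single (⟨(k.1 : ℕ) + 1, h⟩, k.2)]
    · simp
    · rintro ⟨l, b⟩ - hne
      rw [if_neg]
      rintro ⟨h1, h2⟩
      exact hne (Prod.ext (Fin.ext h1.symm) h2.symm)
    · simp
  · refine Finset.sum_eq_zero fun l _ => if_neg ?_
    rintro ⟨h1, -⟩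
    have := l.1.2
    omega

theorem shiftMat_transpose_mulVec (f : Fin L × p → ℝ) (k : Fin L × p) :
    ((shiftMat L p)ᵀ *ᵥ f) k =
      if h : 0 < (k.1 : ℕ) then f (⟨k.1 - 1, by omega⟩, k.2) else 0 := by
  simp only [Matrix.mulVec, dotProduct, shiftMat, Matrix.of_apply, ite_mul, one_mul, zero_mul,
    Matrix.transpose_apply]
  split_ifs with h
  · rw [Finset.sum_eq_single (⟨(k.1 : ℕ) - 1, by omega⟩, k.2)]
    · rw [if_pos]
      exact ⟨by simp; omega, rfl⟩
    · rintro ⟨l, b⟩ - hne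
      rw [if_neg]
      rintro ⟨h1, h2⟩
      refine hne (Prod.ext (Fin.ext ?_) h2)
      simp only at h1 ⊢
      omega
    · simp
  · refine Finset.sum_eq_zero fun l _ => if_neg ?_
    rintro ⟨h1, -⟩
    omega

theorem lastMat_mulVec (a : p → ℝ) (k : Fin L × p) :
    (lastMat L p *ᵥ a) k = if (k.1 : ℕ) + 1 = L then a k.2 else 0 := by
  simp only [Matrix.mulVec, dotProduct, lastMat, Matrix.of_apply, ite_mul, one_mul, zero_mul]
  split_ifs with h <;> simp [h]

theorem stack_succ (s : ℕ → p → ℝ) (t : ℕ) :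
    stack L s (t + 1) = shiftMat L p *ᵥ stack L s t + lastMat L p *ᵥ s (t + L) := by
  funext ⟨k, a⟩
  rw [Pi.add_apply, shiftMat_mulVec, lastMat_mulVec]
  have := k.2
  by_cases h : (k : ℕ) + 1 < L
  · have h2 : ¬ ((k : ℕ) + 1 = L) := by omega
    simp [h, h2, stack, add_assoc, add_comm 1]
  · have h2 : (k : ℕ) + 1 = L := by omega
    rw [dif_neg h, if_pos h2, zero_add]
    change s (t + 1 + k) a = s (t + L) a
    rw [show t + 1 + (k : ℕ) = t + L by omega]

/-- The windows of a shift register with inputs `a` are the stacks of its first block. -/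
theorem eq_stack_of_shift (hL : 0 < L) {f : ℕ → Fin L × p → ℝ} {a : ℕ → p → ℝ}
    (hf : ∀ s, f (s + 1) = shiftMat L p *ᵥ f s + lastMat L p *ᵥ a s) :
    (∀ s, f s = stack L (fun s b => f s (⟨0, hL⟩, b)) s) ∧
      ∀ s, (fun b => f (s + L) (⟨0, hL⟩, b)) = a s := by
  have hshift : ∀ (k : ℕ) (hk : k < L) (s : ℕ) (b : p), f s (⟨k, hk⟩, b) = f (s + k) (⟨0, hL⟩, b) := by
    intro k
    induction k with
    | zero => intros; rfl
    | succ k ih =>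
      intro hk s b
      rw [show s + (k + 1) = (s + 1) + k by ring, ← ih (by omega), hf, Pi.add_apply,
        shiftMat_mulVec, lastMat_mulVec]
      simp only [hk, dite_true]
      rw [if_neg (by omega), add_zero]
  refine ⟨fun s => funext fun ⟨k, b⟩ => hshift k k.2 s b, fun s => funext fun b => ?_⟩
  have h1 := hshift (L - 1) (by omega) (s + 1) b
  rw [show s + 1 + (L - 1) = s + L by omega] at h1
  rw [← h1, hf, Pi.add_apply, shiftMat_mulVec, lastMat_mulVec]
  simp only
  rw [dif_neg (by omega), if_pos (by omega), zero_add]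

theorem state_add {A : Matrix n n ℝ} {x g : ℕ → n → ℝ} (hx : ∀ t, x (t + 1) = A *ᵥ x t + g t)
    (t i : ℕ) :
    x (t + i) = A ^ i *ᵥ x t + ∑ j ∈ Finset.range i, A ^ (i - 1 - j) *ᵥ g (t + j) := by
  induction i with
  | zero => simp
  | succ i ih =>
    rw [← add_assoc, hx, ih, Finset.sum_range_succ, Matrix.mulVec_add, Matrix.mulVec_mulVec,
      ← pow_succ', Matrix.mulVec_sum, add_assoc]
    simp only [Nat.add_sub_cancel, Nat.sub_self, pow_zero, Matrix.one_mulVec]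
    congr 2
    refine Finset.sum_congr rfl fun j hj => ?_
    have := Finset.mem_range.1 hj
    rw [Matrix.mulVec_mulVec, ← pow_succ', show i - 1 - j + 1 = i - j by omega]

theorem sum_stack {m : Type} (t : ℕ) (s : ℕ → p → ℝ) (N : ℕ → Matrix m p ℝ) (a : m) :
    ∑ k : Fin L × p, N k.1 a k.2 * stack L s t k
      = (∑ j ∈ Finset.range L, N j *ᵥ s (t + j)) a := by
  rw [Fintype.sum_prod_type, Finset.sum_apply, Finset.sum_range]
  rfl

theorem reachMat_mulVec_stack (A : Matrix n n ℝ) (B : Matrix n p ℝ) (s : ℕ → p → ℝ) (t : ℕ) :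
    reachMat L A B *ᵥ stack L s t
      = ∑ j ∈ Finset.range L, A ^ (L - 1 - j) *ᵥ (B *ᵥ s (t + j)) := by
  funext a
  simp only [Matrix.mulVec_mulVec]
  exact sum_stack t s (fun j => A ^ (L - 1 - j) * B) a

theorem toepMat_mulVec_stack (A : Matrix n n ℝ) (B : Matrix n p ℝ) (C : Matrix q n ℝ)
    (s : ℕ → p → ℝ) (t : ℕ) (k : Fin L × q) :
    (toepMat L A B C *ᵥ stack L s t) k
      = (C *ᵥ ∑ j ∈ Finset.range k.1, A ^ ((k.1 : ℕ) - 1 - j) *ᵥ (B *ᵥ s (t + j))) k.2 := by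
  have h1 : (toepMat L A B C *ᵥ stack L s t) k = ∑ l : Fin L × p,
      (if (l.1 : ℕ) < k.1 then C * A ^ ((k.1 : ℕ) - l.1 - 1) * B else 0) k.2 l.2
        * stack L s t l := by
    refine Finset.sum_congr rfl fun l _ => ?_
    simp only [toepMat, Matrix.of_apply, Fin.lt_def]
    split_ifs <;> rfl
  rw [h1, sum_stack t s
    (fun j => if j < (k.1 : ℕ) then C * A ^ ((k.1 : ℕ) - j - 1) * B else 0) k.2]
  refine congrFun (Eq.trans ?_ (Matrix.mulVec_sum ..).symm) k.2
  have h2 : ∑ j ∈ Finset.range (k.1 : ℕ),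
      (if j < (k.1 : ℕ) then C * A ^ ((k.1 : ℕ) - j - 1) * B else 0) *ᵥ s (t + j)
      = ∑ j ∈ Finset.range L,
        (if j < (k.1 : ℕ) then C * A ^ ((k.1 : ℕ) - j - 1) * B else 0) *ᵥ s (t + j) := by
    refine Finset.sum_subset (fun j hj => Finset.mem_range.2
      ((Finset.mem_range.1 hj).trans k.1.2)) fun j _ hj => ?_
    rw [if_neg (by simpa using hj), Matrix.zero_mulVec]
  rw [← h2]
  refine Finset.sum_congr rfl fun j hj => ?_
  rw [if_pos (Finset.mem_range.1 hj), Matrix.mulVec_mulVec, Matrix.mulVec_mulVec,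
    Nat.sub_right_comm]

theorem toepMat_mulVec_zero_block (hL : 0 < L) (A : Matrix n n ℝ) (B : Matrix n p ℝ)
    (C : Matrix q n ℝ) (f : Fin L × p → ℝ) (b : q) :
    (toepMat L A B C *ᵥ f) (⟨0, hL⟩, b) = 0 := by
  refine Finset.sum_eq_zero fun l _ => ?_
  have h : ¬ l.1 < (⟨0, hL⟩ : Fin L) := fun h => Nat.not_lt_zero _ h
  simp only [toepMat, Matrix.of_apply]
  rw [if_neg h, zero_mul]

theorem obsMat_mulVec (A : Matrix n n ℝ) (C : Matrix q n ℝ) (x : n → ℝ) (k : Fin L × q) :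
    (obsMat L A C *ᵥ x) k = (C *ᵥ (A ^ (k.1 : ℕ) *ᵥ x)) k.2 := by
  rw [Matrix.mulVec_mulVec]; rfl

/-- Sliding a window of free outputs amounts to advancing the state by A. Thus O intertwines the
window maps used below with the system matrix. -/
theorem shift_obsMat (A : Matrix n n ℝ) (C : Matrix q n ℝ) (x : n → ℝ) :
    shiftMat L q *ᵥ (obsMat L A C *ᵥ x) + lastMat L q *ᵥ (C *ᵥ (A ^ L *ᵥ x))
      = obsMat L A C *ᵥ (A *ᵥ x) := by
  funext k
  rw [Pi.add_apply, shiftMat_mulVec, lastMat_mulVec, obsMat_mulVec,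
    Matrix.mulVec_mulVec x (A ^ (k.1 : ℕ)) A, ← pow_succ]
  have := k.1.2
  by_cases h : (k.1 : ℕ) + 1 < L
  · rw [dif_pos h, if_neg (by omega), obsMat_mulVec, add_zero]
  · have h2 : (k.1 : ℕ) + 1 = L := by omega
    rw [dif_neg h, if_pos h2, h2, zero_add]

/-- The Gram matrix of O has the rank of O, hence is invertible, so the Penrose inverse is a left
inverse. -/
theorem pinv_obsMat_mul {A : Matrix n n ℝ} {C : Matrix q n ℝ} (h : IsStepObservable L A C) :
    pinv (obsMat L A C) * obsMat L A C = 1 := by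
  have hu : IsUnit ((obsMat L A C)ᵀ * obsMat L A C).det := by
    rw [← Matrix.isUnit_iff_isUnit_det, ← Matrix.mulVec_surjective_iff_isUnit]
    have hr : ((obsMat L A C)ᵀ * obsMat L A C).rank = Fintype.card n := by
      rw [Matrix.rank_transpose_mul_self]; exact h
    have ht : LinearMap.range ((obsMat L A C)ᵀ * obsMat L A C).mulVecLin = ⊤ :=
      Submodule.eq_top_of_finrank_eq (by
        rw [← Matrix.rank, hr, Module.finrank_fintype_fun_eq_card])
    exact LinearMap.range_eq_top.1 ht
  rw [pinv_eq_of_isUnit hu, Matrix.mul_assoc, Matrix.nonsing_inv_mul _ hu]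

theorem eq_zero_of_obsMat_mulVec {A : Matrix n n ℝ} {C : Matrix q n ℝ}
    (h : IsStepObservable L A C) {x : n → ℝ} (hx : obsMat L A C *ᵥ x = 0) : x = 0 := by
  have h1 : (pinv (obsMat L A C) * obsMat L A C) *ᵥ x = 0 := by
    rw [← Matrix.mulVec_mulVec, hx, Matrix.mulVec_zero]
  rwa [pinv_obsMat_mul h, Matrix.one_mulVec] at h1

/-- The part of the output window which is not explained by the inputs within the window. -/
def resid (L : ℕ) (A : Matrix n n ℝ) (B : Matrix n p ℝ) (C : Matrix q n ℝ) (a : ℕ → p → ℝ)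
    (b : ℕ → q → ℝ) (t : ℕ) : Fin L × q → ℝ :=
  stack L b t - toepMat L A B C *ᵥ stack L a t

/-- An identity for arbitrary signals, without any system equation. The old residual had the
response to `a t` subtracted; that input leaves the window, and the term with O puts its response
back. -/
theorem resid_succ (A : Matrix n n ℝ) (B : Matrix n p ℝ) (C : Matrix q n ℝ) (a : ℕ → p → ℝ)
    (b : ℕ → q → ℝ) (t : ℕ) :
    resid L A B C a b (t + 1) = shiftMat L q *ᵥ resid L A B C a b t
      + lastMat L q *ᵥ (b (t + L) - C *ᵥ (reachMat L A B *ᵥ stack L a t))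
      + obsMat L A C *ᵥ (B *ᵥ a t) := by
  have key : ∀ i : ℕ, ∑ j ∈ Finset.range (i + 1), A ^ (i - j) *ᵥ (B *ᵥ a (t + j))
      = A ^ i *ᵥ (B *ᵥ a t)
        + ∑ j ∈ Finset.range i, A ^ (i - 1 - j) *ᵥ (B *ᵥ a (t + 1 + j)) := by
    intro i
    rw [Finset.sum_range_succ', add_comm]
    simp only [Nat.sub_zero, add_zero]
    congr 1
    refine Finset.sum_congr rfl fun j _ => ?_
    rw [show i - (j + 1) = i - 1 - j by omega, show t + (j + 1) = t + 1 + j by ring]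
  funext k
  have hk := key k.1
  rw [Pi.add_apply, Pi.add_apply, shiftMat_mulVec, lastMat_mulVec, obsMat_mulVec]
  simp only [resid, Pi.sub_apply, toepMat_mulVec_stack, reachMat_mulVec_stack]
  have := k.1.2
  by_cases h : (k.1 : ℕ) + 1 < L
  · rw [dif_pos h, if_neg (by omega)]
    simp only [Nat.add_sub_cancel, hk, Matrix.mulVec_add, Pi.add_apply, stack]
    rw [show t + ((k.1 : ℕ) + 1) = t + 1 + k.1 by ring]
    ring
  · have h2 : (k.1 : ℕ) + 1 = L := by omega
    rw [dif_neg h, if_pos h2]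
    simp only [← h2, Nat.add_sub_cancel, hk, Matrix.mulVec_add, Pi.add_apply, stack]
    rw [show t + ((k.1 : ℕ) + 1) = t + 1 + k.1 by ring]
    ring

/-- Outputs of a system without output noise over a window. -/
theorem resid_eq_of_run {A : Matrix n n ℝ} {B : Matrix n p ℝ} {C : Matrix q n ℝ} {x : ℕ → n → ℝ}
    {a : ℕ → p → ℝ} {b : ℕ → q → ℝ} (hx : ∀ t, x (t + 1) = A *ᵥ x t + B *ᵥ a t)
    (hb : ∀ t, b t = C *ᵥ x t) (t : ℕ) :
    resid L A B C a b t = obsMat L A C *ᵥ x t := by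
  funext k
  rw [resid, Pi.sub_apply, toepMat_mulVec_stack, obsMat_mulVec, stack, hb,
    state_add (g := fun t => B *ᵥ a t) hx, Matrix.mulVec_add]
  simp

theorem run_add_eq {A : Matrix n n ℝ} {B : Matrix n p ℝ} {x : ℕ → n → ℝ} {a : ℕ → p → ℝ}
    (hx : ∀ t, x (t + 1) = A *ᵥ x t + B *ᵥ a t) (t : ℕ) :
    x (t + L) = A ^ L *ᵥ x t + reachMat L A B *ᵥ stack L a t := by
  rw [state_add (g := fun t => B *ᵥ a t) hx, reachMat_mulVec_stack]

end Windows

/-! ### Histories of plant runs and the feedback law of the rebuilt controller. -/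

section Histories

variable {nx nu ny : ℕ} (S : LQGData nx nu ny) {L : ℕ}

/-- The history over the times `t, …, t + L - 1`. -/
def histOf (L : ℕ) (u : ℕ → Fin nu → ℝ) (y : ℕ → Fin ny → ℝ) (w : ℕ → Fin nx → ℝ)
    (v : ℕ → Fin ny → ℝ) (t : ℕ) : HIdx L nx nu ny → ℝ :=
  Sum.elim (Sum.elim (stack L u t) (stack L y t)) (Sum.elim (stack L w t) (stack L v t))

theorem sum_elim_add {α β : Type} (a a' : α → ℝ) (b b' : β → ℝ) :
    Sum.elim a b + Sum.elim a' b' = Sum.elim (a + a') (b + b') := by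
  funext i; cases i <;> rfl

/-- The history contains the noise, so removing the responses to u, w and v from the output window
leaves O x(t) exactly. The left inverse recovers x(t), and the remaining blocks propagate it over L
steps. -/
theorem histM_mulVec_histOf (hobs : IsStepObservable L S.A S.C) {x : ℕ → Fin nx → ℝ}
    {u : ℕ → Fin nu → ℝ} {y : ℕ → Fin ny → ℝ} {w : ℕ → Fin nx → ℝ} {v : ℕ → Fin ny → ℝ}
    (hx : ∀ t, x (t + 1) = S.A *ᵥ x t + S.B *ᵥ u t + w t) (hy : ∀ t, y t = S.C *ᵥ x t + v t)
    (t : ℕ) : S.histM L *ᵥ histOf L u y w v t = x (t + L) := by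
  have hx' : ∀ t, x (t + 1) = S.A *ᵥ x t + (S.B *ᵥ u t + w t) := fun t => by
    rw [hx, add_assoc]
  have h1 : stack L y t = obsMat L S.A S.C *ᵥ x t + toepMat L S.A S.B S.C *ᵥ stack L u t
      + toepMat L S.A 1 S.C *ᵥ stack L w t + stack L v t := by
    funext k
    rw [Pi.add_apply, Pi.add_apply, Pi.add_apply, toepMat_mulVec_stack, toepMat_mulVec_stack,
      obsMat_mulVec]
    simp only [stack, hy, Matrix.one_mulVec]
    rw [state_add hx', ← Pi.add_apply, ← Pi.add_apply, ← Matrix.mulVec_add, ← Matrix.mulVec_add,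
      add_assoc, ← Finset.sum_add_distrib]
    simp only [Matrix.mulVec_add, Pi.add_apply]
  have h2 : x (t + L) = S.A ^ L *ᵥ x t + reachMat L S.A S.B *ᵥ stack L u t
      + reachMat L S.A 1 *ᵥ stack L w t := by
    rw [reachMat_mulVec_stack, reachMat_mulVec_stack, state_add hx', add_assoc,
      ← Finset.sum_add_distrib]
    simp only [Matrix.mulVec_add, Matrix.one_mulVec]
  have h3 : x t = pinv (obsMat L S.A S.C) *ᵥ (obsMat L S.A S.C *ᵥ x t) := by
    rw [Matrix.mulVec_mulVec, pinv_obsMat_mul hobs, Matrix.one_mulVec]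
  rw [h2]
  conv_rhs => rw [h3]
  simp only [LQGData.histM, histOf, Matrix.fromCols_mulVec_sumElim, h1, Matrix.sub_mulVec,
    Matrix.neg_mulVec, Matrix.mulVec_add, Matrix.mulVec_mulVec, Matrix.mul_assoc]
  abel

theorem histGamma_mulVec (f : ZIdx L nu ny → ℝ) (g : (Fin L × Fin nx) ⊕ (Fin L × Fin ny) → ℝ) :
    histGamma L nx nu ny *ᵥ Sum.elim f g = f := by
  simp [histGamma]

theorem histTheta_mulVec (a : Fin L × Fin nu → ℝ) (b : Fin L × Fin ny → ℝ) (c : Fin L × Fin nx → ℝ)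
    (e : Fin L × Fin ny → ℝ) :
    S.histTheta L *ᵥ Sum.elim (Sum.elim a b) (Sum.elim c e)
      = Sum.elim (Sum.elim (shiftMat L (Fin nu) *ᵥ a) (shiftMat L (Fin ny) *ᵥ b
          + lastMat L (Fin ny) *ᵥ (S.histPsi L *ᵥ Sum.elim (Sum.elim a b) (Sum.elim c e))))
        (Sum.elim (shiftMat L (Fin nx) *ᵥ c) (shiftMat L (Fin ny) *ᵥ e)) := by
  simp only [histTheta, Matrix.add_mulVec, Matrix.fromBlocks_mulVec, Matrix.fromRows_mulVec,
    Sum.elim_comp_inl, Sum.elim_comp_inr, Matrix.zero_mulVec, add_zero, zero_add, sum_elim_add,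
    Matrix.mulVec_mulVec]

theorem histPid_mulVec (δ : Fin nx ⊕ Fin ny → ℝ) :
    histPid L nx nu ny *ᵥ δ
      = Sum.elim (Sum.elim (0 : Fin L × Fin nu → ℝ) (lastMat L (Fin ny) *ᵥ (δ ∘ Sum.inr)))
        (Sum.elim (lastMat L (Fin nx) *ᵥ (δ ∘ Sum.inl))
          (lastMat L (Fin ny) *ᵥ (δ ∘ Sum.inr))) := by
  conv_lhs => rw [← Sum.elim_comp_inl_inr δ]
  simp only [histPid, Matrix.fromBlocks_mulVec, Matrix.fromRows_mulVec,
    Matrix.fromCols_mulVec_sumElim, Sum.elim_comp_inl, Sum.elim_comp_inr, Matrix.zero_mulVec,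
    add_zero, zero_add]

theorem histPiu_mulVec (a : Fin nu → ℝ) :
    histPiu L nx nu ny *ᵥ a
      = Sum.elim (Sum.elim (lastMat L (Fin nu) *ᵥ a) 0) (Sum.elim 0 0) := by
  simp only [histPiu, Matrix.fromRows_mulVec, Matrix.zero_mulVec]
  congr 1
  funext i; cases i <;> rfl

/-- Only the output equation at time t + L enters, everything else is shifting. The signals need not
come from a plant run, which matters for histories that the plant cannot produce. -/
theorem histOf_succ {u : ℕ → Fin nu → ℝ} {y : ℕ → Fin ny → ℝ} {δ : ℕ → Fin nx ⊕ Fin ny → ℝ}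
    (t : ℕ) (hy : y (t + L) = S.histPsi L *ᵥ histOf L u y (fun t => δ t ∘ Sum.inl)
      (fun t => δ t ∘ Sum.inr) t + δ (t + L) ∘ Sum.inr) :
    histOf L u y (fun t => δ t ∘ Sum.inl) (fun t => δ t ∘ Sum.inr) (t + 1)
      = S.histTheta L *ᵥ histOf L u y (fun t => δ t ∘ Sum.inl) (fun t => δ t ∘ Sum.inr) t
        + histPid L nx nu ny *ᵥ δ (t + L) + histPiu L nx nu ny *ᵥ u (t + L) := by
  rw [histOf, histOf, histTheta_mulVec, histPid_mulVec, histPiu_mulVec]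
  simp only [sum_elim_add, stack_succ]
  rw [← histOf, hy, Matrix.mulVec_add]
  simp [add_assoc]

theorem tendsto_sum_elim {α β : Type} {a : ℕ → α → ℝ} {b : ℕ → β → ℝ}
    (ha : Tendsto a atTop (𝓝 0)) (hb : Tendsto b atTop (𝓝 0)) :
    Tendsto (fun t => Sum.elim (a t) (b t)) atTop (𝓝 0) := by
  rw [tendsto_pi_nhds] at ha hb ⊢
  rintro (i | i)
  · exact ha i
  · exact hb i

theorem tendsto_stack {p : Type} {a : ℕ → p → ℝ} (ha : Tendsto a atTop (𝓝 0)) :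
    Tendsto (fun t => stack L a t) atTop (𝓝 0) := by
  rw [tendsto_pi_nhds] at ha ⊢
  intro k
  exact (ha k.2).comp (tendsto_add_atTop_nat k.1)

theorem tendsto_mulVec_zero {m n : Type} [Fintype n] (M : Matrix m n ℝ) {a : ℕ → n → ℝ}
    (ha : Tendsto a atTop (𝓝 0)) : Tendsto (fun t => M *ᵥ a t) atTop (𝓝 0) := by
  have hc : Continuous fun v : n → ℝ => M *ᵥ v := by fun_prop
  simpa [Function.comp_def] using (hc.tendsto 0).comp ha

theorem ofGain_F_mulVec (hL : 0 < L) (K : Matrix (Fin nu) (ZIdx L nu ny) ℝ)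
    (f : Fin L × Fin nu → ℝ) (b : Fin nu) :
    ((DynController.ofGain K).F *ᵥ f) b = f (⟨L - 1, by omega⟩, b) := by
  change ((lastMat L (Fin nu))ᵀ *ᵥ f) b = _
  simp only [Matrix.mulVec, dotProduct, lastMat, Matrix.of_apply, ite_mul, one_mul, zero_mul,
    Matrix.transpose_apply]
  rw [Finset.sum_eq_single (⟨L - 1, by omega⟩, b)]
  · rw [if_pos ⟨by simp only; omega, rfl⟩]
  · rintro ⟨l, b'⟩ - hne
    rw [if_neg]
    rintro ⟨h1, h2⟩
    refine hne (Prod.ext (Fin.ext ?_) h2)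
    simp only at h1 ⊢
    omega
  · simp

/-- The contribution of the `j`-th block of `K` to the input, for values `u s` and `y s`. -/
def gainTerm (K : Matrix (Fin nu) (ZIdx L nu ny) ℝ) (u : ℕ → Fin nu → ℝ) (y : ℕ → Fin ny → ℝ)
    (j s : ℕ) (a : Fin nu) : ℝ :=
  if h : j < L then ∑ b, K a (Sum.inl (⟨j, h⟩, b)) * u s b + ∑ b, K a (Sum.inr (⟨j, h⟩, b)) * y s b
  else 0

theorem ofGain_step (hL : 0 < L) (K : Matrix (Fin nu) (ZIdx L nu ny) ℝ)
    {ξ : ℕ → Fin L × Fin nu → ℝ} {y : ℕ → Fin ny → ℝ}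
    (hξ : ∀ t, ξ (t + 1) = (DynController.ofGain K).G *ᵥ ξ t + (DynController.ofGain K).H *ᵥ y t)
    (t : ℕ) (k : Fin L × Fin nu) :
    ξ (t + 1) k = (if h : 0 < (k.1 : ℕ) then ξ t (⟨k.1 - 1, by omega⟩, k.2) else 0)
      + (∑ b, K k.2 (Sum.inl (k.1, b)) * ξ t (⟨L - 1, by omega⟩, b)
        + ∑ b, K k.2 (Sum.inr (k.1, b)) * y t b) := by
  rw [hξ, Pi.add_apply, DynController.ofGain, Matrix.add_mulVec, Pi.add_apply,
    shiftMat_transpose_mulVec, add_assoc]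
  congr 2
  simp only [Matrix.mulVec, dotProduct, Matrix.of_apply, Fintype.sum_prod_type]
  rw [Finset.sum_eq_single (⟨L - 1, by omega⟩ : Fin L)]
  · refine Finset.sum_congr rfl fun b _ => ?_
    rw [if_pos (by simp only; omega)]
  · intro l _ hl
    refine Finset.sum_eq_zero fun b _ => ?_
    rw [if_neg, zero_mul]
    intro h
    exact hl (Fin.ext (by simp only; omega))
  · simp

/-- The controller rebuilt from `K` applies the feedback `u = K z` from time `L` on. -/
theorem ofGain_run (K : Matrix (Fin nu) (ZIdx L nu ny) ℝ) {ξ : ℕ → Fin L × Fin nu → ℝ}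
    {y : ℕ → Fin ny → ℝ}
    (hξ : ∀ t, ξ (t + 1) = (DynController.ofGain K).G *ᵥ ξ t + (DynController.ofGain K).H *ᵥ y t)
    {u : ℕ → Fin nu → ℝ} (hu : ∀ t, u t = (DynController.ofGain K).F *ᵥ ξ t) (t : ℕ) :
    u (t + L) = K *ᵥ Sum.elim (stack L u t) (stack L y t) := by
  rcases Nat.eq_zero_or_pos L with rfl | hL
  · rw [hu]
    funext a
    rw [Matrix.mulVec, Matrix.mulVec, dotProduct, dotProduct, Fintype.sum_empty, Fintype.sum_empty]
  have hu' : ∀ t b, ξ t (⟨L - 1, by omega⟩, b) = u t b := by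
    intro t b
    rw [hu, ofGain_F_mulVec hL]
  have hstep := ofGain_step hL K hξ
  -- At time t + i + 1, block i has collected the terms of the blocks 0, …, i for the times t, …, t
  -- + i. The initial content has been shifted out by then, so the law holds for every initial
  -- state.
  have hclaim : ∀ (i : ℕ) (hi : i < L) (a : Fin nu),
      ξ (t + i + 1) (⟨i, hi⟩, a) = ∑ j ∈ Finset.range (i + 1), gainTerm K u y j (t + j) a := by
    intro i
    induction i with
    | zero =>
      intro hi a
      rw [hstep, dif_neg (by simp)]
      simp [gainTerm, hi, hu']
    | succ i ih =>
      intro hi a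
      rw [hstep, dif_pos (by simp), Finset.sum_range_succ, ← ih (by omega)]
      simp only [Nat.add_sub_cancel, ← add_assoc]
      simp [gainTerm, hi, hu', add_assoc]
  funext a
  rw [← hu', show t + L = t + (L - 1) + 1 by omega, hclaim, Nat.sub_add_cancel hL]
  simp only [Finset.sum_range, gainTerm, Fin.is_lt, dite_true, Fin.eta]
  simp only [Matrix.mulVec, dotProduct, Fintype.sum_sum_type, Fintype.sum_prod_type, Sum.elim_inl,
    Sum.elim_inr, Finset.sum_add_distrib, stack]

end Histories

/-! ### Internal stability of the rebuilt controller and of the LQG controller. -/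

section Stabilizing

variable {nx nu ny : ℕ} (S : LQGData nx nu ny) {L : ℕ}

/-- Noise-free histories under an IOH gain. -/
theorem histOf_succ_of_gain {u : ℕ → Fin nu → ℝ} {y : ℕ → Fin ny → ℝ}
    (K : Matrix (Fin nu) (ZIdx L nu ny) ℝ) (t : ℕ)
    (hu : u (t + L) = K *ᵥ Sum.elim (stack L u t) (stack L y t))
    (hy : y (t + L) = S.histPsi L *ᵥ histOf L u y 0 0 t) :
    histOf L u y 0 0 (t + 1)
      = (S.histTheta L + histPiu L nx nu ny * K * histGamma L nx nu ny) *ᵥ histOf L u y 0 0 t := by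
  have h := histOf_succ S (u := u) (y := y) (δ := fun _ => 0) t
    (by rw [hy]; exact (add_zero _).symm)
  simp only [Pi.zero_comp, Matrix.mulVec_zero, add_zero] at h
  have e : histGamma L nx nu ny *ᵥ histOf L u y 0 0 t = Sum.elim (stack L u t) (stack L y t) :=
    histGamma_mulVec _ _
  rw [Matrix.add_mulVec, ← Matrix.mulVec_mulVec, ← Matrix.mulVec_mulVec, e, ← hu]
  exact h

theorem isStabilizing_of_trajectories {ι : Type} [Fintype ι] [DecidableEq ι]
    (c : DynController ι nu ny)
    (h : ∀ (x : ℕ → Fin nx → ℝ) (ξ : ℕ → ι → ℝ),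
      (∀ t, x (t + 1) = S.A *ᵥ x t + S.B *ᵥ (c.F *ᵥ ξ t)) →
      (∀ t, ξ (t + 1) = c.G *ᵥ ξ t + c.H *ᵥ (S.C *ᵥ x t)) →
      Tendsto x atTop (𝓝 0) ∧ Tendsto ξ atTop (𝓝 0)) : S.IsStabilizing c := by
  refine isSchur_of_trajectories fun z hz => ?_
  have hz1 : ∀ t, z t = Sum.elim (z t ∘ Sum.inl) (z t ∘ Sum.inr) := fun t =>
    (Sum.elim_comp_inl_inr _).symm
  obtain ⟨h1, h2⟩ := h (fun t => z t ∘ Sum.inl) (fun t => z t ∘ Sum.inr)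
    (fun t => by
      rw [hz, Matrix.fromBlocks_mulVec]; simp [Matrix.mulVec_mulVec])
    (fun t => by
      rw [hz, Matrix.fromBlocks_mulVec]; simp [Matrix.mulVec_mulVec, add_comm])
  have := tendsto_sum_elim h1 h2
  exact this.congr fun t => (hz1 t).symm

/-- Along a noise-free run the histories follow the Schur matrix of the gain, hence vanish. The
plant state is read off the history by M, the input by KΓ, and the controller state follows from the
input and the output. -/
theorem isStabilizing_ofGain (hobs : IsStepObservable L S.A S.C)
    {K : Matrix (Fin nu) (ZIdx L nu ny) ℝ} (hK : K ∈ S.stabGains L) :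
    S.IsStabilizing (DynController.ofGain K) := by
  refine isStabilizing_of_trajectories S _ fun x ξ hx hξ => ?_
  set u : ℕ → Fin nu → ℝ := fun t => (DynController.ofGain K).F *ᵥ ξ t with hu
  set y : ℕ → Fin ny → ℝ := fun t => S.C *ᵥ x t with hy
  have hrun := ofGain_run K (y := y) hξ (u := u) fun t => rfl
  have hM := histM_mulVec_histOf S (L := L) hobs (x := x) (u := u) (y := y) (w := 0) (v := 0)
    (fun t => by simp [hx, hu]) (fun t => by simp [hy])
  have hh : Tendsto (fun t => histOf L u y (0 : ℕ → Fin nx → ℝ) 0 t) atTop (𝓝 0) := by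
    refine IsSchur.tendsto_zero_of_recursion hK (b := fun _ => 0) tendsto_const_nhds fun t => ?_
    rw [add_zero]
    refine histOf_succ_of_gain S K t (hrun t) ?_
    rw [histPsi, ← Matrix.mulVec_mulVec, hM]
  have hx0 : Tendsto x atTop (𝓝 0) := by
    rw [← tendsto_add_atTop_iff_nat L]
    exact (tendsto_mulVec_zero (S.histM L) hh).congr hM
  have hy0 : Tendsto y atTop (𝓝 0) := tendsto_mulVec_zero S.C hx0
  have hu0 : Tendsto u atTop (𝓝 0) := by
    rw [← tendsto_add_atTop_iff_nat L]
    refine (tendsto_mulVec_zero (K * histGamma L nx nu ny) hh).congr fun t => ?_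
    rw [← Matrix.mulVec_mulVec, histOf, histGamma_mulVec, hrun]
  refine ⟨hx0, ?_⟩
  rcases Nat.eq_zero_or_pos L with rfl | hL
  · rw [tendsto_pi_nhds]
    intro k
    exact k.1.elim0
  have hstep := ofGain_step hL K (ξ := ξ) (y := y) hξ
  have hlast : ∀ t b, ξ t (⟨L - 1, by omega⟩, b) = u t b := fun t b =>
    (ofGain_F_mulVec hL K (ξ t) b).symm
  rw [tendsto_pi_nhds] at hu0 hy0 ⊢
  have hterm : ∀ k : Fin L × Fin nu, Tendsto (fun t =>
      (∑ b, K k.2 (Sum.inl (k.1, b)) * ξ t (⟨L - 1, by omega⟩, b)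
        + ∑ b, K k.2 (Sum.inr (k.1, b)) * y t b)) atTop (𝓝 0) := by
    intro k
    have e : (0 : ℝ) = ∑ b : Fin nu, K k.2 (Sum.inl (k.1, b)) * (0 : Fin nu → ℝ) b
        + ∑ b : Fin ny, K k.2 (Sum.inr (k.1, b)) * (0 : Fin ny → ℝ) b := by simp
    rw [e]
    simp only [hlast]
    exact (tendsto_finsetSum _ fun b _ => (hu0 b).const_mul _).add
      (tendsto_finsetSum _ fun b _ => (hy0 b).const_mul _)
  -- Each block of the register is the previous block one step earlier plus vanishing terms.
  have hclaim : ∀ (i : ℕ) (hi : i < L) (a : Fin nu),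
      Tendsto (fun t => ξ t (⟨i, hi⟩, a)) atTop (𝓝 0) := by
    intro i
    induction i with
    | zero =>
      intro hi a
      rw [← tendsto_add_atTop_iff_nat 1]
      refine (hterm (⟨0, hi⟩, a)).congr fun t => ?_
      rw [hstep, dif_neg (by simp), zero_add]
    | succ i ih =>
      intro hi a
      rw [← tendsto_add_atTop_iff_nat 1]
      have := (ih (by omega) a).add (hterm (⟨i + 1, hi⟩, a))
      rw [add_zero] at this
      refine this.congr fun t => ?_
      rw [hstep, dif_pos (by simp)]
      simp
  exact fun k => hclaim k.1 k.1.2 k.2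

/-- The filter equation is the control equation of the dual pair (Aᵀ, Cᵀ); its closed-loop matrix is
the transpose of A - HC. -/
theorem filter_schur {X Y : Matrix (Fin nx) (Fin nx) ℝ}
    (hY : IsStabilizingRiccati S.Aᵀ S.Cᵀ S.Vw S.Vv Y) (hV : S.Vv.PosDef) :
    IsSchur (S.A - (S.lqgController X Y).H * S.C) := by
  have h := hY.schur.transpose
  have hYs : Yᵀ = Y := hY.posSemidef.isHermitian
  have hVs : S.Vvᵀ = S.Vv := hV.isHermitian
  convert h using 1
  simp only [riccatiGain, lqgController, Matrix.transpose_add, Matrix.transpose_mul,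
    Matrix.transpose_neg, Matrix.transpose_transpose, Matrix.transpose_nonsing_inv, hYs, hVs]
  rw [Matrix.neg_mul, ← sub_eq_add_neg]
  simp only [Matrix.mul_assoc, add_comm]

/-- Separation principle: the error x - ξ obeys A - HC autonomously, and ξ obeys A + BF driven by
that error. -/
theorem isStabilizing_lqgController {X Y : Matrix (Fin nx) (Fin nx) ℝ}
    (hX : IsStabilizingRiccati S.A S.B (S.Cᵀ * S.Qy * S.C) S.Ru X)
    (hY : IsStabilizingRiccati S.Aᵀ S.Cᵀ S.Vw S.Vv Y) (hV : S.Vv.PosDef) :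
    S.IsStabilizing (S.lqgController X Y) := by
  have hs := filter_schur S (X := X) hY hV
  set c := S.lqgController X Y with hc
  have hF : IsSchur (S.A + S.B * c.F) := hX.schur
  have hG : c.G = S.A + S.B * c.F - c.H * S.C := rfl
  refine isStabilizing_of_trajectories S _ fun x ξ hx hξ => ?_
  have he : Tendsto (fun t => x t - ξ t) atTop (𝓝 0) := by
    refine hs.tendsto_zero_of_recursion (b := fun _ => 0) tendsto_const_nhds fun t => ?_
    rw [hx, hξ, hG]
    simp only [Matrix.sub_mulVec, Matrix.add_mulVec, Matrix.mulVec_sub, Matrix.mulVec_mulVec]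
    abel
  have hξ0 : Tendsto ξ atTop (𝓝 0) := by
    refine hF.tendsto_zero_of_recursion (b := fun t => (c.H * S.C) *ᵥ (x t - ξ t))
      (tendsto_mulVec_zero _ he) fun t => ?_
    rw [hξ, hG]
    simp only [Matrix.sub_mulVec, Matrix.add_mulVec, Matrix.mulVec_sub, Matrix.mulVec_mulVec]
    abel
  exact ⟨by simpa using he.add hξ0, hξ0⟩

end Stabilizing

/-! ### Deadbeat feedback modulo an invariant subspace. -/

section Deadbeat

/-- Deadbeat control modulo an invariant subspace. -/
theorem exists_deadbeat {U E : Type} [AddCommGroup U] [Module ℝ U] [AddCommGroup E] [Module ℝ E]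
    (J : U →ₗ[ℝ] U) (B : E →ₗ[ℝ] U) (K₀ : U →ₗ[ℝ] E) (W : Submodule ℝ U)
    (hW : ∀ w ∈ W, J w + B (K₀ w) ∈ W) (L : ℕ) (hJ : ∀ u, (J ^ L) u ∈ W) :
    ∃ K : U →ₗ[ℝ] E, (∀ w ∈ W, K w = K₀ w) ∧ ∀ u, ((J + B ∘ₗ K) ^ L) u ∈ W := by
  classical
  let T : Submodule ℝ U → Submodule ℝ (U × E) := fun S => S.comap (J.coprod B)
  -- `S k` consists of the states that suitable inputs steer into W in k steps. The feedback is
  -- built to descend this chain one level per step.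
  let S : ℕ → Submodule ℝ U := fun k => Nat.rec W (fun _ S => (T S).map (LinearMap.fst ℝ U E)) k
  have hS0 : S 0 = W := rfl
  have hSmem : ∀ k u, u ∈ S (k + 1) ↔ ∃ v, J u + B v ∈ S k := by
    intro k u
    change u ∈ (T (S k)).map (LinearMap.fst ℝ U E) ↔ _
    simp [T]
  have hmono1 : ∀ k, S k ≤ S (k + 1) := by
    intro k
    induction k with
    | zero => exact fun w hw => (hSmem 0 w).2 ⟨K₀ w, hW w hw⟩
    | succ k ih =>
      intro u hu
      obtain ⟨v, hv⟩ := (hSmem k u).1 hu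
      exact (hSmem (k + 1) u).2 ⟨v, ih hv⟩
  have hmono : Monotone S := monotone_nat_of_le_succ hmono1
  -- Zero inputs are admissible, so the assumption on J ^ L makes `S L` the whole space.
  have hpow : ∀ k u, (J ^ k) u ∈ W → u ∈ S k := by
    intro k
    induction k with
    | zero => intro u hu; exact hu
    | succ k ih =>
      intro u hu
      refine (hSmem k u).2 ⟨0, ?_⟩
      rw [map_zero, add_zero]
      exact ih _ (by rwa [pow_succ] at hu)
  -- To gain one more level, keep K on `S k`, which is invariant under the loop, and on a complement
  -- use a linear choice σ of inputs leading from `S (k + 1)` into `S k`. With `pr` the projection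
  -- onto the complement, the new gain is K (u - pr u) + σ (pr u).
  have hK : ∀ k, ∃ K : U →ₗ[ℝ] E, (∀ w ∈ W, K w = K₀ w) ∧
      ∀ j < k, ∀ u ∈ S (j + 1), J u + B (K u) ∈ S j := by
    intro k
    induction k with
    | zero => exact ⟨K₀, fun _ _ => rfl, fun j hj => absurd hj (Nat.not_lt_zero j)⟩
    | succ k ih =>
      obtain ⟨K, hK1, hK2⟩ := ih
      have hinv : ∀ u ∈ S k, J u + B (K u) ∈ S k := by
        intro u hu
        rcases k with _ | j
        · rw [hK1 u hu]; exact hW u hu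
        · exact hmono1 j (hK2 j (Nat.lt_succ_self j) u hu)
      let f : T (S k) →ₗ[ℝ] S (k + 1) :=
        ((LinearMap.fst ℝ U E).comp (T (S k)).subtype).codRestrict _ fun z =>
          (hSmem k _).2 ⟨z.1.2, z.2⟩
      have hf : LinearMap.range f = ⊤ := by
        rw [LinearMap.range_eq_top]
        rintro ⟨u, hu⟩
        obtain ⟨v, hv⟩ := (hSmem k u).1 hu
        exact ⟨⟨(u, v), hv⟩, rfl⟩
      obtain ⟨g, hg⟩ := f.exists_rightInverse_of_surjective hf
      obtain ⟨σ, hσ⟩ := LinearMap.exists_extend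
        ((LinearMap.snd ℝ U E).comp ((T (S k)).subtype.comp g))
      have hσ' : ∀ u ∈ S (k + 1), J u + B (σ u) ∈ S k := by
        intro u hu
        have h1 : σ u = (g ⟨u, hu⟩).1.2 := by
          have := LinearMap.congr_fun hσ ⟨u, hu⟩
          simpa using this
        have h2 : (g ⟨u, hu⟩).1.1 = u := by
          have := congrArg Subtype.val (LinearMap.congr_fun hg ⟨u, hu⟩)
          simpa [f] using this
        have h3 : J (g ⟨u, hu⟩).1.1 + B (g ⟨u, hu⟩).1.2 ∈ S k := (g ⟨u, hu⟩).2
        rwa [h2, ← h1] at h3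
      obtain ⟨q, hq⟩ := (S k).exists_isCompl
      let pr : U →ₗ[ℝ] U := q.subtype.comp (q.projectionOnto (S k) hq.symm)
      have hpr0 : ∀ u ∈ S k, pr u = 0 := by
        intro u hu
        have := (Submodule.projectionOnto_apply_eq_zero_iff hq.symm).2 hu
        simp [pr, this]
      have hpr1 : ∀ u, u - pr u ∈ S k := by
        intro u
        rw [← Submodule.projectionOnto_apply_eq_zero_iff hq.symm, map_sub, sub_eq_zero]
        exact (Submodule.projectionOnto_apply_left hq.symm _).symm
      refine ⟨K + (σ - K) ∘ₗ pr, fun w hw => ?_, fun j hj u hu => ?_⟩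
      · rw [← hK1 w hw]
        simp [hpr0 w (hmono (Nat.zero_le k) hw)]
      · rcases Nat.lt_succ_iff_lt_or_eq.1 hj with hlt | rfl
        · have := hpr0 u (hmono hlt hu)
          simpa [this] using hK2 j hlt u hu
        · have h1 : pr u ∈ S (j + 1) := by
            have := (S (j + 1)).sub_mem hu (hmono1 j (hpr1 u))
            simpa using this
          have h2 := (S j).add_mem (hinv _ (hpr1 u)) (hσ' _ h1)
          convert h2 using 1
          simp only [LinearMap.add_apply, LinearMap.comp_apply, LinearMap.sub_apply, map_sub,
            map_add]
          abel
  obtain ⟨K, hK1, hK2⟩ := hK L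
  refine ⟨K, hK1, fun u => ?_⟩
  have hfin : ∀ k ≤ L, ∀ u ∈ S k, ((J + B ∘ₗ K) ^ k) u ∈ W := by
    intro k
    induction k with
    | zero => intro _ u hu; exact hu
    | succ k ih =>
      intro hk u hu
      rw [pow_succ]
      exact ih (by omega) _ (hK2 k (by omega) u hu)
  exact hfin L le_rfl u (hpow L u (hJ u))

theorem exists_comp_eq_of_ker_le {V U E : Type} [AddCommGroup V] [Module ℝ V] [AddCommGroup U]
    [Module ℝ U] [AddCommGroup E] [Module ℝ E] (g : V →ₗ[ℝ] U) (f : V →ₗ[ℝ] E)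
    (h : ∀ v, g v = 0 → f v = 0) : ∃ K : U →ₗ[ℝ] E, ∀ v, K (g v) = f v := by
  obtain ⟨s, hs⟩ := g.rangeRestrict.exists_rightInverse_of_surjective g.range_rangeRestrict
  obtain ⟨K, hK⟩ := LinearMap.exists_extend (f ∘ₗ s)
  refine ⟨K, fun v => ?_⟩
  have h1 : K (g v) = f (s (g.rangeRestrict v)) :=
    LinearMap.congr_fun hK (g.rangeRestrict v)
  rw [h1, ← sub_eq_zero, ← map_sub]
  refine h _ ?_
  have h2 := congrArg Subtype.val (LinearMap.congr_fun hs (g.rangeRestrict v))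
  simp only [LinearMap.comp_apply, LinearMap.codRestrict_apply, LinearMap.rangeRestrict,
    LinearMap.id_apply] at h2
  rw [map_sub, sub_eq_zero]
  exact h2

theorem shiftMat_pow_mulVec {L : ℕ} {p : Type} [Fintype p] [DecidableEq p] (i : ℕ)
    (f : Fin L × p → ℝ) (k : Fin L × p) (h : L ≤ k.1 + i) : ((shiftMat L p) ^ i *ᵥ f) k = 0 := by
  induction i generalizing k with
  | zero => have := k.1.2; omega
  | succ i ih =>
    rw [pow_succ', ← Matrix.mulVec_mulVec, shiftMat_mulVec]
    split_ifs with h1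
    · exact ih _ (by simp only; omega)
    · rfl

/-- A feedback on the input window which reproduces the output equation on `V` and steers every
window in `L` steps to one generated from `V`. -/
theorem exists_window_gain {ι : Type} [Fintype ι] [DecidableEq ι] {nu : ℕ} (L : ℕ)
    (G : Matrix ι ι ℝ) (F : Matrix (Fin nu) ι ℝ) (V : Submodule ℝ (ι → ℝ))
    (hG : ∀ θ ∈ V, G *ᵥ θ ∈ V)
    (hobs : ∀ θ ∈ V, obsMat L G F *ᵥ θ = 0 → F *ᵥ (G ^ L *ᵥ θ) = 0) :
    ∃ K : Matrix (Fin nu) (Fin L × Fin nu) ℝ,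
      (∀ θ ∈ V, K *ᵥ (obsMat L G F *ᵥ θ) = F *ᵥ (G ^ L *ᵥ θ)) ∧
      ∀ f, ∃ θ ∈ V, (shiftMat L (Fin nu) + lastMat L (Fin nu) * K) ^ L *ᵥ f
        = obsMat L G F *ᵥ θ := by
  -- On the windows generated from V the feedback is forced, and `hobs` says that it is well defined
  -- there. The bare shift is nilpotent, which supplies the assumption on the L-th power.
  obtain ⟨K₀, hK₀⟩ := exists_comp_eq_of_ker_le ((obsMat L G F).mulVecLin ∘ₗ V.subtype)
    (F.mulVecLin ∘ₗ (G ^ L).mulVecLin ∘ₗ V.subtype) (fun v hv => hobs v.1 v.2 hv)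
  obtain ⟨K, hK, hKL⟩ := exists_deadbeat (shiftMat L (Fin nu)).mulVecLin
    (lastMat L (Fin nu)).mulVecLin K₀ (V.map (obsMat L G F).mulVecLin) (by
      rintro _ ⟨θ, hθ, rfl⟩
      refine ⟨G *ᵥ θ, hG θ hθ, ?_⟩
      have h1 : K₀ (obsMat L G F *ᵥ θ) = F *ᵥ (G ^ L *ᵥ θ) := hK₀ ⟨θ, hθ⟩
      simp only [Matrix.mulVecLin_apply]
      rw [h1, shift_obsMat]) L (fun u => by
      have h0 : ((shiftMat L (Fin nu)).mulVecLin ^ L) u = 0 := by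
        rw [← Matrix.toLin'_apply', ← Matrix.toLin'_pow, Matrix.toLin'_apply]
        funext k
        exact shiftMat_pow_mulVec L u k (by omega)
      rw [h0]; exact Submodule.zero_mem _)
  have hKm : ∀ f, LinearMap.toMatrix' K *ᵥ f = K f := fun f => LinearMap.toMatrix'_mulVec K f
  refine ⟨LinearMap.toMatrix' K, fun θ hθ => ?_, fun f => ?_⟩
  · rw [hKm, hK (obsMat L G F *ᵥ θ) ⟨θ, hθ, rfl⟩]
    exact hK₀ ⟨θ, hθ⟩
  · obtain ⟨θ, hθ, h⟩ := hKL f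
    refine ⟨θ, hθ, ?_⟩
    rw [Matrix.mulVecLin_apply] at h
    rw [h, ← Matrix.toLin'_apply, Matrix.toLin'_pow, map_add, Matrix.toLin'_mul,
      Matrix.toLin'_toMatrix']
    rfl

end Deadbeat

/-! ### Realizing a stabilizing controller by a stabilizing IOH gain. -/

section Realization

variable {nx nu ny : ℕ} (S : LQGData nx nu ny) {L : ℕ} {ι ι' : Type} [Fintype ι] [DecidableEq ι]
  [Fintype ι'] [DecidableEq ι']

/-- The states of `c` whose free responses are also free responses of `c'`. -/
def matchedStates (c : DynController ι nu ny) (c' : DynController ι' nu ny) :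
    Submodule ℝ (ι → ℝ) where
  carrier := {θ | ∃ η : ι' → ℝ, ∀ k : ℕ, c.F *ᵥ (c.G ^ k *ᵥ θ) = c'.F *ᵥ (c'.G ^ k *ᵥ η)}
  add_mem' := by
    rintro θ θ' ⟨η, h⟩ ⟨η', h'⟩
    exact ⟨η + η', fun k => by simp only [Matrix.mulVec_add, h, h']⟩
  zero_mem' := ⟨0, fun k => by simp only [Matrix.mulVec_zero]⟩
  smul_mem' := by
    rintro a θ ⟨η, h⟩
    exact ⟨a • η, fun k => by simp only [Matrix.mulVec_smul, h]⟩

theorem matchedStates_G {c : DynController ι nu ny} {c' : DynController ι' nu ny} {θ : ι → ℝ}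
    (h : θ ∈ matchedStates c c') : c.G *ᵥ θ ∈ matchedStates c c' := by
  obtain ⟨η, h⟩ := h
  refine ⟨c'.G *ᵥ η, fun k => ?_⟩
  have := h (k + 1)
  rwa [pow_succ, pow_succ, ← Matrix.mulVec_mulVec, ← Matrix.mulVec_mulVec] at this

/-- Equality of the Markov parameters: an impulse leaves both controllers in states with equal free
responses. With invariance under G, all states reachable from 0 are matched. -/
theorem matchedStates_H {c : DynController ι nu ny} {c' : DynController ι' nu ny}
    (hc : c'.SameBehaviour c) (y : Fin ny → ℝ) : c.H *ᵥ y ∈ matchedStates c c' := by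
  refine ⟨c'.H *ᵥ y, fun k => ?_⟩
  have := congrArg (fun M => M *ᵥ y) (hc k)
  simpa only [Matrix.mulVec_mulVec, Matrix.mul_assoc] using this.symm

/-- The controller `c` itself may fail to be L-step observable. A silent window is also a silent
window of the observable realization, whose matching state must vanish, and with it the whole
response. -/
theorem matchedStates_obs {c : DynController ι nu ny} {c' : DynController ι' nu ny}
    (hc : IsStepObservable L c'.G c'.F) {θ : ι → ℝ} (h : θ ∈ matchedStates c c')
    (h0 : obsMat L c.G c.F *ᵥ θ = 0) : c.F *ᵥ (c.G ^ L *ᵥ θ) = 0 := by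
  obtain ⟨η, h⟩ := h
  have h1 : obsMat L c'.G c'.F *ᵥ η = 0 := by
    rw [← h0]
    funext k
    rw [obsMat_mulVec, obsMat_mulVec, h]
  rw [h, eq_zero_of_obsMat_mulVec hc h1, Matrix.mulVec_zero, Matrix.mulVec_zero]

/-- The IOH gain realizing the controller `c`, with the feedback `K` on the unexplained part of
the input window. -/
def windowGain (c : DynController ι nu ny) (K : Matrix (Fin nu) (Fin L × Fin nu) ℝ) :
    Matrix (Fin nu) (ZIdx L nu ny) ℝ :=
  Matrix.fromCols K (c.F * reachMat L c.G c.H - K * toepMat L c.G c.H c.F)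

theorem windowGain_mulVec (c : DynController ι nu ny) (K : Matrix (Fin nu) (Fin L × Fin nu) ℝ)
    (u : ℕ → Fin nu → ℝ) (y : ℕ → Fin ny → ℝ) (t : ℕ) :
    windowGain c K *ᵥ Sum.elim (stack L u t) (stack L y t)
      = K *ᵥ resid L c.G c.H c.F y u t + c.F *ᵥ (reachMat L c.G c.H *ᵥ stack L y t) := by
  simp only [windowGain, Matrix.fromCols_mulVec_sumElim, resid, Matrix.sub_mulVec,
    Matrix.mulVec_sub, Matrix.mulVec_mulVec]
  abel

/-- The controller state never leaves V, so the input residual is Oξ(t), and K predicts its free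
contribution F G^L ξ(t) to the next input. -/
theorem windowGain_run {c : DynController ι nu ny} {K : Matrix (Fin nu) (Fin L × Fin nu) ℝ}
    {V : Submodule ℝ (ι → ℝ)} (hVG : ∀ θ ∈ V, c.G *ᵥ θ ∈ V) (hVH : ∀ y, c.H *ᵥ y ∈ V)
    (hK : ∀ θ ∈ V, K *ᵥ (obsMat L c.G c.F *ᵥ θ) = c.F *ᵥ (c.G ^ L *ᵥ θ))
    {ξ : ℕ → ι → ℝ} {y : ℕ → Fin ny → ℝ} (hξ0 : ξ 0 ∈ V)
    (hξ : ∀ t, ξ (t + 1) = c.G *ᵥ ξ t + c.H *ᵥ y t)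
    {u : ℕ → Fin nu → ℝ} (hu : ∀ t, u t = c.F *ᵥ ξ t) (t : ℕ) :
    u (t + L) = windowGain c K *ᵥ Sum.elim (stack L u t) (stack L y t) := by
  have hV : ∀ t, ξ t ∈ V := by
    intro t
    induction t with
    | zero => exact hξ0
    | succ t ih => rw [hξ]; exact V.add_mem (hVG _ ih) (hVH _)
  rw [windowGain_mulVec, resid_eq_of_run hξ hu, hK _ (hV t), hu, run_add_eq hξ, Matrix.mulVec_add]

/-- The one-step map of the output residual of the history dynamics. -/
noncomputable def residMap (L : ℕ) : Matrix (Fin L × Fin ny) (Fin L × Fin ny) ℝ :=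
  shiftMat L (Fin ny) + lastMat L (Fin ny) * (S.C * (S.A ^ L * pinv (obsMat L S.A S.C)))

/-- The map governing the modes of the history dynamics that do not come from the plant. -/
noncomputable def hiddenMap (L : ℕ) : Matrix (Fin L × Fin ny) (Fin L × Fin ny) ℝ :=
  (1 - obsMat L S.A S.C * pinv (obsMat L S.A S.C)) * residMap S L

theorem histPsi_mulVec (u : ℕ → Fin nu → ℝ) (y : ℕ → Fin ny → ℝ) (t : ℕ) :
    S.histPsi L *ᵥ histOf L u y 0 0 t
      = S.C *ᵥ (reachMat L S.A S.B *ᵥ stack L u t) + (S.C * (S.A ^ L * pinv (obsMat L S.A S.C))) *ᵥ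
          resid L S.A S.B S.C u y t := by
  have h0 : ∀ p : Type, stack L (0 : ℕ → p → ℝ) t = 0 := fun p => rfl
  simp only [histPsi, histM, histOf, ← Matrix.mulVec_mulVec, Matrix.fromCols_mulVec_sumElim, h0,
    Matrix.mulVec_zero, add_zero, resid, Matrix.sub_mulVec, Matrix.mulVec_sub, Matrix.mulVec_add]
  abel

variable {u : ℕ → Fin nu → ℝ} {y : ℕ → Fin ny → ℝ}

theorem residual_succ (hy : ∀ t, y (t + L) = S.histPsi L *ᵥ histOf L u y 0 0 t) (t : ℕ) :
    resid L S.A S.B S.C u y (t + 1) = residMap S L *ᵥ resid L S.A S.B S.C u y t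
      + obsMat L S.A S.C *ᵥ (S.B *ᵥ u t) := by
  rw [resid_succ, hy, histPsi_mulVec, add_sub_cancel_left, residMap, Matrix.add_mulVec,
    Matrix.mulVec_mulVec]

/-- Splitting of the output residual into a plant state and the hidden modes. -/
theorem residual_split (hobs : IsStepObservable L S.A S.C)
    (hy : ∀ t, y (t + L) = S.histPsi L *ᵥ histOf L u y 0 0 t) :
    ∃ (ζ : ℕ → Fin nx → ℝ) (q : ℕ → Fin L × Fin ny → ℝ),
      (∀ t, resid L S.A S.B S.C u y t = obsMat L S.A S.C *ᵥ ζ t + q t) ∧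
      (∀ t, q t = (1 - obsMat L S.A S.C * pinv (obsMat L S.A S.C)) *ᵥ
        resid L S.A S.B S.C u y t) ∧
      (∀ t, q (t + 1) = hiddenMap S L *ᵥ q t) ∧
      ∀ t, ζ (t + 1) = S.A *ᵥ ζ t + S.B *ᵥ u t
        + pinv (obsMat L S.A S.C) *ᵥ (residMap S L *ᵥ q t) := by
  set O := obsMat L S.A S.C with hO
  set r := resid L S.A S.B S.C u y with hr
  have hPO : ∀ x, pinv O *ᵥ (O *ᵥ x) = x := fun x => by
    rw [Matrix.mulVec_mulVec, pinv_obsMat_mul hobs, Matrix.one_mulVec]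
  -- On the range of O the residual map acts as A does on the state. Since 1 - O O† annihilates that
  -- range, the remaining part of the residual evolves autonomously, whatever the input is.
  have hN : ∀ x, residMap S L *ᵥ (O *ᵥ x) = O *ᵥ (S.A *ᵥ x) := fun x => by
    rw [residMap, Matrix.add_mulVec, ← Matrix.mulVec_mulVec, ← Matrix.mulVec_mulVec,
      ← Matrix.mulVec_mulVec, ← hO, hPO, hO, shift_obsMat]
  have hq : ∀ x : Fin L × Fin ny → ℝ, (1 - O * pinv O) *ᵥ x = x - O *ᵥ (pinv O *ᵥ x) := fun x => by
    rw [Matrix.sub_mulVec, Matrix.one_mulVec, Matrix.mulVec_mulVec]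
  have h1 : ∀ t, r (t + 1) = O *ᵥ (S.A *ᵥ (pinv O *ᵥ r t) + S.B *ᵥ u t)
      + residMap S L *ᵥ ((1 - O * pinv O) *ᵥ r t) := by
    intro t
    rw [hr, residual_succ S hy, ← hr, hq, Matrix.mulVec_sub, hN, Matrix.mulVec_add]
    abel
  refine ⟨fun t => pinv O *ᵥ r t, fun t => (1 - O * pinv O) *ᵥ r t, fun t => ?_, fun t => rfl,
    fun t => ?_, fun t => ?_⟩
  · simp only [hq]; abel
  · simp only [hiddenMap, ← hO, ← Matrix.mulVec_mulVec, h1]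
    rw [hq, hq (residMap S L *ᵥ _), Matrix.mulVec_add (pinv O), hPO, Matrix.mulVec_add O (_ + _)]
    abel
  · simp only [h1, Matrix.mulVec_add (pinv O), hPO]

theorem tendsto_zero_block (hL : 0 < L) {p : Type} {f : ℕ → Fin L × p → ℝ}
    (hf : Tendsto f atTop (𝓝 0)) : Tendsto (fun t b => f t (⟨0, hL⟩, b)) atTop (𝓝 0) := by
  rw [tendsto_pi_nhds] at hf ⊢
  exact fun b => hf (⟨0, hL⟩, b)

theorem resid_zero_block {n p q : Type} [Fintype n] [DecidableEq n] [Fintype p] [DecidableEq p]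
    [Fintype q] [DecidableEq q] (hL : 0 < L) (A : Matrix n n ℝ) (B : Matrix n p ℝ)
    (C : Matrix q n ℝ) (a : ℕ → p → ℝ) (b : ℕ → q → ℝ) (t : ℕ) :
    (fun i => resid L A B C a b t (⟨0, hL⟩, i)) = b t := by
  funext i
  rw [resid, Pi.sub_apply, toepMat_mulVec_zero_block hL, sub_zero]
  rfl

theorem obsMat_zero_block {n q : Type} [Fintype n] [DecidableEq n]
    [Fintype q] [DecidableEq q] (hL : 0 < L) (A : Matrix n n ℝ) (C : Matrix q n ℝ) (x : n → ℝ) :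
    (fun i => (obsMat L A C *ᵥ x) (⟨0, hL⟩, i)) = C *ᵥ x := by
  funext i
  rw [obsMat_mulVec, pow_zero, Matrix.one_mulVec]

/-- After L steps the deadbeat feedback has made the input window consistent with a controller state
θ. From then on (ζ, θ) runs in the stable loop of plant and controller, perturbed only by the
decaying hidden part q of the output residual. -/
theorem windowGain_tendsto_zero (hL : 0 < L) (hobs : IsStepObservable L S.A S.C)
    (hhid : ∀ r, Tendsto (fun t => hiddenMap S L ^ t *ᵥ
      ((1 - obsMat L S.A S.C * pinv (obsMat L S.A S.C)) *ᵥ r)) atTop (𝓝 0))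
    {c : DynController ι nu ny} (hc : S.IsStabilizing c)
    {K : Matrix (Fin nu) (Fin L × Fin nu) ℝ}
    {V : Submodule ℝ (ι → ℝ)} (hVG : ∀ θ ∈ V, c.G *ᵥ θ ∈ V) (hVH : ∀ y, c.H *ᵥ y ∈ V)
    (hK : ∀ θ ∈ V, K *ᵥ (obsMat L c.G c.F *ᵥ θ) = c.F *ᵥ (c.G ^ L *ᵥ θ))
    (hKL : ∀ f, ∃ θ ∈ V, (shiftMat L (Fin nu) + lastMat L (Fin nu) * K) ^ L *ᵥ f
      = obsMat L c.G c.F *ᵥ θ)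
    (hu : ∀ t, u (t + L) = windowGain c K *ᵥ Sum.elim (stack L u t) (stack L y t))
    (hy : ∀ t, y (t + L) = S.histPsi L *ᵥ histOf L u y 0 0 t) :
    Tendsto u atTop (𝓝 0) ∧ Tendsto y atTop (𝓝 0) := by
  obtain ⟨ζ, q, hr, hq0, hq, hζ⟩ := residual_split S hobs hy
  set D := shiftMat L (Fin nu) + lastMat L (Fin nu) * K with hD
  set O := obsMat L c.G c.F with hO
  set ρ := resid L c.G c.H c.F y u with hρ
  have hDO : ∀ θ ∈ V, D *ᵥ (O *ᵥ θ) = O *ᵥ (c.G *ᵥ θ) := fun θ hθ => by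
    rw [hD, Matrix.add_mulVec, ← Matrix.mulVec_mulVec, hK θ hθ, hO, shift_obsMat]
  have hρs : ∀ t, ρ (t + 1) = D *ᵥ ρ t + O *ᵥ (c.H *ᵥ y t) := by
    intro t
    rw [hρ, resid_succ, hu, windowGain_mulVec, add_sub_cancel_right, hD, Matrix.add_mulVec,
      Matrix.mulVec_mulVec]
  -- The outputs contribute only elements of O V, so any inconsistency sits in the free term, which
  -- `hKL` brings into O V at time L.
  have hρt : ∀ t, ∃ θ ∈ V, ρ t = D ^ t *ᵥ ρ 0 + O *ᵥ θ := by
    intro t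
    induction t with
    | zero => exact ⟨0, V.zero_mem, by simp⟩
    | succ t ih =>
      obtain ⟨θ, hθ, h⟩ := ih
      refine ⟨c.G *ᵥ θ + c.H *ᵥ y t, V.add_mem (hVG θ hθ) (hVH _), ?_⟩
      rw [hρs, h, Matrix.mulVec_add, hDO θ hθ, Matrix.mulVec_mulVec, ← pow_succ',
        Matrix.mulVec_add, add_assoc]
  obtain ⟨θ₀, hθ₀, hstart⟩ : ∃ θ ∈ V, ρ L = O *ᵥ θ := by
    obtain ⟨θ, hθ, h⟩ := hρt L
    obtain ⟨θ', hθ', h'⟩ := hKL (ρ 0)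
    exact ⟨θ' + θ, V.add_mem hθ' hθ, by rw [h, h', Matrix.mulVec_add]⟩
  -- The state θ(t) explains the input window that starts at t + L; it is therefore driven by y(t +
  -- L) and paired with ζ(t + L).
  let θ : ℕ → ι → ℝ := fun t => Nat.rec θ₀ (fun t θ => c.G *ᵥ θ + c.H *ᵥ y (t + L)) t
  have hθs : ∀ t, θ (t + 1) = c.G *ᵥ θ t + c.H *ᵥ y (t + L) := fun t => rfl
  have hθ : ∀ t, θ t ∈ V ∧ ρ (t + L) = O *ᵥ θ t := by
    intro t
    induction t with
    | zero => exact ⟨hθ₀, by rw [zero_add, hstart]; rfl⟩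
    | succ t ih =>
      refine ⟨by rw [hθs]; exact V.add_mem (hVG _ ih.1) (hVH _), ?_⟩
      rw [show t + 1 + L = t + L + 1 by ring, hρs, ih.2, hDO _ ih.1, hθs, Matrix.mulVec_add]
  have hut : ∀ t, u (t + L) = c.F *ᵥ θ t := fun t => by
    rw [← resid_zero_block hL c.G c.H c.F y u, ← hρ, (hθ t).2, obsMat_zero_block]
  have hyt : ∀ t, y t = S.C *ᵥ ζ t + fun b => q t (⟨0, hL⟩, b) := fun t => by
    rw [← obsMat_zero_block hL S.A S.C, ← resid_zero_block hL S.A S.B S.C u y, hr]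
    rfl
  have hq1 : ∀ t, q t = hiddenMap S L ^ t *ᵥ q 0 := by
    intro t
    induction t with
    | zero => simp
    | succ t ih => rw [hq, ih, Matrix.mulVec_mulVec, ← pow_succ']
  have hqt : Tendsto q atTop (𝓝 0) := by
    have := hhid (resid L S.A S.B S.C u y 0)
    rw [← hq0] at this
    exact this.congr fun t => (hq1 t).symm
  have hqL : Tendsto (fun t => q (t + L)) atTop (𝓝 0) := (tendsto_add_atTop_iff_nat L).2 hqt
  have hz : Tendsto (fun t => Sum.elim (ζ (t + L)) (θ t)) atTop (𝓝 0) := by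
    refine IsSchur.tendsto_zero_of_recursion hc
      (b := fun t => Sum.elim (pinv (obsMat L S.A S.C) *ᵥ (residMap S L *ᵥ q (t + L)))
        (c.H *ᵥ fun b => q (t + L) (⟨0, hL⟩, b))) ?_ fun t => ?_
    · exact tendsto_sum_elim (tendsto_mulVec_zero _ (tendsto_mulVec_zero _ hqL))
        (tendsto_mulVec_zero _ (tendsto_zero_block hL hqL))
    · rw [Matrix.fromBlocks_mulVec, sum_elim_add, Sum.elim_comp_inl, Sum.elim_comp_inr,
        show t + 1 + L = t + L + 1 by ring, hζ, hut, hθs, hyt, Matrix.mulVec_add,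
        ← Matrix.mulVec_mulVec, ← Matrix.mulVec_mulVec]
      congr 1
      abel
  rw [tendsto_pi_nhds] at hz
  have hζ0 : Tendsto ζ atTop (𝓝 0) :=
    (tendsto_add_atTop_iff_nat L).1 (tendsto_pi_nhds.2 fun i => hz (Sum.inl i))
  have hθ0 : Tendsto θ atTop (𝓝 0) := tendsto_pi_nhds.2 fun i => hz (Sum.inr i)
  refine ⟨(tendsto_add_atTop_iff_nat L).1 ?_, ?_⟩
  · exact (tendsto_mulVec_zero c.F hθ0).congr fun t => (hut t).symm
  · have := (tendsto_mulVec_zero S.C hζ0).add (tendsto_zero_block hL hqt)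
    rw [add_zero] at this
    exact this.congr fun t => (hyt t).symm

/-- Signals generating a trajectory of the noise-free closed loop of the history dynamics. -/
theorem exists_signals (hL : 0 < L) (K : Matrix (Fin nu) (ZIdx L nu ny) ℝ)
    {h : ℕ → HIdx L nx nu ny → ℝ}
    (hh : ∀ t, h (t + 1)
      = (S.histTheta L + histPiu L nx nu ny * K * histGamma L nx nu ny) *ᵥ h t) :
    ∃ (u : ℕ → Fin nu → ℝ) (y : ℕ → Fin ny → ℝ) (w : ℕ → Fin nx → ℝ) (v : ℕ → Fin ny → ℝ),
      (∀ t, h t = histOf L u y w v t) ∧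
      (∀ t, u (t + L) = K *ᵥ Sum.elim (stack L u t) (stack L y t)) ∧
      (∀ t, y (t + L) = S.histPsi L *ᵥ h t) ∧ (∀ t, w (t + L) = 0) ∧ ∀ t, v (t + L) = 0 := by
  have hsplit : ∀ t, h t = Sum.elim
      (Sum.elim (fun k => h t (Sum.inl (Sum.inl k))) (fun k => h t (Sum.inl (Sum.inr k))))
      (Sum.elim (fun k => h t (Sum.inr (Sum.inl k))) (fun k => h t (Sum.inr (Sum.inr k)))) := by
    intro t
    funext i
    rcases i with (i | i) | (i | i) <;> rfl
  have hstep : ∀ t, h (t + 1) = Sum.elim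
      (Sum.elim (shiftMat L (Fin nu) *ᵥ (fun k => h t (Sum.inl (Sum.inl k)))
          + lastMat L (Fin nu) *ᵥ (K *ᵥ (histGamma L nx nu ny *ᵥ h t)))
        (shiftMat L (Fin ny) *ᵥ (fun k => h t (Sum.inl (Sum.inr k)))
          + lastMat L (Fin ny) *ᵥ (S.histPsi L *ᵥ h t)))
      (Sum.elim (shiftMat L (Fin nx) *ᵥ (fun k => h t (Sum.inr (Sum.inl k))))
        (shiftMat L (Fin ny) *ᵥ (fun k => h t (Sum.inr (Sum.inr k))))) := by
    intro t
    rw [hh, Matrix.add_mulVec, ← Matrix.mulVec_mulVec, ← Matrix.mulVec_mulVec, histPiu_mulVec]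
    conv_lhs => enter [1]; rw [hsplit t]
    rw [histTheta_mulVec, ← hsplit t]
    simp only [sum_elim_add, add_zero]
  obtain ⟨hu1, hu2⟩ := eq_stack_of_shift hL (f := fun t k => h t (Sum.inl (Sum.inl k)))
    (a := fun t => K *ᵥ (histGamma L nx nu ny *ᵥ h t)) fun t => by
      funext k; rw [hstep]; rfl
  obtain ⟨hy1, hy2⟩ := eq_stack_of_shift hL (f := fun t k => h t (Sum.inl (Sum.inr k)))
    (a := fun t => S.histPsi L *ᵥ h t) fun t => by
      funext k; rw [hstep]; rfl
  obtain ⟨hw1, hw2⟩ := eq_stack_of_shift hL (f := fun t k => h t (Sum.inr (Sum.inl k)))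
    (a := fun _ => 0) fun t => by
      rw [Matrix.mulVec_zero, add_zero]; funext k; rw [hstep]; rfl
  obtain ⟨hv1, hv2⟩ := eq_stack_of_shift hL (f := fun t k => h t (Sum.inr (Sum.inr k)))
    (a := fun _ => 0) fun t => by
      rw [Matrix.mulVec_zero, add_zero]; funext k; rw [hstep]; rfl
  have hhist := fun t => (hsplit t).trans (by rw [hu1 t, hy1 t, hw1 t, hv1 t])
  refine ⟨_, _, _, _, hhist, fun t => ?_, hy2, hw2, hv2⟩
  refine (hu2 t).trans ?_
  rw [hhist t, histGamma_mulVec]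

theorem signals_zero_of_start {p : Type} {s : ℕ → p → ℝ} (h0 : stack L s 0 = 0)
    (h1 : ∀ t, s (t + L) = 0) : s = 0 := by
  funext t
  rcases lt_or_ge t L with h | h
  · funext a
    have := congrFun h0 (⟨t, h⟩, a)
    simpa [stack] using this
  · rw [← Nat.sub_add_cancel h, h1]; rfl

/-- The hidden modes are stable as soon as some IOH gain is stabilizing. -/
theorem hidden_tendsto (hL : 0 < L) (hobs : IsStepObservable L S.A S.C)
    (hne : (S.stabGains L).Nonempty) (r : Fin L × Fin ny → ℝ) :
    Tendsto (fun t => hiddenMap S L ^ t *ᵥ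
      ((1 - obsMat L S.A S.C * pinv (obsMat L S.A S.C)) *ᵥ r)) atTop (𝓝 0) := by
  obtain ⟨K, hK⟩ := hne
  set M := S.histTheta L + histPiu L nx nu ny * K * histGamma L nx nu ny with hM
  -- With zero input and noise windows, the output residual at time 0 is the arbitrary vector r
  -- itself. The history decays under the given stabilizing gain, and so does the hidden part of its
  -- residual.
  let h : ℕ → HIdx L nx nu ny → ℝ := fun t => M ^ t *ᵥ Sum.elim (Sum.elim 0 r) 0
  have hh : ∀ t, h (t + 1) = M *ᵥ h t := fun t => by
    simp only [h, Matrix.mulVec_mulVec, ← pow_succ']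
  have hh0 : Tendsto h atTop (𝓝 0) :=
    IsSchur.tendsto_zero_of_recursion hK (b := fun _ => 0) tendsto_const_nhds fun t => by
      rw [add_zero, hh]
  obtain ⟨u, y, w, v, h1, -, h3, h4, h5⟩ := exists_signals S hL K hh
  have hstart : histOf L u y w v 0 = Sum.elim (Sum.elim (0 : Fin L × Fin nu → ℝ) r) 0 := by
    rw [← h1]; simp [h]
  have hs0 : ∀ i, histOf L u y w v 0 i
      = Sum.elim (Sum.elim (0 : Fin L × Fin nu → ℝ) r) 0 i := congrFun hstart
  have hw : w = 0 := signals_zero_of_start (funext fun k => hs0 (Sum.inr (Sum.inl k))) h4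
  have hv : v = 0 := signals_zero_of_start (funext fun k => hs0 (Sum.inr (Sum.inr k))) h5
  have hu0 : stack L u 0 = 0 := funext fun k => hs0 (Sum.inl (Sum.inl k))
  have hy0 : stack L y 0 = r := funext fun k => hs0 (Sum.inl (Sum.inr k))
  subst hw hv
  obtain ⟨ζ, q, -, hq0, hq, -⟩ := residual_split S hobs (u := u) (y := y) fun t => by
    rw [h3, h1]
  have hr0 : resid L S.A S.B S.C u y 0 = r := by
    rw [resid, hu0, hy0, Matrix.mulVec_zero, sub_zero]
  have hq1 : ∀ t, q t = hiddenMap S L ^ t *ᵥ q 0 := by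
    intro t
    induction t with
    | zero => simp
    | succ t ih => rw [hq, ih, Matrix.mulVec_mulVec, ← pow_succ']
  rw [hq0 0, hr0] at hq1
  have hh1 := tendsto_pi_nhds.1 hh0
  have hsu : Tendsto (fun t => stack L u t) atTop (𝓝 0) := by
    rw [tendsto_pi_nhds]
    intro k
    refine (hh1 (Sum.inl (Sum.inl k))).congr fun t => ?_
    rw [h1]; rfl
  have hsy : Tendsto (fun t => stack L y t) atTop (𝓝 0) := by
    rw [tendsto_pi_nhds]
    intro k
    refine (hh1 (Sum.inl (Sum.inr k))).congr fun t => ?_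
    rw [h1]; rfl
  have hrt : Tendsto (fun t => resid L S.A S.B S.C u y t) atTop (𝓝 0) := by
    have := hsy.sub (tendsto_mulVec_zero (toepMat L S.A S.B S.C) hsu)
    rwa [sub_zero] at this
  exact (tendsto_mulVec_zero (1 - obsMat L S.A S.C * pinv (obsMat L S.A S.C)) hrt).congr
    fun t => by rw [← hq0, hq1]

/-- A stabilizing controller with an `L`-step observable realization of its input-output behaviour
is realized by a stabilizing IOH gain. -/
theorem exists_stabGain_realizing (hobs : IsStepObservable L S.A S.C)
    (hne : (S.stabGains L).Nonempty) {c : DynController ι nu ny} (hc : S.IsStabilizing c)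
    {c' : DynController ι' nu ny} (hcc : c'.SameBehaviour c)
    (hobs' : IsStepObservable L c'.G c'.F) :
    ∃ K ∈ S.stabGains L, ∀ (ξ : ℕ → ι → ℝ) (y : ℕ → Fin ny → ℝ), ξ 0 = 0 →
      (∀ t, ξ (t + 1) = c.G *ᵥ ξ t + c.H *ᵥ y t) → ∀ t,
      c.F *ᵥ ξ (t + L) = K *ᵥ Sum.elim (stack L (fun t => c.F *ᵥ ξ t) t) (stack L y t) := by
  -- Working on the matched states replaces observability of `c` by that of `c'`.
  obtain ⟨K, hK, hKL⟩ := exists_window_gain L c.G c.F (matchedStates c c')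
    (fun θ hθ => matchedStates_G hθ) (fun θ hθ h0 => matchedStates_obs hobs' hθ h0)
  refine ⟨windowGain c K, ?_, fun ξ y h0 hξ t => ?_⟩
  · refine isSchur_of_trajectories fun h hh => ?_
    rcases Nat.eq_zero_or_pos L with rfl | hL
    · rw [tendsto_pi_nhds]
      rintro ((k | k) | (k | k)) <;> exact k.1.elim0
    obtain ⟨u, y, w, v, h1, h2, h3, h4, h5⟩ := exists_signals S hL _ hh
    -- The stored noises form shift registers without input, so they are empty after L steps; from
    -- then on the history is noise-free.
    have hshift : ∀ t, histOf L u y w v (t + L)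
        = histOf L (fun t => u (t + L)) (fun t => y (t + L)) 0 0 t := by
      intro t
      funext i
      rcases i with (i | i) | (i | i)
      · simp [histOf, stack, add_right_comm]
      · simp [histOf, stack, add_right_comm]
      · simp [histOf, stack, add_right_comm _ L, h4]
      · simp [histOf, stack, add_right_comm _ L, h5]
    obtain ⟨hu, hy⟩ := windowGain_tendsto_zero S hL hobs (hidden_tendsto S hL hobs hne) hc
      (fun θ hθ => matchedStates_G hθ) (matchedStates_H hcc) hK hKL
      (u := fun t => u (t + L)) (y := fun t => y (t + L))
      (fun t => by
        rw [h2]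
        congr 2
        · funext k; simp [stack, add_right_comm]
        · funext k; simp [stack, add_right_comm])
      (fun t => by rw [h3, h1, hshift])
    rw [← tendsto_add_atTop_iff_nat L]
    refine (tendsto_sum_elim (tendsto_sum_elim (tendsto_stack hu) (tendsto_stack hy))
      (tendsto_sum_elim (tendsto_stack (tendsto_const_nhds (x := 0)))
        (tendsto_stack (tendsto_const_nhds (x := 0))))).congr fun t => ?_
    rw [h1, hshift]
    rfl
  · exact windowGain_run (fun θ hθ => matchedStates_G hθ) (matchedStates_H hcc) hK
      (by rw [h0]; exact Submodule.zero_mem _) hξ (fun _ => rfl) t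

end Realization

/-! ### Second moments of square-integrable random vectors. -/

section Moments

variable {Ω : Type*} [MeasurableSpace Ω] {P : Measure Ω}
  {ι κ κ' : Type} [Fintype ι] [DecidableEq ι] [Fintype κ] [DecidableEq κ] [Fintype κ']
  [DecidableEq κ']

/-- Square-integrable random vectors. -/
def SqInt (P : Measure Ω) (a : Ω → ι → ℝ) : Prop := ∀ i, MemLp (fun ω => a ω i) 2 P

/-- The matrix of mixed second moments. -/
noncomputable def mom (P : Measure Ω) (a : Ω → ι → ℝ) (b : Ω → κ → ℝ) : Matrix ι κ ℝ :=
  Matrix.of fun i j => ∫ ω, a ω i * b ω j ∂P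

theorem SqInt.add {a b : Ω → ι → ℝ} (ha : SqInt P a) (hb : SqInt P b) :
    SqInt P (fun ω => a ω + b ω) := fun i => (ha i).add (hb i)

theorem SqInt.sub {a b : Ω → ι → ℝ} (ha : SqInt P a) (hb : SqInt P b) :
    SqInt P (fun ω => a ω - b ω) := fun i => (ha i).sub (hb i)

theorem SqInt.mulVec {a : Ω → ι → ℝ} (ha : SqInt P a) (M : Matrix κ ι ℝ) :
    SqInt P (fun ω => M *ᵥ a ω) := fun i =>
  memLp_finsetSum (f := fun j ω => M i j * a ω j) _ fun j _ => (ha j).const_mul (M i j)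

theorem SqInt.const [IsFiniteMeasure P] (v : ι → ℝ) : SqInt P (fun _ : Ω => v) :=
  fun i => memLp_const (v i)

theorem SqInt.elim {a : Ω → ι → ℝ} {b : Ω → κ → ℝ} (ha : SqInt P a) (hb : SqInt P b) :
    SqInt P (fun ω => Sum.elim (a ω) (b ω)) := by
  rintro (i | i)
  · exact ha i
  · exact hb i

theorem SqInt.integrable_mul {a : Ω → ι → ℝ} {b : Ω → κ → ℝ} (ha : SqInt P a) (hb : SqInt P b)
    (i : ι) (j : κ) : Integrable (fun ω => a ω i * b ω j) P := (ha i).integrable_mul (hb j)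

theorem mom_transpose (a : Ω → ι → ℝ) (b : Ω → κ → ℝ) : (mom P a b)ᵀ = mom P b a := by
  ext i j
  simp [mom, mul_comm]

theorem mom_add_left {a a' : Ω → ι → ℝ} {b : Ω → κ → ℝ} (ha : SqInt P a) (ha' : SqInt P a')
    (hb : SqInt P b) : mom P (fun ω => a ω + a' ω) b = mom P a b + mom P a' b := by
  ext i j
  simp only [mom, Matrix.of_apply, Matrix.add_apply, Pi.add_apply, add_mul]
  exact integral_add (ha.integrable_mul hb i j) (ha'.integrable_mul hb i j)

theorem mom_mulVec_left {a : Ω → ι → ℝ} {b : Ω → κ → ℝ} (M : Matrix κ' ι ℝ) (ha : SqInt P a)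
    (hb : SqInt P b) : mom P (fun ω => M *ᵥ a ω) b = M * mom P a b := by
  ext i j
  simp only [mom, Matrix.of_apply, Matrix.mul_apply, Matrix.mulVec, dotProduct, Finset.sum_mul,
    mul_assoc]
  rw [integral_finsetSum _ fun k _ => (ha.integrable_mul hb k j).const_mul (M i k)]
  simp only [integral_const_mul]

theorem mom_add_right {a : Ω → ι → ℝ} {b b' : Ω → κ → ℝ} (ha : SqInt P a) (hb : SqInt P b)
    (hb' : SqInt P b') : mom P a (fun ω => b ω + b' ω) = mom P a b + mom P a b' := by
  rw [← mom_transpose, mom_add_left hb hb' ha, Matrix.transpose_add, mom_transpose, mom_transpose]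

theorem mom_mulVec_right {a : Ω → ι → ℝ} {b : Ω → κ → ℝ} (M : Matrix κ' κ ℝ) (ha : SqInt P a)
    (hb : SqInt P b) : mom P a (fun ω => M *ᵥ b ω) = mom P a b * Mᵀ := by
  rw [← mom_transpose, mom_mulVec_left M hb ha, Matrix.transpose_mul, mom_transpose]

theorem integrable_quad {a : Ω → ι → ℝ} {b : Ω → κ → ℝ} (Q : Matrix ι κ ℝ) (ha : SqInt P a)
    (hb : SqInt P b) : Integrable (fun ω => a ω ⬝ᵥ (Q *ᵥ b ω)) P := by
  simp only [dotProduct]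
  exact integrable_finsetSum _ fun i _ => ha.integrable_mul (hb.mulVec Q) i i

theorem integral_quad {a : Ω → ι → ℝ} {b : Ω → κ → ℝ} (Q : Matrix ι κ ℝ) (ha : SqInt P a)
    (hb : SqInt P b) : ∫ ω, a ω ⬝ᵥ (Q *ᵥ b ω) ∂P = (mom P a b * Qᵀ).trace := by
  rw [← mom_mulVec_right Q ha hb]
  simp only [dotProduct, Matrix.trace, Matrix.diag, mom, Matrix.of_apply]
  exact integral_finsetSum _ fun i _ => ha.integrable_mul (hb.mulVec Q) i i

/-- Used to bound correlations of the initial state with the noise uniformly in time. -/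
theorem abs_mom_le {a : Ω → ι → ℝ} {b : Ω → κ → ℝ} (ha : SqInt P a) (hb : SqInt P b) (i : ι)
    (j : κ) : |mom P a b i j| ≤ mom P a a i i + mom P b b j j := by
  have h1 := ha.integrable_mul ha i i
  have h2 := hb.integrable_mul hb j j
  simp only [mom, Matrix.of_apply]
  rw [← integral_add h1 h2]
  refine (abs_integral_le_integral_abs).trans
    (integral_mono (ha.integrable_mul hb i j).abs (h1.add h2) fun ω => ?_)
  simp only
  rw [abs_le]
  constructor <;> nlinarith [sq_nonneg (a ω i + b ω j), sq_nonneg (a ω i - b ω j),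
    sq_nonneg (a ω i), sq_nonneg (b ω j)]

theorem mom_self_posSemidef {a : Ω → ι → ℝ} (ha : SqInt P a) : (mom P a a).PosSemidef := by
  refine Matrix.PosSemidef.of_dotProduct_mulVec_nonneg ?_ fun x => ?_
  · change (mom P a a)ᴴ = _
    rw [Matrix.conjTranspose_eq_transpose_of_trivial, mom_transpose]
  · have h1 : mom P (fun ω => (Matrix.of fun (_ : Unit) j => x j) *ᵥ a ω)
        (fun ω => (Matrix.of fun (_ : Unit) j => x j) *ᵥ a ω) () () = x ⬝ᵥ (mom P a a *ᵥ x) := by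
      rw [mom_mulVec_left _ ha (ha.mulVec _), mom_mulVec_right _ ha ha, ← Matrix.mul_assoc,
        Matrix.dotProduct_mulVec]
      rfl
    rw [star_trivial, ← h1]
    exact integral_nonneg fun ω => mul_self_nonneg _

end Moments

/-! ### White noise, stationary second moments, and limits of average costs. -/

section Noise

variable {Ω : Type*} [MeasurableSpace Ω] {P : Measure Ω} [IsProbabilityMeasure P]
  {nx nu ny : ℕ} (S : LQGData nx nu ny)

/-- Centered white noise with covariance `diag (Vw, Vv)`. -/
structure IsWhiteNoise (P : Measure Ω) (δ : ℕ → Ω → Fin nx ⊕ Fin ny → ℝ) : Prop where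
  sqInt : ∀ t, SqInt P (δ t)
  mean : ∀ t i, ∫ ω, δ t ω i ∂P = 0
  uncorrelated : ∀ s t, s ≠ t → mom P (δ s) (δ t) = 0
  cov : ∀ t, mom P (δ t) (δ t) = Matrix.fromBlocks S.Vw 0 0 S.Vv

theorem posSemidef_blockDiagonal {m n : Type} [Fintype m] [Fintype n] {V : Matrix m m ℝ}
    {W : Matrix n n ℝ} (hV : V.PosSemidef) (hW : W.PosSemidef) :
    (Matrix.fromBlocks V 0 0 W).PosSemidef := by
  refine Matrix.PosSemidef.of_dotProduct_mulVec_nonneg ?_ fun x => ?_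
  · exact Matrix.IsHermitian.fromBlocks hV.isHermitian (by simp) hW.isHermitian
  · rw [star_trivial, Matrix.fromBlocks_mulVec, ← Sum.elim_comp_inl_inr x]
    simp only [Sum.elim_comp_inl, Sum.elim_comp_inr, Matrix.zero_mulVec, add_zero, zero_add,
      sumElim_dotProduct_sumElim]
    have h1 := hV.dotProduct_mulVec_nonneg (x ∘ Sum.inl)
    have h2 := hW.dotProduct_mulVec_nonneg (x ∘ Sum.inr)
    simp only [star_trivial] at h1 h2
    exact add_nonneg h1 h2

/-- Later arguments use the noise only through these second-order properties, and orthogonality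
takes the place of independence. -/
theorem isWhiteNoise_of_gaussian (hVw : S.Vw.PosSemidef) (hVv : S.Vv.PosDef)
    {d : ℕ → Ω → Noise nx ny} (hm : ∀ t, Measurable (d t)) (hi : iIndepFun d P)
    (hl : ∀ t, P.map (d t) = multivariateGaussian 0 (Matrix.fromBlocks S.Vw 0 0 S.Vv)) :
    IsWhiteNoise S P (fun t ω => (d t ω).ofLp) := by
  have hV := posSemidef_blockDiagonal hVw hVv.posSemidef
  set μ := multivariateGaussian (0 : Noise nx ny) (Matrix.fromBlocks S.Vw 0 0 S.Vv) with hμ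
  have hev : ∀ i, Measurable fun x : Noise nx ny => x i := fun i => by fun_prop
  have hL2 : ∀ i, MemLp (fun x : Noise nx ny => x i) 2 μ := fun i => by
    have h1 : MemLp (id : Noise nx ny → Noise nx ny) 2 μ := IsGaussian.memLp_two_id
    refine MemLp.of_le h1 (hev i).aestronglyMeasurable (Eventually.of_forall fun x => ?_)
    exact PiLp.norm_apply_le x i
  have hmean : ∀ i, ∫ x : Noise nx ny, x i ∂μ = 0 := fun i => by
    have h1 : ∫ x : Noise nx ny, x ∂μ = 0 := integral_id_multivariateGaussian
    have h2 := ContinuousLinearMap.integral_comp_comm (EuclideanSpace.proj (𝕜 := ℝ) i)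
      (φ := fun x : Noise nx ny => x) (μ := μ) IsGaussian.integrable_fun_id
    rw [h1, map_zero] at h2
    exact h2
  have hsq : ∀ t, SqInt P (fun ω => (d t ω).ofLp) := fun t i => by
    have h1 := hL2 i
    rw [← hl t] at h1
    exact h1.comp_of_map (hm t).aemeasurable
  have hmean' : ∀ t i, ∫ ω, (d t ω).ofLp i ∂P = 0 := fun t i => by
    rw [← hmean i, ← hl t,
      integral_map (hm t).aemeasurable (hev i).aestronglyMeasurable]
  refine ⟨hsq, hmean', fun s t hst => ?_, fun t => ?_⟩
  · ext i j
    have h1 : IndepFun (fun ω => (d s ω).ofLp i) (fun ω => (d t ω).ofLp j) P :=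
      (hi.indepFun hst).comp (hev i) (hev j)
    have h2 := h1.integral_mul_eq_mul_integral (hsq s i).aestronglyMeasurable
      (hsq t j).aestronglyMeasurable
    simp only [mom, Matrix.of_apply, Matrix.zero_apply]
    refine h2.trans ?_
    rw [hmean' s i, zero_mul]
  · ext i j
    have h1 := covariance_eval_multivariateGaussian (μ := (0 : Noise nx ny)) hV i j
    rw [← hμ, covariance_eq_sub (hL2 i) (hL2 j), hmean i, zero_mul, sub_zero, ← hl t] at h1
    rw [← h1]
    refine (integral_map (f := fun x : Noise nx ny => x i * x j) (hm t).aemeasurable ?_).symm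
    exact ((hev i).mul (hev j)).aestronglyMeasurable

variable {S} {δ : ℕ → Ω → Fin nx ⊕ Fin ny → ℝ}
variable {ι κ : Type} [Fintype ι] [DecidableEq ι] [Fintype κ] [DecidableEq κ]

/-- Second moments of a stable linear recursion driven by white noise. -/
theorem exists_mom_limit (hδ : IsWhiteNoise S P δ) {M : Matrix ι ι ℝ} (hM : IsSchur M)
    (N : Matrix ι (Fin nx ⊕ Fin ny) ℝ) :
    ∃ Z : Matrix ι ι ℝ, ∀ (t₀ : ℕ) (s : ℕ → Ω → ι → ℝ), SqInt P (s 0) →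
      (∀ t ω, s (t + 1) ω = M *ᵥ s t ω + N *ᵥ δ (t₀ + t) ω) →
      (∀ t, SqInt P (s t)) ∧ Tendsto (fun t => mom P (s t) (δ (t₀ + t))) atTop (𝓝 0) ∧
      Tendsto (fun t => mom P (s t) (s t)) atTop (𝓝 Z) := by
  obtain ⟨Z, hZ⟩ := hM.exists_tendsto_sylvester hM (N * Matrix.fromBlocks S.Vw 0 0 S.Vv * Nᵀ)
  refine ⟨Z, fun t₀ s hs0 hs => ?_⟩
  have hfun : ∀ t, s (t + 1) = fun ω => M *ᵥ s t ω + N *ᵥ δ (t₀ + t) ω := fun t => funext (hs t)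
  have hsq : ∀ t, SqInt P (s t) := by
    intro t
    induction t with
    | zero => exact hs0
    | succ t ih => rw [hfun]; exact (ih.mulVec M).add ((hδ.sqInt _).mulVec N)
  -- The initial state may be correlated with the whole noise. Such correlations are propagated by M
  -- ^ t and stay bounded at the start, so they disappear in the limit; this admits arbitrary
  -- square-integrable initial controller states.
  have hC : ∀ t r, t₀ + t ≤ r → mom P (s t) (δ r) = M ^ t * mom P (s 0) (δ r) := by
    intro t
    induction t with
    | zero => intro r _; simp
    | succ t ih =>
      intro r hr
      rw [hfun, mom_add_left ((hsq t).mulVec M) ((hδ.sqInt _).mulVec N) (hδ.sqInt r),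
        mom_mulVec_left M (hsq t) (hδ.sqInt r), mom_mulVec_left N (hδ.sqInt _) (hδ.sqInt r),
        hδ.uncorrelated _ _ (by omega), ih r (by omega), Matrix.mul_zero, add_zero, pow_succ',
        Matrix.mul_assoc]
  have hC0 : Tendsto (fun t => mom P (s t) (δ (t₀ + t))) atTop (𝓝 0) := by
    refine tendsto_pi_nhds.2 fun i => tendsto_pi_nhds.2 fun j => ?_
    simp only [hC _ _ le_rfl, Matrix.mul_apply]
    rw [show (0 : Matrix ι (Fin nx ⊕ Fin ny) ℝ) i j = ∑ _k : ι, (0 : ℝ) by simp]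
    refine tendsto_finsetSum _ fun k _ => ?_
    refine Tendsto.zero_mul_isBoundedUnder_le (hM.tendsto_pow_entry i k) ?_
    refine isBoundedUnder_of ⟨mom P (s 0) (s 0) k k
      + Matrix.fromBlocks S.Vw 0 0 S.Vv j j, fun t => ?_⟩
    have := abs_mom_le (hsq 0) (hδ.sqInt (t₀ + t)) k j
    rwa [hδ.cov] at this
  refine ⟨hsq, hC0, hZ (fun t => M * mom P (s t) (δ (t₀ + t)) * Nᵀ
    + (M * mom P (s t) (δ (t₀ + t)) * Nᵀ)ᵀ + N * Matrix.fromBlocks S.Vw 0 0 S.Vv * Nᵀ) _ ?_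
    fun t => ?_⟩
  · have hc : Continuous fun C : Matrix ι (Fin nx ⊕ Fin ny) ℝ => M * C * Nᵀ + (M * C * Nᵀ)ᵀ
        + N * Matrix.fromBlocks S.Vw 0 0 S.Vv * Nᵀ := by fun_prop
    simpa [Function.comp_def] using (hc.tendsto 0).comp hC0
  · have h1 := (hsq t).mulVec M
    have h2 := (hδ.sqInt (t₀ + t)).mulVec N
    have h3 := hsq t
    have h4 := hδ.sqInt (t₀ + t)
    rw [hfun, mom_add_left h1 h2 (h1.add h2), mom_add_right h1 h1 h2, mom_add_right h2 h1 h2,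
      mom_mulVec_left M h3 h1, mom_mulVec_right M h3 h3, mom_mulVec_left M h3 h2,
      mom_mulVec_right N h3 h4, mom_mulVec_left N h4 h1, mom_mulVec_right M h4 h3,
      mom_mulVec_left N h4 h2, mom_mulVec_right N h4 h4, hδ.cov]
    simp only [Matrix.transpose_mul, Matrix.transpose_transpose, mom_transpose, Matrix.mul_assoc]
    abel

theorem stage_nonneg (hQ : S.Qy.PosDef) (hR : S.Ru.PosDef) (y : Fin ny → ℝ) (u : Fin nu → ℝ) :
    0 ≤ S.stage y u := by
  have h1 := hQ.posSemidef.dotProduct_mulVec_nonneg y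
  have h2 := hR.posSemidef.dotProduct_mulVec_nonneg u
  simp only [star_trivial] at h1 h2
  exact add_nonneg h1 h2

theorem integrable_stage {y : Ω → Fin ny → ℝ} {u : Ω → Fin nu → ℝ} (hy : SqInt P y)
    (hu : SqInt P u) : Integrable (fun ω => S.stage (y ω) (u ω)) P :=
  (integrable_quad S.Qy hy hy).add (integrable_quad S.Ru hu hu)

theorem integral_stage {y : Ω → Fin ny → ℝ} {u : Ω → Fin nu → ℝ} (hy : SqInt P y)
    (hu : SqInt P u) : ∫ ω, S.stage (y ω) (u ω) ∂P
      = (mom P y y * S.Qyᵀ).trace + (mom P u u * S.Ruᵀ).trace := by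
  rw [← integral_quad S.Qy hy hy, ← integral_quad S.Ru hu hu]
  exact integral_add (integrable_quad S.Qy hy hy) (integrable_quad S.Ru hu hu)

theorem comp_inr_eq (δ : Fin nx ⊕ Fin ny → ℝ) :
    δ ∘ Sum.inr = (Matrix.fromCols 0 1 : Matrix (Fin ny) (Fin nx ⊕ Fin ny) ℝ) *ᵥ δ := by
  conv_rhs => rw [← Sum.elim_comp_inl_inr δ]
  rw [Matrix.fromCols_mulVec_sumElim, Matrix.zero_mulVec, Matrix.one_mulVec, zero_add]

theorem comp_inl_eq (δ : Fin nx ⊕ Fin ny → ℝ) :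
    δ ∘ Sum.inl = (Matrix.fromCols 1 0 : Matrix (Fin nx) (Fin nx ⊕ Fin ny) ℝ) *ᵥ δ := by
  conv_rhs => rw [← Sum.elim_comp_inl_inr δ]
  rw [Matrix.fromCols_mulVec_sumElim, Matrix.zero_mulVec, Matrix.one_mulVec, add_zero]

/-- The expected running cost of a stable linear recursion driven by white noise converges, to a
limit which does not depend on the initial state. -/
theorem exists_stage_limit (hδ : IsWhiteNoise S P δ) {M : Matrix ι ι ℝ} (hM : IsSchur M)
    (N : Matrix ι (Fin nx ⊕ Fin ny) ℝ) (Ψ : Matrix (Fin ny) ι ℝ) (Φ : Matrix (Fin nu) ι ℝ) :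
    ∃ ℓ : ℝ, ∀ (t₀ : ℕ) (s : ℕ → Ω → ι → ℝ), SqInt P (s 0) →
      (∀ t ω, s (t + 1) ω = M *ᵥ s t ω + N *ᵥ δ (t₀ + t) ω) →
      Tendsto (fun t => ∫ ω, S.stage (Ψ *ᵥ s t ω + δ (t₀ + t) ω ∘ Sum.inr) (Φ *ᵥ s t ω) ∂P)
        atTop (𝓝 ℓ) := by
  obtain ⟨Z, hZ⟩ := exists_mom_limit hδ hM N
  set E : Matrix (Fin ny) (Fin nx ⊕ Fin ny) ℝ := Matrix.fromCols 0 1 with hE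
  set V := Matrix.fromBlocks S.Vw 0 0 S.Vv with hV
  let f : Matrix ι ι ℝ × Matrix ι (Fin nx ⊕ Fin ny) ℝ → ℝ := fun p =>
    ((Ψ * p.1 * Ψᵀ + Ψ * p.2 * Eᵀ + (Ψ * p.2 * Eᵀ)ᵀ + E * V * Eᵀ) * S.Qyᵀ).trace
      + ((Φ * p.1 * Φᵀ) * S.Ruᵀ).trace
  have hf : Continuous f := by
    have h1 : Continuous fun p : Matrix ι ι ℝ × Matrix ι (Fin nx ⊕ Fin ny) ℝ =>
        (Ψ * p.1 * Ψᵀ + Ψ * p.2 * Eᵀ + (Ψ * p.2 * Eᵀ)ᵀ + E * V * Eᵀ) * S.Qyᵀ := by fun_prop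
    have h2 : Continuous fun p : Matrix ι ι ℝ × Matrix ι (Fin nx ⊕ Fin ny) ℝ =>
        (Φ * p.1 * Φᵀ) * S.Ruᵀ := by fun_prop
    exact h1.matrix_trace.add h2.matrix_trace
  refine ⟨f (Z, 0), fun t₀ s hs0 hs => ?_⟩
  obtain ⟨hsq, hC, hZs⟩ := hZ t₀ s hs0 hs
  have h1 := (hf.tendsto (Z, 0)).comp (hZs.prodMk_nhds hC)
  refine h1.congr fun t => ?_
  have h3 := hsq t
  have h4 := hδ.sqInt (t₀ + t)
  simp only [comp_inr_eq, ← hE]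
  rw [integral_stage ((h3.mulVec Ψ).add (h4.mulVec E)) (h3.mulVec Φ),
    mom_mulVec_left Φ h3 (h3.mulVec Φ), mom_mulVec_right Φ h3 h3,
    mom_add_left (h3.mulVec Ψ) (h4.mulVec E) ((h3.mulVec Ψ).add (h4.mulVec E)),
    mom_add_right (h3.mulVec Ψ) (h3.mulVec Ψ) (h4.mulVec E),
    mom_add_right (h4.mulVec E) (h3.mulVec Ψ) (h4.mulVec E), mom_mulVec_left Ψ h3 (h3.mulVec Ψ),
    mom_mulVec_right Ψ h3 h3, mom_mulVec_left Ψ h3 (h4.mulVec E), mom_mulVec_right E h3 h4,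
    mom_mulVec_left E h4 (h3.mulVec Ψ), mom_mulVec_right Ψ h4 h3,
    mom_mulVec_left E h4 (h4.mulVec E), mom_mulVec_right E h4 h4, hδ.cov]
  simp only [f, Function.comp, Matrix.transpose_mul, Matrix.transpose_transpose, mom_transpose,
    Matrix.mul_assoc, add_assoc, hV]

theorem tendsto_average {a : ℕ → ℝ} {ℓ : ℝ} (ha : Tendsto a atTop (𝓝 ℓ)) (t₀ : ℕ) :
    Tendsto (fun T : ℕ => 1 / (T : ℝ) * ∑ t ∈ Finset.Icc t₀ T, a t) atTop (𝓝 ℓ) := by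
  have h1 := ha.cesaro
  -- The sum runs from t₀ to T inclusive but is divided by T: compared with the Cesàro mean it has
  -- the extra term `a T` and lacks a fixed head, both negligible.
  have h2 : Tendsto (fun T : ℕ => (T : ℝ)⁻¹ * (a T - ∑ t ∈ Finset.range t₀, a t)) atTop (𝓝 0) := by
    have := tendsto_inv_atTop_nhds_zero_nat (𝕜 := ℝ).mul
      (ha.sub_const (∑ t ∈ Finset.range t₀, a t))
    simpa using this
  have h3 := h1.add h2
  rw [add_zero] at h3
  refine h3.congr' ?_
  filter_upwards [eventually_ge_atTop t₀] with T hT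
  have h4 : ∑ t ∈ Finset.Icc t₀ T, a t
      = ∑ t ∈ Finset.range (T + 1), a t - ∑ t ∈ Finset.range t₀, a t := by
    rw [Finset.sum_range_sub_sum_range (by omega)]
    congr 1
    ext i; simp; omega
  rw [h4, Finset.sum_range_succ]
  ring

theorem avgCost_eq {r : Ω → ℕ → ℝ} (h0 : ∀ ω t, 0 ≤ r ω t) (t₀ : ℕ)
    (hi : ∀ t, t₀ ≤ t → Integrable (fun ω => r ω t) P) (T : ℕ) :
    avgCost P r t₀ T
      = ENNReal.ofReal (1 / (T : ℝ) * ∑ t ∈ Finset.Icc t₀ T, ∫ ω, r ω t ∂P) := by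
  have hi' : ∀ t ∈ Finset.Icc t₀ T, Integrable (fun ω => r ω t) P := fun t ht =>
    hi t (Finset.mem_Icc.1 ht).1
  rw [avgCost, ← ofReal_integral_eq_lintegral_ofReal]
  · rw [integral_const_mul, integral_finsetSum _ hi']
  · exact (integrable_finsetSum _ hi').const_mul _
  · exact Eventually.of_forall fun ω =>
      mul_nonneg (by positivity) (Finset.sum_nonneg fun t _ => h0 ω t)

theorem tendsto_avgCost {r : Ω → ℕ → ℝ} (h0 : ∀ ω t, 0 ≤ r ω t) {t₀ : ℕ}
    (hi : ∀ t, t₀ ≤ t → Integrable (fun ω => r ω t) P) {ℓ : ℝ}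
    (hl : Tendsto (fun t => ∫ ω, r ω t ∂P) atTop (𝓝 ℓ)) :
    Tendsto (avgCost P r t₀) atTop (𝓝 (ENNReal.ofReal ℓ)) := by
  have h1 := (ENNReal.continuous_ofReal.tendsto ℓ).comp (tendsto_average hl t₀)
  exact h1.congr fun T => (avgCost_eq h0 t₀ hi T).symm

end Noise

/-! ### Norm bounds for quadratic forms. -/

section Bounds

variable {n p : Type} [Fintype n] [DecidableEq n] [Fintype p] [DecidableEq p]

theorem exists_mulVec_bound (M : Matrix p n ℝ) : ∃ k : ℝ, 0 ≤ k ∧ ∀ v, ‖M *ᵥ v‖ ≤ k * ‖v‖ :=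
  ⟨‖M.mulVecLin.toContinuousLinearMap‖, norm_nonneg _,
    M.mulVecLin.toContinuousLinearMap.le_opNorm⟩

theorem norm_sq_le_dotProduct (v : n → ℝ) : ‖v‖ ^ 2 ≤ v ⬝ᵥ v := by
  have h0 : 0 ≤ v ⬝ᵥ v := Finset.sum_nonneg fun i _ => mul_self_nonneg _
  have h1 : ‖v‖ ≤ Real.sqrt (v ⬝ᵥ v) := by
    rw [pi_norm_le_iff_of_nonneg (Real.sqrt_nonneg _)]
    intro i
    rw [Real.norm_eq_abs]
    refine Real.abs_le_sqrt ?_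
    rw [pow_two]
    exact Finset.single_le_sum (f := fun i => v i * v i) (fun i _ => mul_self_nonneg _)
      (Finset.mem_univ i)
  calc ‖v‖ ^ 2 ≤ Real.sqrt (v ⬝ᵥ v) ^ 2 := by gcongr
    _ = _ := Real.sq_sqrt h0

theorem exists_quad_bound (Q : Matrix n n ℝ) : ∃ k : ℝ, 0 ≤ k ∧ ∀ v, v ⬝ᵥ (Q *ᵥ v) ≤ k * ‖v‖ ^ 2 := by
  obtain ⟨k, hk, h⟩ := exists_mulVec_bound Q
  refine ⟨Fintype.card n * k, by positivity, fun v => ?_⟩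
  calc v ⬝ᵥ (Q *ᵥ v) ≤ ∑ _i : n, ‖v‖ * (k * ‖v‖) := by
        refine Finset.sum_le_sum fun i _ => ?_
        refine (le_abs_self _).trans ?_
        rw [abs_mul]
        exact mul_le_mul (norm_le_pi_norm v i) ((norm_le_pi_norm (Q *ᵥ v) i).trans (h v))
          (abs_nonneg _) (norm_nonneg _)
    _ = _ := by simp; ring

open scoped MatrixOrder Matrix.Norms.L2Operator in
theorem posSemidef_exists_sqrt {V : Matrix n n ℝ} (hV : V.PosSemidef) :
    ∃ B : Matrix n n ℝ, V = Bᵀ * B := by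
  obtain ⟨B, hB⟩ := CStarAlgebra.nonneg_iff_eq_star_mul_self.1 (Matrix.nonneg_iff_posSemidef.2 hV)
  exact ⟨B, hB⟩

/-- A merely semidefinite form cannot control v, but it controls V v, because V = BᵀB. This is what
is available for Vw. -/
theorem posSemidef_exists_bound {V : Matrix n n ℝ} (hV : V.PosSemidef) :
    ∃ k : ℝ, 0 ≤ k ∧ ∀ v, ‖V *ᵥ v‖ ^ 2 ≤ k * (v ⬝ᵥ (V *ᵥ v)) := by
  obtain ⟨B, hB⟩ := posSemidef_exists_sqrt hV
  obtain ⟨k, hk, h⟩ := exists_mulVec_bound Bᵀ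
  refine ⟨k ^ 2, by positivity, fun v => ?_⟩
  have h1 : v ⬝ᵥ (V *ᵥ v) = (B *ᵥ v) ⬝ᵥ (B *ᵥ v) := by
    rw [hB, ← Matrix.mulVec_mulVec, Matrix.dotProduct_mulVec, Matrix.vecMul_transpose]
  rw [h1]
  have h2 : ‖V *ᵥ v‖ ≤ k * ‖B *ᵥ v‖ := by rw [hB, ← Matrix.mulVec_mulVec]; exact h _
  calc ‖V *ᵥ v‖ ^ 2 ≤ (k * ‖B *ᵥ v‖) ^ 2 := by gcongr
    _ = k ^ 2 * ‖B *ᵥ v‖ ^ 2 := by ring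
    _ ≤ _ := by gcongr; exact norm_sq_le_dotProduct _

theorem posDef_exists_bound {V : Matrix n n ℝ} (hV : V.PosDef) :
    ∃ k : ℝ, 0 ≤ k ∧ ∀ v, ‖v‖ ^ 2 ≤ k * (v ⬝ᵥ (V *ᵥ v)) := by
  obtain ⟨k, hk, h⟩ := posSemidef_exists_bound hV.posSemidef
  obtain ⟨k', hk', h'⟩ := exists_mulVec_bound V⁻¹
  refine ⟨k' ^ 2 * k, by positivity, fun v => ?_⟩
  have h1 := h' (V *ᵥ v)
  rw [Matrix.mulVec_mulVec, Matrix.nonsing_inv_mul _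
    ((Matrix.isUnit_iff_isUnit_det _).1 hV.isUnit), Matrix.one_mulVec] at h1
  calc ‖v‖ ^ 2 ≤ (k' * ‖V *ᵥ v‖) ^ 2 := by gcongr
    _ = k' ^ 2 * ‖V *ᵥ v‖ ^ 2 := by ring
    _ ≤ k' ^ 2 * (k * (v ⬝ᵥ (V *ᵥ v))) := by gcongr; exact h v
    _ = _ := by ring

theorem PosSemidef.quad_nonneg {V : Matrix n n ℝ} (hV : V.PosSemidef) (v : n → ℝ) :
    0 ≤ v ⬝ᵥ (V *ᵥ v) := by
  simpa using hV.dotProduct_mulVec_nonneg v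

end Bounds

/-! ### Riccati equations and convergence of the time-varying Kalman filter. -/

section Riccati

variable {n p : Type} [Fintype n] [DecidableEq n] [Fintype p] [DecidableEq p]

theorem innov_posDef {q : Type} [Fintype q] [DecidableEq q] {P : Matrix n n ℝ} {V : Matrix q q ℝ}
    (hP : P.PosSemidef) (hV : V.PosDef) (C : Matrix q n ℝ) : (C * P * Cᵀ + V).PosDef := by
  have := hP.mul_mul_conjTranspose_same C
  rw [Matrix.conjTranspose_eq_transpose_of_trivial] at this
  exact hV.posSemidef_add this

theorem riccatiGain_spec {A : Matrix n n ℝ} {B : Matrix n p ℝ} {W X : Matrix n n ℝ}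
    {R : Matrix p p ℝ} (hR : R.PosDef) (hX : IsStabilizingRiccati A B W R X) :
    (R + Bᵀ * X * B) * riccatiGain A B R X = -(Bᵀ * X * A) ∧
    X = Aᵀ * X * A - (riccatiGain A B R X)ᵀ * (R + Bᵀ * X * B) * riccatiGain A B R X + W := by
  have hS : (R + Bᵀ * X * B).PosDef := by
    have := innov_posDef hX.posSemidef hR Bᵀ
    rwa [Matrix.transpose_transpose, add_comm] at this
  have hu : IsUnit (R + Bᵀ * X * B).det := (Matrix.isUnit_iff_isUnit_det _).1 hS.isUnit
  have hSt : (R + Bᵀ * X * B)ᵀ = R + Bᵀ * X * B := hS.isHermitian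
  have hXt : Xᵀ = X := hX.posSemidef.isHermitian
  rw [Matrix.mul_assoc Bᵀ X B] at hSt
  have h1 : (R + Bᵀ * X * B) * riccatiGain A B R X = -(Bᵀ * X * A) := by
    rw [riccatiGain, Matrix.mul_neg]
    simp only [← Matrix.mul_assoc]
    rw [Matrix.mul_nonsing_inv _ hu, Matrix.one_mul]
  refine ⟨h1, ?_⟩
  rw [Matrix.mul_assoc (riccatiGain A B R X)ᵀ, h1]
  conv_lhs => rw [hX.eq]
  simp only [riccatiGain, Matrix.transpose_neg, Matrix.transpose_mul, Matrix.transpose_nonsing_inv,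
    hSt, hXt, Matrix.transpose_transpose, Matrix.neg_mul, Matrix.mul_neg, neg_neg, Matrix.mul_assoc]

variable {nx nu ny : ℕ} (S : LQGData nx nu ny)

/-- The Kalman gain for the error covariance `P`. -/
noncomputable def filterGain (P : Matrix (Fin nx) (Fin nx) ℝ) : Matrix (Fin nx) (Fin ny) ℝ :=
  S.A * P * S.Cᵀ * (S.C * P * S.Cᵀ + S.Vv)⁻¹

/-- The error covariance after one step of the filter with gain `K`. -/
noncomputable def covStep (K : Matrix (Fin nx) (Fin ny) ℝ) (P : Matrix (Fin nx) (Fin nx) ℝ) :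
    Matrix (Fin nx) (Fin nx) ℝ :=
  (S.A - K * S.C) * P * (S.A - K * S.C)ᵀ + (S.Vw + K * S.Vv * Kᵀ)

variable {S}

theorem filterGain_mul (hVv : S.Vv.PosDef) {P : Matrix (Fin nx) (Fin nx) ℝ} (hP : P.PosSemidef) :
    filterGain S P * (S.C * P * S.Cᵀ + S.Vv) = S.A * P * S.Cᵀ := by
  rw [filterGain, Matrix.mul_assoc, Matrix.nonsing_inv_mul _
    ((Matrix.isUnit_iff_isUnit_det _).1 (innov_posDef hP hVv S.C).isUnit), Matrix.mul_one]

/-- The normal equation of the Kalman gain: the next error is uncorrelated with the current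
innovation Ce + v. -/
theorem filterGain_orth (hVv : S.Vv.PosDef) {P : Matrix (Fin nx) (Fin nx) ℝ} (hP : P.PosSemidef) :
    (S.A - filterGain S P * S.C) * P * S.Cᵀ = filterGain S P * S.Vv := by
  have h := filterGain_mul hVv hP
  rw [Matrix.mul_add] at h
  rw [Matrix.sub_mul, Matrix.sub_mul, ← h]
  simp only [Matrix.mul_assoc]
  abel

theorem covStep_eq (hVv : S.Vv.PosDef) {P : Matrix (Fin nx) (Fin nx) ℝ} (hP : P.PosSemidef) :
    covStep S (filterGain S P) P = (S.A - filterGain S P * S.C) * P * S.Aᵀ + S.Vw := by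
  have h := filterGain_orth hVv hP
  rw [covStep, Matrix.transpose_sub, Matrix.mul_sub, Matrix.transpose_mul, ← Matrix.mul_assoc, h]
  abel

theorem covStep_posSemidef (hVw : S.Vw.PosSemidef) (hVv : S.Vv.PosDef)
    (K : Matrix (Fin nx) (Fin ny) ℝ) {P : Matrix (Fin nx) (Fin nx) ℝ} (hP : P.PosSemidef) :
    (covStep S K P).PosSemidef := by
  have h1 := hP.mul_mul_conjTranspose_same (S.A - K * S.C)
  have h2 := hVv.posSemidef.mul_mul_conjTranspose_same K
  rw [Matrix.conjTranspose_eq_transpose_of_trivial] at h1 h2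
  exact h1.add (hVw.add h2)

/-- Completing the square in the gain; the excess is positive semidefinite, so the Kalman gain
minimizes the next covariance. -/
theorem covStep_sub (hVv : S.Vv.PosDef) {P : Matrix (Fin nx) (Fin nx) ℝ} (hP : P.PosSemidef)
    (K : Matrix (Fin nx) (Fin ny) ℝ) :
    covStep S K P - covStep S (filterGain S P) P
      = (K - filterGain S P) * (S.C * P * S.Cᵀ + S.Vv) * (K - filterGain S P)ᵀ := by
  have h := filterGain_mul hVv hP
  have hPt : Pᵀ = P := hP.isHermitian
  have hVt : S.Vvᵀ = S.Vv := hVv.isHermitian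
  set G := filterGain S P
  set Sg := S.C * P * S.Cᵀ + S.Vv with hSg
  have hSt : Sgᵀ = Sg := (innov_posDef hP hVv S.C).isHermitian
  have h' : S.C * P * S.Aᵀ = Sg * Gᵀ := by
    have := congrArg Matrix.transpose h
    rw [Matrix.transpose_mul, hSt] at this
    rw [this]
    simp only [Matrix.transpose_mul, Matrix.transpose_transpose, hPt, Matrix.mul_assoc]
  have key : ∀ Q : Matrix (Fin nx) (Fin ny) ℝ, covStep S Q P
      = S.A * P * S.Aᵀ + S.Vw - Q * (Sg * Gᵀ) - G * Sg * Qᵀ + Q * Sg * Qᵀ := by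
    intro Q
    rw [← h', h, covStep, hSg, Matrix.transpose_sub, Matrix.transpose_mul]
    simp only [Matrix.sub_mul, Matrix.mul_sub, Matrix.mul_add, Matrix.add_mul, Matrix.mul_assoc]
    abel
  rw [key, key, Matrix.transpose_sub]
  simp only [Matrix.sub_mul, Matrix.mul_sub, Matrix.mul_assoc]
  abel

variable {Y : Matrix (Fin nx) (Fin nx) ℝ}

theorem filterGain_eq (hVv : S.Vv.PosDef) (hY : IsStabilizingRiccati S.Aᵀ S.Cᵀ S.Vw S.Vv Y) :
    riccatiGain S.Aᵀ S.Cᵀ S.Vv Y = -(filterGain S Y)ᵀ := by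
  have hYs : Yᵀ = Y := hY.posSemidef.isHermitian
  have hVs : S.Vvᵀ = S.Vv := hVv.isHermitian
  simp only [riccatiGain, filterGain, Matrix.transpose_mul, Matrix.transpose_nonsing_inv,
    Matrix.transpose_add, Matrix.transpose_transpose, hYs, hVs, Matrix.mul_assoc, add_comm]

theorem covStep_fixed (hVv : S.Vv.PosDef) (hY : IsStabilizingRiccati S.Aᵀ S.Cᵀ S.Vw S.Vv Y) :
    covStep S (filterGain S Y) Y = Y := by
  have hYs : Yᵀ = Y := hY.posSemidef.isHermitian
  obtain ⟨h1, h2⟩ := riccatiGain_spec hVv hY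
  rw [covStep_eq hVv hY.posSemidef]
  conv_rhs => rw [h2]
  rw [Matrix.mul_assoc (riccatiGain S.Aᵀ S.Cᵀ S.Vv Y)ᵀ, h1, filterGain_eq hVv hY]
  simp only [Matrix.transpose_transpose, Matrix.transpose_neg, Matrix.neg_mul, Matrix.mul_neg,
    Matrix.sub_mul, Matrix.mul_assoc, neg_neg]

theorem schur_filter (hVv : S.Vv.PosDef) (hY : IsStabilizingRiccati S.Aᵀ S.Cᵀ S.Vw S.Vv Y) :
    IsSchur (S.A - filterGain S Y * S.C) := filter_schur S (X := 0) hY hVv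

variable (S) in
/-- The error covariances of the time-varying Kalman filter with known initial state. -/
noncomputable def kalmanCov : ℕ → Matrix (Fin nx) (Fin nx) ℝ
  | 0 => 0
  | t + 1 => covStep S (filterGain S (kalmanCov t)) (kalmanCov t)

theorem kalmanCov_posSemidef (hVw : S.Vw.PosSemidef) (hVv : S.Vv.PosDef) (t : ℕ) :
    (kalmanCov S t).PosSemidef := by
  induction t with
  | zero => exact Matrix.PosSemidef.zero
  | succ t ih => exact covStep_posSemidef hVw hVv _ ih

/-- The next difference from Y is the old one propagated by the stationary filter, plus the excess
caused by using the stationary gain at the current covariance. Both are positive semidefinite. -/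
theorem kalmanCov_le (hVw : S.Vw.PosSemidef) (hVv : S.Vv.PosDef)
    (hY : IsStabilizingRiccati S.Aᵀ S.Cᵀ S.Vw S.Vv Y) (t : ℕ) :
    (Y - kalmanCov S t).PosSemidef := by
  induction t with
  | zero => rw [kalmanCov, sub_zero]; exact hY.posSemidef
  | succ t ih =>
    have hP := kalmanCov_posSemidef (S := S) hVw hVv t
    have h1 := ih.mul_mul_conjTranspose_same (S.A - filterGain S Y * S.C)
    have h2 := (innov_posDef hP hVv S.C).posSemidef.mul_mul_conjTranspose_same
      (filterGain S Y - filterGain S (kalmanCov S t))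
    rw [Matrix.conjTranspose_eq_transpose_of_trivial] at h1 h2
    rw [← covStep_sub hVv hP] at h2
    have h3 := h1.add h2
    convert h3 using 1
    rw [kalmanCov]
    conv_lhs => rw [← covStep_fixed hVv hY]
    simp only [covStep, Matrix.mul_sub, Matrix.sub_mul]
    abel

/-- The difference of two Riccati iterates factors with the stationary filter on the left and the
time-varying one on the right. Iterated, the left factor decays geometrically, so boundedness of the
right factor is enough for convergence. -/
theorem kalmanCov_diff_succ (hVw : S.Vw.PosSemidef) (hVv : S.Vv.PosDef)
    (hY : IsStabilizingRiccati S.Aᵀ S.Cᵀ S.Vw S.Vv Y) (t : ℕ) :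
    Y - kalmanCov S (t + 1) = (S.A - filterGain S Y * S.C) * (Y - kalmanCov S t)
      * (S.A - filterGain S (kalmanCov S t) * S.C)ᵀ := by
  have hP := kalmanCov_posSemidef (S := S) hVw hVv t
  have hVt : S.Vvᵀ = S.Vv := hVv.isHermitian
  have hPt : (kalmanCov S t)ᵀ = kalmanCov S t := hP.isHermitian
  have hWt : S.Vwᵀ = S.Vw := hVw.isHermitian
  have hSt : (kalmanCov S (t + 1))ᵀ = kalmanCov S (t + 1) :=
    (kalmanCov_posSemidef (S := S) hVw hVv (t + 1)).isHermitian
  have e1 : Y - S.Vw = (S.A - filterGain S Y * S.C) * Y * S.Aᵀ := by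
    have h := covStep_eq hVv hY.posSemidef
    rw [covStep_fixed hVv hY] at h
    rw [sub_eq_iff_eq_add]; exact h
  have e2 := filterGain_orth hVv hY.posSemidef
  have e3 : kalmanCov S (t + 1) - S.Vw
      = S.A * kalmanCov S t * (S.A - filterGain S (kalmanCov S t) * S.C)ᵀ := by
    have h := congrArg Matrix.transpose (covStep_eq hVv hP)
    change (kalmanCov S (t + 1))ᵀ = _ at h
    rw [hSt, Matrix.transpose_add, hWt] at h
    rw [sub_eq_iff_eq_add, h]
    simp only [Matrix.transpose_mul, Matrix.transpose_transpose, hPt, Matrix.mul_assoc]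
  have e4 : S.C * kalmanCov S t * (S.A - filterGain S (kalmanCov S t) * S.C)ᵀ
      = S.Vv * (filterGain S (kalmanCov S t))ᵀ := by
    have h := congrArg Matrix.transpose (filterGain_orth hVv hP)
    simpa only [Matrix.transpose_mul, Matrix.transpose_transpose, hPt, hVt, Matrix.mul_assoc]
      using h
  set P := kalmanCov S t
  set H := filterGain S Y
  set G := filterGain S P
  calc Y - kalmanCov S (t + 1) = (Y - S.Vw) - (kalmanCov S (t + 1) - S.Vw) := by abel
    _ = (S.A - H * S.C) * Y * S.Aᵀ - H * S.Vv * Gᵀ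
        - (S.A * P * (S.A - G * S.C)ᵀ - H * (S.Vv * Gᵀ)) := by
        rw [e1, e3, Matrix.mul_assoc H]; abel
    _ = _ := by
        rw [← e2, ← e4]
        simp only [Matrix.transpose_sub, Matrix.transpose_mul, Matrix.sub_mul, Matrix.mul_sub,
          Matrix.mul_assoc]
        abel

/-- The transition matrices of the time-varying Kalman filter. -/
noncomputable def kalmanTrans (S : LQGData nx nu ny) : ℕ → Matrix (Fin nx) (Fin nx) ℝ
  | 0 => 1
  | t + 1 => (S.A - filterGain S (kalmanCov S t) * S.C) * kalmanTrans S t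

theorem kalmanCov_diff (hVw : S.Vw.PosSemidef) (hVv : S.Vv.PosDef)
    (hY : IsStabilizingRiccati S.Aᵀ S.Cᵀ S.Vw S.Vv Y) (t : ℕ) :
    Y - kalmanCov S t = (S.A - filterGain S Y * S.C) ^ t * Y * (kalmanTrans S t)ᵀ := by
  induction t with
  | zero => simp [kalmanCov, kalmanTrans]
  | succ t ih =>
    rw [kalmanCov_diff_succ hVw hVv hY, ih, kalmanTrans, Matrix.transpose_mul, pow_succ']
    simp only [Matrix.mul_assoc]

theorem bil_transfer {m : Type} [Fintype m] (T : Matrix p n ℝ) (M : Matrix p m ℝ) (x : n → ℝ)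
    (y : m → ℝ) : (T *ᵥ x) ⬝ᵥ (M *ᵥ y) = x ⬝ᵥ ((Tᵀ * M) *ᵥ y) := by
  rw [← Matrix.mulVec_mulVec, Matrix.dotProduct_mulVec x, Matrix.vecMul_transpose]

/-- An energy argument on the dual system. The form fᵀP(t)f, at most fᵀYf, accounts for Vw and Vv
along the dual trajectory. Relative to the stable matrix (A + Vw F)ᵀ that trajectory is perturbed
only by terms which Vw and Vv control. -/
theorem kalmanTrans_bound (hVw : S.Vw.PosSemidef) (hVv : S.Vv.PosDef)
    (hY : IsStabilizingRiccati S.Aᵀ S.Cᵀ S.Vw S.Vv Y) (hs : IsStabilizable S.A S.Vw)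
    (f : Fin nx → ℝ) : ∃ b, ∀ t, ‖(kalmanTrans S t)ᵀ *ᵥ f‖ ≤ b := by
  obtain ⟨F, hF⟩ := hs
  set N := (S.A + S.Vw * F)ᵀ with hN
  have hWt : S.Vwᵀ = S.Vw := hVw.isHermitian
  obtain ⟨c, ρ, hc, hρ0, hρ1, hpow⟩ := hF.transpose.exists_norm_pow_mulVec_le
  obtain ⟨k1, hk1, h1⟩ := posSemidef_exists_bound hVw
  obtain ⟨k2, hk2, h2⟩ := posDef_exists_bound hVv
  obtain ⟨k3, hk3, h3⟩ := exists_mulVec_bound Fᵀ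
  obtain ⟨k4, hk4, h4⟩ := exists_mulVec_bound S.Cᵀ
  set κ : ℝ := 2 * (k3 ^ 2 * k1 + k4 ^ 2 * k2) with hκ
  have hκ0 : 0 ≤ κ := by positivity
  have hquad : ∀ t (f : Fin nx → ℝ), f ⬝ᵥ (kalmanCov S (t + 1) *ᵥ f)
      = ((S.A - filterGain S (kalmanCov S t) * S.C)ᵀ *ᵥ f) ⬝ᵥ (kalmanCov S t *ᵥ
        ((S.A - filterGain S (kalmanCov S t) * S.C)ᵀ *ᵥ f))
        + f ⬝ᵥ (S.Vw *ᵥ f) + ((filterGain S (kalmanCov S t))ᵀ *ᵥ f) ⬝ᵥ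
          (S.Vv *ᵥ ((filterGain S (kalmanCov S t))ᵀ *ᵥ f)) := by
    intro t f
    rw [Matrix.mulVec_mulVec, Matrix.mulVec_mulVec, bil_transfer, bil_transfer, kalmanCov, covStep,
      Matrix.add_mulVec, Matrix.add_mulVec, dotProduct_add, dotProduct_add]
    simp only [Matrix.transpose_transpose, Matrix.mul_assoc, add_assoc]
  -- The dual runs backward: the newest gain acts on f first. So f is general in the induction, and
  -- the new perturbation `r₀` takes the last index t.
  have hrep : ∀ t (f : Fin nx → ℝ), ∃ r : ℕ → Fin nx → ℝ,
      (∀ s < t, ‖r s‖ ^ 2 ≤ κ * (f ⬝ᵥ (kalmanCov S t *ᵥ f))) ∧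
      (kalmanTrans S t)ᵀ *ᵥ f = N ^ t *ᵥ f - ∑ s ∈ Finset.range t, N ^ s *ᵥ r s := by
    intro t
    induction t with
    | zero => intro f; exact ⟨0, by simp, by simp [kalmanTrans]⟩
    | succ t ih =>
      intro f
      set G := filterGain S (kalmanCov S t) with hG
      obtain ⟨r, hr1, hr2⟩ := ih ((S.A - G * S.C)ᵀ *ᵥ f)
      set r₀ := Fᵀ *ᵥ (S.Vw *ᵥ f) + S.Cᵀ *ᵥ (Gᵀ *ᵥ f) with hr0
      have hq := hquad t f
      rw [← hG] at hq
      have n1 := PosSemidef.quad_nonneg (kalmanCov_posSemidef (S := S) hVw hVv t)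
        ((S.A - G * S.C)ᵀ *ᵥ f)
      have n2 := PosSemidef.quad_nonneg hVw f
      have n3 := PosSemidef.quad_nonneg hVv.posSemidef (Gᵀ *ᵥ f)
      have hg : (S.A - G * S.C)ᵀ *ᵥ f = N *ᵥ f - r₀ := by
        rw [hr0, hN]
        simp only [Matrix.transpose_sub, Matrix.transpose_add, Matrix.transpose_mul, hWt,
          Matrix.sub_mulVec, Matrix.add_mulVec, Matrix.mulVec_mulVec]
        abel
      have hr0b : ‖r₀‖ ^ 2 ≤ κ * (f ⬝ᵥ (kalmanCov S (t + 1) *ᵥ f)) := by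
        have a1 : ‖r₀‖ ≤ k3 * ‖S.Vw *ᵥ f‖ + k4 * ‖Gᵀ *ᵥ f‖ :=
          (norm_add_le _ _).trans (add_le_add (h3 _) (h4 _))
        have a2 := h1 f
        have a3 := h2 (Gᵀ *ᵥ f)
        calc ‖r₀‖ ^ 2 ≤ (k3 * ‖S.Vw *ᵥ f‖ + k4 * ‖Gᵀ *ᵥ f‖) ^ 2 := by gcongr
          _ ≤ 2 * ((k3 * ‖S.Vw *ᵥ f‖) ^ 2 + (k4 * ‖Gᵀ *ᵥ f‖) ^ 2) := by
              nlinarith [sq_nonneg (k3 * ‖S.Vw *ᵥ f‖ - k4 * ‖Gᵀ *ᵥ f‖)]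
          _ = 2 * (k3 ^ 2 * ‖S.Vw *ᵥ f‖ ^ 2 + k4 ^ 2 * ‖Gᵀ *ᵥ f‖ ^ 2) := by ring
          _ ≤ 2 * (k3 ^ 2 * (k1 * (f ⬝ᵥ (S.Vw *ᵥ f)))
              + k4 ^ 2 * (k2 * ((Gᵀ *ᵥ f) ⬝ᵥ (S.Vv *ᵥ (Gᵀ *ᵥ f))))) := by gcongr
          _ ≤ κ * (f ⬝ᵥ (S.Vw *ᵥ f) + (Gᵀ *ᵥ f) ⬝ᵥ (S.Vv *ᵥ (Gᵀ *ᵥ f))) := by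
              have p1 : 0 ≤ k3 ^ 2 * k1 * ((Gᵀ *ᵥ f) ⬝ᵥ (S.Vv *ᵥ (Gᵀ *ᵥ f))) := by positivity
              have p2 : 0 ≤ k4 ^ 2 * k2 * (f ⬝ᵥ (S.Vw *ᵥ f)) := by positivity
              rw [hκ]; linarith
          _ ≤ _ := by
              rw [hq]
              exact mul_le_mul_of_nonneg_left (by linarith) hκ0
      refine ⟨fun s => if s < t then r s else r₀, fun s hs => ?_, ?_⟩
      · by_cases h : s < t
        · simp only [h, if_true]
          refine (hr1 s h).trans (mul_le_mul_of_nonneg_left ?_ hκ0)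
          rw [hq]; linarith
        · simp only [h, if_false]
          exact hr0b
      · have hsum : ∑ s ∈ Finset.range t, N ^ s *ᵥ (if s < t then r s else r₀)
            = ∑ s ∈ Finset.range t, N ^ s *ᵥ r s :=
          Finset.sum_congr rfl fun s hs => by rw [if_pos (Finset.mem_range.1 hs)]
        rw [kalmanTrans, Matrix.transpose_mul, ← Matrix.mulVec_mulVec, ← hG, hr2, hg,
          Finset.sum_range_succ]
        simp only [hsum, lt_irrefl, if_false, Matrix.mulVec_sub, Matrix.mulVec_mulVec, pow_succ]
        abel
  set D := Real.sqrt (κ * (f ⬝ᵥ (Y *ᵥ f))) with hD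
  have hD0 : 0 ≤ D := Real.sqrt_nonneg _
  refine ⟨c * ‖f‖ + c * D * (1 - ρ)⁻¹, fun t => ?_⟩
  obtain ⟨r, hr1, hr2⟩ := hrep t f
  have hle : f ⬝ᵥ (kalmanCov S t *ᵥ f) ≤ f ⬝ᵥ (Y *ᵥ f) := by
    have := PosSemidef.quad_nonneg (kalmanCov_le hVw hVv hY t) f
    rw [Matrix.sub_mulVec, dotProduct_sub] at this
    linarith
  have hrD : ∀ s < t, ‖r s‖ ≤ D := fun s hs =>
    Real.le_sqrt_of_sq_le ((hr1 s hs).trans (mul_le_mul_of_nonneg_left hle hκ0))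
  rw [hr2]
  refine (norm_sub_le _ _).trans (add_le_add ?_ ?_)
  · refine (hpow t f).trans ?_
    have : c * ρ ^ t ≤ c * 1 := mul_le_mul_of_nonneg_left (pow_le_one₀ hρ0 hρ1.le) hc
    rw [mul_one] at this
    exact mul_le_mul_of_nonneg_right this (norm_nonneg _)
  · calc ‖∑ s ∈ Finset.range t, N ^ s *ᵥ r s‖ ≤ ∑ s ∈ Finset.range t, c * D * ρ ^ s := by
          refine (norm_sum_le _ _).trans (Finset.sum_le_sum fun s hs => ?_)
          refine (hpow s _).trans ?_
          have := mul_le_mul_of_nonneg_left (hrD s (Finset.mem_range.1 hs))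
            (by positivity : 0 ≤ c * ρ ^ s)
          linarith
      _ = c * D * ∑ s ∈ Finset.range t, ρ ^ s := by rw [Finset.mul_sum]
      _ ≤ c * D * (1 - ρ)⁻¹ := by
          refine mul_le_mul_of_nonneg_left ?_ (by positivity)
          rw [← tsum_geometric_of_lt_one hρ0 hρ1]
          exact (summable_geometric_of_lt_one hρ0 hρ1).sum_le_tsum _ fun s _ => by positivity

/-- The Kalman filter started from a known state converges to the stabilizing solution. -/
theorem kalmanCov_tendsto (hVw : S.Vw.PosSemidef) (hVv : S.Vv.PosDef)
    (hY : IsStabilizingRiccati S.Aᵀ S.Cᵀ S.Vw S.Vv Y) (hs : IsStabilizable S.A S.Vw) :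
    Tendsto (kalmanCov S) atTop (𝓝 Y) := by
  obtain ⟨c, ρ, hc, hρ0, hρ1, hpow⟩ := (schur_filter hVv hY).exists_norm_pow_mulVec_le
  obtain ⟨k, hk, h⟩ := exists_mulVec_bound Y
  have hvec : ∀ f, Tendsto (fun t => (Y - kalmanCov S t) *ᵥ f) atTop (𝓝 0) := by
    intro f
    obtain ⟨b, hb⟩ := kalmanTrans_bound hVw hVv hY hs f
    refine squeeze_zero_norm (a := fun t => c * ρ ^ t * (k * b)) (fun t => ?_) ?_
    · rw [kalmanCov_diff hVw hVv hY, ← Matrix.mulVec_mulVec, ← Matrix.mulVec_mulVec]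
      refine (hpow t _).trans (mul_le_mul_of_nonneg_left ((h _).trans ?_) (by positivity))
      exact mul_le_mul_of_nonneg_left (hb t) hk
    · simpa using ((tendsto_pow_atTop_nhds_zero_of_lt_one hρ0 hρ1).const_mul c).mul_const (k * b)
  refine tendsto_pi_nhds.2 fun i => tendsto_pi_nhds.2 fun j => ?_
  have h1 := tendsto_pi_nhds.1 (hvec (Pi.single j 1)) i
  simp only [Matrix.mulVec_single_one, Matrix.col_apply, Matrix.sub_apply, Pi.zero_apply] at h1
  have h2 := h1.const_sub (Y i j)
  simpa using h2

end Riccati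

/-! ### Two inequalities for real sequences. -/

section RealSequences

/-- Here a is the cost, b a storage and γ the unavoidable loss. A cheap run has small total storage,
so the storage is bounded by a constant at some time τ close to the horizon. Telescoping up to τ
then shows that the run was not cheap. -/
theorem eventually_le_sum_of_dissipation {a b γ : ℕ → ℝ} {j κ c : ℝ} (ha : ∀ t, 0 ≤ a t)
    (hb : ∀ t, 0 ≤ b t) (hκ : 0 ≤ κ) (hc : 0 ≤ c) (hab : ∀ t, b t - b (t + 1) + γ t ≤ a t)
    (hγ : Tendsto γ atTop (𝓝 j))
    (hsum : ∀ T, ∑ t ∈ Finset.range (T + 1), b t ≤ κ * (∑ t ∈ Finset.range T, a t + c * T))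
    {j' : ℝ} (hj : j' < j) : ∀ᶠ T : ℕ in atTop, j' * T ≤ ∑ t ∈ Finset.range T, a t := by
  rcases le_or_gt j' 0 with h0 | h0
  · refine Eventually.of_forall fun T => ?_
    have h1 : 0 ≤ ∑ t ∈ Finset.range T, a t := Finset.sum_nonneg fun t _ => ha t
    have h2 : (0 : ℝ) ≤ T := by positivity
    nlinarith
  obtain ⟨m, hm1, hm2⟩ := exists_between hj
  obtain ⟨ε, hε0, hε1, hε⟩ : ∃ ε : ℝ, 0 < ε ∧ ε < 1 ∧ j' < m * (1 - ε) := by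
    refine ⟨(m - j') / (2 * m), by apply div_pos <;> linarith, ?_, ?_⟩
    · rw [div_lt_one (by linarith)]; linarith
    · have : m * (1 - (m - j') / (2 * m)) = (m + j') / 2 := by
        have hm0 : m ≠ 0 := by linarith
        field_simp; ring
      rw [this]; linarith
  obtain ⟨D₂, hD₂⟩ : ∃ D, ∀ τ : ℕ, m * τ - D ≤ ∑ t ∈ Finset.range τ, γ t := by
    obtain ⟨N, hN⟩ := eventually_atTop.1 (hγ.eventually_const_le hm2)
    refine ⟨∑ t ∈ Finset.range N, |m - γ t|, fun τ => ?_⟩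
    have h1 : ∑ t ∈ Finset.range τ, (m - γ t) ≤ ∑ t ∈ Finset.range N, |m - γ t| := by
      calc ∑ t ∈ Finset.range τ, (m - γ t)
          ≤ ∑ t ∈ Finset.range τ, if t < N then |m - γ t| else 0 := by
            refine Finset.sum_le_sum fun t _ => ?_
            split_ifs with h
            · exact le_abs_self _
            · have := hN t (by omega); linarith
        _ ≤ ∑ t ∈ Finset.range (max τ N), if t < N then |m - γ t| else 0 := by
            refine Finset.sum_le_sum_of_subset_of_nonneg
              (fun t ht => Finset.mem_range.2 ((Finset.mem_range.1 ht).trans_le (le_max_left _ _)))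
              fun t _ _ => ?_
            split_ifs <;> positivity
        _ = ∑ t ∈ Finset.range N, if t < N then |m - γ t| else 0 := by
            refine (Finset.sum_subset (fun t ht =>
              Finset.mem_range.2 ((Finset.mem_range.1 ht).trans_le (le_max_right _ _)))
              fun t _ ht => ?_).symm
            rw [if_neg (by simpa using ht)]
        _ = _ := Finset.sum_congr rfl fun t ht => if_pos (Finset.mem_range.1 ht)
    rw [Finset.sum_sub_distrib] at h1
    simp only [Finset.sum_const, Finset.card_range, nsmul_eq_mul] at h1
    linarith
  -- The total storage is at most κ (j' + c) T and the final window has at least ε T instants, so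
  -- somewhere in it the storage is at most this average.
  set D := κ * (j' + c) / ε with hD
  have hlim : Tendsto (fun T : ℕ => (m * (1 - ε) - j') * (T : ℝ)) atTop atTop :=
    tendsto_natCast_atTop_atTop.const_mul_atTop (by linarith)
  filter_upwards [hlim.eventually_ge_atTop (D₂ + D), eventually_gt_atTop 0] with T hT hTpos
  by_contra hcon
  push Not at hcon
  have hT0 : (0 : ℝ) < T := by exact_mod_cast hTpos
  set q := ⌈(1 - ε) * (T : ℝ)⌉₊ with hq
  have hq1 : (1 - ε) * (T : ℝ) ≤ q := Nat.le_ceil _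
  have hq2 : (q : ℝ) < (1 - ε) * T + 1 :=
    Nat.ceil_lt_add_one (mul_nonneg (by linarith) hT0.le)
  have hqT : q ≤ T := Nat.ceil_le.2 (by nlinarith)
  obtain ⟨τ, hτ1, hτ2, hτ3⟩ : ∃ τ, q ≤ τ ∧ τ ≤ T ∧ b τ ≤ D := by
    by_contra hno
    push Not at hno
    have h1 : ∑ _t ∈ Finset.Icc q T, D < ∑ t ∈ Finset.Icc q T, b t :=
      Finset.sum_lt_sum_of_nonempty (Finset.nonempty_Icc.2 hqT) fun t ht =>
        hno t (Finset.mem_Icc.1 ht).1 (Finset.mem_Icc.1 ht).2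
    have h2 : ∑ t ∈ Finset.Icc q T, b t ≤ ∑ t ∈ Finset.range (T + 1), b t :=
      Finset.sum_le_sum_of_subset_of_nonneg (fun t ht => by
        have := (Finset.mem_Icc.1 ht).2
        exact Finset.mem_range.2 (by omega)) fun t _ _ => hb t
    have h3 : κ * (∑ t ∈ Finset.range T, a t + c * T) ≤ κ * ((j' + c) * T) := by
      refine mul_le_mul_of_nonneg_left ?_ hκ
      linarith
    have h4 : ε * T ≤ ((T + 1 - q : ℕ) : ℝ) := by
      rw [Nat.cast_sub (by omega)]
      push_cast
      linarith
    have h5 : D * (ε * T) = κ * ((j' + c) * T) := by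
      rw [hD]; field_simp
    have h6 : 0 ≤ D := by rw [hD]; positivity
    simp only [Finset.sum_const, Nat.card_Icc, nsmul_eq_mul] at h1
    have h7 := mul_le_mul_of_nonneg_left h4 h6
    have h8 := hsum T
    linarith
  have hA : ∑ t ∈ Finset.range τ, γ t + b 0 - b τ ≤ ∑ t ∈ Finset.range τ, a t := by
    have h1 : ∑ t ∈ Finset.range τ, (b t - b (t + 1) + γ t) ≤ ∑ t ∈ Finset.range τ, a t :=
      Finset.sum_le_sum fun t _ => hab t
    rw [Finset.sum_add_distrib, Finset.sum_range_sub'] at h1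
    linarith
  have hmono : ∑ t ∈ Finset.range τ, a t ≤ ∑ t ∈ Finset.range T, a t :=
    Finset.sum_le_sum_of_subset_of_nonneg (Finset.range_subset_range.2 hτ2) fun t _ _ => ha t
  have hτ4 : m * ((1 - ε) * T) ≤ m * τ := by
    refine mul_le_mul_of_nonneg_left (hq1.trans ?_) (by linarith)
    exact_mod_cast hτ1
  have := hD₂ τ
  have := hb 0
  nlinarith

variable {n : Type} [Fintype n] [DecidableEq n]

/-- A stable recursion has finite `ℓ²` gain. -/
theorem IsSchur.exists_sum_sq_le {M : Matrix n n ℝ} (hM : IsSchur M) :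
    ∃ κ : ℝ, 0 ≤ κ ∧ ∀ x r : ℕ → n → ℝ, x 0 = 0 → (∀ t, x (t + 1) = M *ᵥ x t + r t) →
      ∀ T, ∑ t ∈ Finset.range (T + 1), ‖x t‖ ^ 2 ≤ κ * ∑ t ∈ Finset.range T, ‖r t‖ ^ 2 := by
  obtain ⟨c, ρ, hc, hρ0, hρ1, hpow⟩ := hM.exists_norm_pow_mulVec_le
  have hρ' : 0 < 1 - ρ := by linarith
  refine ⟨c ^ 2 / (1 - ρ) ^ 2, by positivity, fun x r hx0 hx T => ?_⟩
  let N : ℕ → ℝ := fun t => ∑ k ∈ Finset.range t, c * ρ ^ k * ‖r (t - 1 - k)‖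
  have hN0 : N 0 = 0 := by simp [N]
  have hNpos : ∀ t, 0 ≤ N t := fun t => Finset.sum_nonneg fun k _ => by positivity
  have hNs : ∀ t, N (t + 1) = ρ * N t + c * ‖r t‖ := by
    intro t
    simp only [N]
    rw [Finset.sum_range_succ', Finset.mul_sum]
    simp only [pow_zero, mul_one, Nat.add_sub_cancel, Nat.sub_zero]
    congr 1
    refine Finset.sum_congr rfl fun k _ => ?_
    rw [show t - (k + 1) = t - 1 - k by omega, pow_succ]
    ring
  have hxN : ∀ t, ‖x t‖ ≤ N t := by
    intro t
    rw [recursion_eq_sum hx t, hx0, Matrix.mulVec_zero, zero_add]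
    exact (norm_sum_le _ _).trans (Finset.sum_le_sum fun k _ => hpow k _)
  -- Convexity of the square: ρN + c‖r‖ is the convex combination of N and c‖r‖/(1 - ρ) with weights
  -- ρ and 1 - ρ.
  have hNsq : ∀ t, (1 - ρ) * N (t + 1) ^ 2 ≤ (1 - ρ) * ρ * N t ^ 2 + c ^ 2 * ‖r t‖ ^ 2 := by
    intro t
    rw [hNs]
    nlinarith [mul_nonneg hρ0 (sq_nonneg ((1 - ρ) * N t - c * ‖r t‖))]
  have hsum : ∀ T, (1 - ρ) ^ 2 * ∑ t ∈ Finset.range (T + 1), N t ^ 2 + (1 - ρ) * ρ * N T ^ 2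
      ≤ c ^ 2 * ∑ t ∈ Finset.range T, ‖r t‖ ^ 2 := by
    intro T
    induction T with
    | zero => simp [hN0]
    | succ T ih =>
      rw [Finset.sum_range_succ (fun t => N t ^ 2) (T + 1),
        Finset.sum_range_succ (fun t => ‖r t‖ ^ 2) T]
      have := hNsq T
      nlinarith
  have h1 : ∑ t ∈ Finset.range (T + 1), ‖x t‖ ^ 2 ≤ ∑ t ∈ Finset.range (T + 1), N t ^ 2 :=
    Finset.sum_le_sum fun t _ => by
      have := hxN t
      gcongr
  have h2 := hsum T
  have h3 : 0 ≤ (1 - ρ) * ρ * N T ^ 2 := by positivity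
  rw [div_mul_eq_mul_div, le_div_iff₀ (by positivity)]
  nlinarith

end RealSequences

/-! ### Orthogonality to families of random variables. -/

section Uncorrelated

variable {Ω : Type*} [MeasurableSpace Ω] {P : Measure Ω}
  {ι κ κ' : Type} [Fintype ι] [DecidableEq ι] [Fintype κ] [DecidableEq κ] [Fintype κ']
  [DecidableEq κ']

theorem mulVec_comp_mem {U : Submodule ℝ (Ω → ℝ)} {a : Ω → ι → ℝ}
    (ha : ∀ i, (fun ω => a ω i) ∈ U) (M : Matrix κ ι ℝ) (i : κ) : (fun ω => (M *ᵥ a ω) i) ∈ U := by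
  have h : (fun ω => (M *ᵥ a ω) i) = ∑ j, M i j • fun ω => a ω j := by
    funext ω; simp [Matrix.mulVec, dotProduct]
  rw [h]
  exact U.sum_mem fun j _ => U.smul_mem _ (ha j)

/-- The square-integrable functions which are orthogonal to the square-integrable members of
`ℱ`. -/
def uncorr (P : Measure Ω) (ℱ : Set (Ω → ℝ)) : Submodule ℝ (Ω → ℝ) where
  carrier := {f | MemLp f 2 P ∧ ∀ g ∈ ℱ, MemLp g 2 P → ∫ ω, f ω * g ω ∂P = 0}
  zero_mem' := ⟨MemLp.zero, fun g _ _ => by simp⟩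
  add_mem' := by
    rintro f f' ⟨hf, h⟩ ⟨hf', h'⟩
    refine ⟨hf.add hf', fun g hg hg2 => ?_⟩
    simp only [Pi.add_apply, add_mul]
    refine (integral_add (hf.integrable_mul hg2) (hf'.integrable_mul hg2)).trans ?_
    simp only [Pi.mul_apply, h g hg hg2, h' g hg hg2, add_zero]
  smul_mem' := by
    rintro k f ⟨hf, h⟩
    refine ⟨hf.const_smul k, fun g hg hg2 => ?_⟩
    simp only [Pi.smul_apply, smul_eq_mul, mul_assoc]
    rw [integral_const_mul, h g hg hg2, mul_zero]

/-- All components of `a` are orthogonal to `ℱ`. -/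
def Uncorr (P : Measure Ω) (ℱ : Set (Ω → ℝ)) (a : Ω → ι → ℝ) : Prop :=
  ∀ i, (fun ω => a ω i) ∈ uncorr P ℱ

/-- The components of a random vector. -/
def comps (a : Ω → ι → ℝ) : Set (Ω → ℝ) := Set.range fun i ω => a ω i

/-- The components of the members of a sequence of random vectors from time `t` on. -/
def future (δ : ℕ → Ω → ι → ℝ) (t : ℕ) : Set (Ω → ℝ) := ⋃ r ≥ t, comps (δ r)

variable {ℱ ℱ' : Set (Ω → ℝ)} {a b : Ω → ι → ℝ}

theorem Uncorr.sqInt (ha : Uncorr P ℱ a) : SqInt P a := fun i => (ha i).1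

theorem Uncorr.add (ha : Uncorr P ℱ a) (hb : Uncorr P ℱ b) : Uncorr P ℱ (fun ω => a ω + b ω) :=
  fun i => (uncorr P ℱ).add_mem (ha i) (hb i)

theorem Uncorr.sub (ha : Uncorr P ℱ a) (hb : Uncorr P ℱ b) : Uncorr P ℱ (fun ω => a ω - b ω) :=
  fun i => (uncorr P ℱ).sub_mem (ha i) (hb i)

theorem Uncorr.mulVec (ha : Uncorr P ℱ a) (M : Matrix κ ι ℝ) :
    Uncorr P ℱ (fun ω => M *ᵥ a ω) := mulVec_comp_mem ha M

theorem uncorr_mono (h : ℱ ⊆ ℱ') : uncorr P ℱ' ≤ uncorr P ℱ :=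
  fun _ hf => ⟨hf.1, fun g hg => hf.2 g (h hg)⟩

theorem Uncorr.mono (ha : Uncorr P ℱ' a) (h : ℱ ⊆ ℱ') : Uncorr P ℱ a :=
  fun i => uncorr_mono h (ha i)

theorem future_mono (δ : ℕ → Ω → ι → ℝ) {s t : ℕ} (h : s ≤ t) : future δ t ⊆ future δ s :=
  Set.biUnion_subset_biUnion_left fun _ hr => le_trans h hr

theorem Uncorr.mom_eq_zero {b : Ω → κ → ℝ} (ha : Uncorr P ℱ a) (hb : SqInt P b)
    (h : comps b ⊆ ℱ) : mom P a b = 0 := by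
  ext i j
  exact (ha i).2 _ (h ⟨j, rfl⟩) (hb j)

theorem uncorr_comps {b : Ω → κ → ℝ} (ha : SqInt P a) (h : mom P a b = 0) :
    Uncorr P (comps b) a := by
  refine fun i => ⟨ha i, ?_⟩
  rintro _ ⟨j, rfl⟩ _
  exact congrFun (congrFun h i) j

theorem Uncorr.union (ha : Uncorr P ℱ a) (ha' : Uncorr P ℱ' a) : Uncorr P (ℱ ∪ ℱ') a :=
  fun i => ⟨(ha i).1, fun g hg => hg.elim ((ha i).2 g) ((ha' i).2 g)⟩

theorem uncorr_future {δ : ℕ → Ω → κ → ℝ} {t : ℕ} (ha : SqInt P a)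
    (h : ∀ r, t ≤ r → mom P a (δ r) = 0) : Uncorr P (future δ t) a := by
  refine fun i => ⟨ha i, fun g hg hg2 => ?_⟩
  obtain ⟨r, hr, hg⟩ := Set.mem_iUnion₂.1 hg
  exact (uncorr_comps ha (h r hr) i).2 g hg hg2

theorem Uncorr.mom_future {δ : ℕ → Ω → κ → ℝ} {t : ℕ} (ha : Uncorr P (future δ t) a)
    (hδ : ∀ t, SqInt P (δ t)) {r : ℕ} (hr : t ≤ r) : mom P a (δ r) = 0 :=
  ha.mom_eq_zero (hδ r) (Set.subset_biUnion_of_mem (u := fun r => comps (δ r)) hr)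

end Uncorrelated

/-! ### Completion of squares with the control Riccati equation. -/

section CompletionOfSquares

variable {nx nu ny : ℕ} {S : LQGData nx nu ny} {X : Matrix (Fin nx) (Fin nx) ℝ}

theorem completion_of_squares (hR : S.Ru.PosDef)
    (hX : IsStabilizingRiccati S.A S.B (S.Cᵀ * S.Qy * S.C) S.Ru X) (x : Fin nx → ℝ)
    (u : Fin nu → ℝ) :
    (S.A *ᵥ x + S.B *ᵥ u) ⬝ᵥ (X *ᵥ (S.A *ᵥ x + S.B *ᵥ u))
        + (S.C *ᵥ x) ⬝ᵥ (S.Qy *ᵥ (S.C *ᵥ x)) + u ⬝ᵥ (S.Ru *ᵥ u)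
      = x ⬝ᵥ (X *ᵥ x) + (u - riccatiGain S.A S.B S.Ru X *ᵥ x) ⬝ᵥ
        ((S.Ru + S.Bᵀ * X * S.B) *ᵥ (u - riccatiGain S.A S.B S.Ru X *ᵥ x)) := by
  obtain ⟨h1, h2⟩ := riccatiGain_spec hR hX
  set F := riccatiGain S.A S.B S.Ru X
  set Z := S.Ru + S.Bᵀ * X * S.B with hZ
  have hXt : Xᵀ = X := hX.posSemidef.isHermitian
  have hRt : S.Ruᵀ = S.Ru := hR.isHermitian
  have hZt : Zᵀ = Z := by
    rw [hZ, Matrix.transpose_add, hRt]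
    simp only [Matrix.transpose_mul, Matrix.transpose_transpose, hXt, Matrix.mul_assoc]
  have h3 : Fᵀ * Z = -(S.Aᵀ * X * S.B) := by
    have := congrArg Matrix.transpose h1
    rw [Matrix.transpose_mul, hZt] at this
    rw [this]
    simp only [Matrix.transpose_mul, Matrix.transpose_transpose, hXt, Matrix.transpose_neg,
      Matrix.mul_assoc]
  have e1 : u ⬝ᵥ (Z *ᵥ u) = u ⬝ᵥ (S.Ru *ᵥ u) + u ⬝ᵥ ((S.Bᵀ * X * S.B) *ᵥ u) := by
    rw [hZ, Matrix.add_mulVec, dotProduct_add]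
  have e2 : u ⬝ᵥ (Z *ᵥ (F *ᵥ x)) = -(u ⬝ᵥ ((S.Bᵀ * X * S.A) *ᵥ x)) := by
    rw [Matrix.mulVec_mulVec, h1, Matrix.neg_mulVec, dotProduct_neg]
  have e3 : (F *ᵥ x) ⬝ᵥ (Z *ᵥ u) = -(x ⬝ᵥ ((S.Aᵀ * X * S.B) *ᵥ u)) := by
    rw [bil_transfer, h3, Matrix.neg_mulVec, dotProduct_neg]
  have e4 : x ⬝ᵥ (X *ᵥ x) = x ⬝ᵥ ((S.Aᵀ * X * S.A) *ᵥ x)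
      - (F *ᵥ x) ⬝ᵥ (Z *ᵥ (F *ᵥ x)) + (S.C *ᵥ x) ⬝ᵥ (S.Qy *ᵥ (S.C *ᵥ x)) := by
    rw [Matrix.mulVec_mulVec x Z F, Matrix.mulVec_mulVec x S.Qy S.C, bil_transfer, bil_transfer,
      ← Matrix.mul_assoc, ← Matrix.mul_assoc, ← dotProduct_sub, ← Matrix.sub_mulVec,
      ← dotProduct_add, ← Matrix.add_mulVec, ← h2]
  rw [Matrix.mulVec_sub, dotProduct_sub, sub_dotProduct, sub_dotProduct, e1, e2, e3, e4,
    Matrix.mulVec_add, dotProduct_add, add_dotProduct, add_dotProduct, Matrix.mulVec_mulVec x X,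
    Matrix.mulVec_mulVec u X, bil_transfer, bil_transfer, bil_transfer, bil_transfer]
  simp only [Matrix.mul_assoc]
  ring

end CompletionOfSquares

/-! ### Estimation errors and lower bounds for the cost. -/

section Estimation

variable {Ω : Type*} [MeasurableSpace Ω] {P : Measure Ω} [IsProbabilityMeasure P]
  {nx nu ny : ℕ} {S : LQGData nx nu ny} {δ : ℕ → Ω → Fin nx ⊕ Fin ny → ℝ}
  {ι κ : Type} [Fintype ι] [DecidableEq ι] [Fintype κ] [DecidableEq κ]
  {X Y : Matrix (Fin nx) (Fin nx) ℝ}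

theorem IsWhiteNoise.uncorr_succ (hδ : IsWhiteNoise S P δ) (t : ℕ) :
    Uncorr P (future δ (t + 1)) (δ t) :=
  uncorr_future (hδ.sqInt t) fun r hr => hδ.uncorrelated t r (by omega)

theorem IsWhiteNoise.uncorr_const (hδ : IsWhiteNoise S P δ) (t : ℕ) (a : ι → ℝ) :
    Uncorr P (future δ t) (fun _ : Ω => a) :=
  uncorr_future (SqInt.const a) fun r _ => by
    ext i j
    simp only [mom, Matrix.of_apply, Matrix.zero_apply]
    rw [integral_const_mul, hδ.mean, mul_zero]

theorem mom_add_noise (hδ : IsWhiteNoise S P δ) {a : Ω → ι → ℝ} {b : Ω → κ → ℝ} {t : ℕ}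
    (ha : Uncorr P (future δ t) a) (hb : Uncorr P (future δ t) b)
    (D : Matrix ι (Fin nx ⊕ Fin ny) ℝ) (E : Matrix κ (Fin nx ⊕ Fin ny) ℝ) :
    mom P (fun ω => a ω + D *ᵥ δ t ω) (fun ω => b ω + E *ᵥ δ t ω)
      = mom P a b + D * Matrix.fromBlocks S.Vw 0 0 S.Vv * Eᵀ := by
  have h1 := ha.sqInt
  have h2 := hb.sqInt
  have h3 := hδ.sqInt t
  rw [mom_add_left h1 (h3.mulVec D) (h2.add (h3.mulVec E)), mom_add_right h1 h2 (h3.mulVec E),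
    mom_add_right (h3.mulVec D) h2 (h3.mulVec E), mom_mulVec_right E h1 h3,
    mom_mulVec_left D h3 h2, mom_mulVec_left D h3 (h3.mulVec E), mom_mulVec_right E h3 h3, hδ.cov,
    ha.mom_future hδ.sqInt le_rfl, ← mom_transpose b (δ t), hb.mom_future hδ.sqInt le_rfl]
  simp [Matrix.mul_assoc]

theorem noiseGain_mul (D : Matrix κ (Fin nx) ℝ) (D' : Matrix κ (Fin ny) ℝ)
    (E : Matrix ι (Fin nx) ℝ) (E' : Matrix ι (Fin ny) ℝ) :
    Matrix.fromCols D D' * Matrix.fromBlocks S.Vw 0 0 S.Vv * (Matrix.fromCols E E')ᵀ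
      = D * S.Vw * Eᵀ + D' * S.Vv * E'ᵀ := by
  rw [Matrix.fromCols_mul_fromBlocks, Matrix.transpose_fromCols, Matrix.fromCols_mul_fromRows]
  simp

/-- The part of the expected running cost which no controller can influence. -/
noncomputable def fixedCost (S : LQGData nx nu ny) (X : Matrix (Fin nx) (Fin nx) ℝ) : ℝ :=
  (S.Vv * S.Qyᵀ).trace + (S.Vw * Xᵀ).trace

/-- The optimal cost of the LQG problem. -/
noncomputable def optimalCost (S : LQGData nx nu ny) (X Y : Matrix (Fin nx) (Fin nx) ℝ) : ℝ :=
  fixedCost S X + (riccatiGain S.A S.B S.Ru X * Y * (riccatiGain S.A S.B S.Ru X)ᵀ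
    * (S.Ru + S.Bᵀ * X * S.B)ᵀ).trace

/-- Since x and u are orthogonal to the current noise, the noise enters only through its covariance.
Apart from a telescoping term, the controller influences the cost only through u - Fx. -/
theorem integral_stage_eq (hδ : IsWhiteNoise S P δ) (hR : S.Ru.PosDef)
    (hX : IsStabilizingRiccati S.A S.B (S.Cᵀ * S.Qy * S.C) S.Ru X) {x x' : Ω → Fin nx → ℝ}
    {u : Ω → Fin nu → ℝ} {t : ℕ} (hx : Uncorr P (future δ t) x) (hu : Uncorr P (future δ t) u)
    (hx' : ∀ ω, x' ω = S.A *ᵥ x ω + S.B *ᵥ u ω + δ t ω ∘ Sum.inl) :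
    ∫ ω, S.stage (S.C *ᵥ x ω + δ t ω ∘ Sum.inr) (u ω) ∂P
      = fixedCost S X + (∫ ω, x ω ⬝ᵥ (X *ᵥ x ω) ∂P - ∫ ω, x' ω ⬝ᵥ (X *ᵥ x' ω) ∂P)
        + ∫ ω, (u ω - riccatiGain S.A S.B S.Ru X *ᵥ x ω) ⬝ᵥ
          ((S.Ru + S.Bᵀ * X * S.B) *ᵥ (u ω - riccatiGain S.A S.B S.Ru X *ᵥ x ω)) ∂P := by
  have hxs := hx.sqInt
  have hus := hu.sqInt
  have hz : Uncorr P (future δ t) fun ω => S.A *ᵥ x ω + S.B *ᵥ u ω :=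
    (hx.mulVec _).add (hu.mulVec _)
  have hw := (hδ.sqInt t).mulVec (Matrix.fromCols (1 : Matrix (Fin nx) (Fin nx) ℝ) 0)
  have hv := (hδ.sqInt t).mulVec (Matrix.fromCols 0 (1 : Matrix (Fin ny) (Fin ny) ℝ))
  have e1 : ∫ ω, x' ω ⬝ᵥ (X *ᵥ x' ω) ∂P
      = ∫ ω, (S.A *ᵥ x ω + S.B *ᵥ u ω) ⬝ᵥ (X *ᵥ (S.A *ᵥ x ω + S.B *ᵥ u ω)) ∂P
        + (S.Vw * Xᵀ).trace := by
    simp only [hx', comp_inl_eq]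
    rw [integral_quad X (hz.sqInt.add hw) (hz.sqInt.add hw), mom_add_noise hδ hz hz, noiseGain_mul,
      integral_quad X hz.sqInt hz.sqInt, Matrix.add_mul, Matrix.trace_add]
    simp
  have e2 : ∫ ω, S.stage (S.C *ᵥ x ω + δ t ω ∘ Sum.inr) (u ω) ∂P
      = ∫ ω, (S.C *ᵥ x ω) ⬝ᵥ (S.Qy *ᵥ (S.C *ᵥ x ω)) ∂P + ∫ ω, u ω ⬝ᵥ (S.Ru *ᵥ u ω) ∂P
        + (S.Vv * S.Qyᵀ).trace := by
    have hc := hx.mulVec S.C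
    simp only [comp_inr_eq]
    rw [integral_stage (hc.sqInt.add hv) hus, mom_add_noise hδ hc hc, noiseGain_mul,
      integral_quad S.Qy hc.sqInt hc.sqInt, integral_quad S.Ru hus hus, Matrix.add_mul,
      Matrix.trace_add]
    simp
    ring
  have i1 := integrable_quad X hz.sqInt hz.sqInt
  have i12 : Integrable (fun ω => (S.A *ᵥ x ω + S.B *ᵥ u ω) ⬝ᵥ (X *ᵥ (S.A *ᵥ x ω + S.B *ᵥ u ω))
    + (S.C *ᵥ x ω) ⬝ᵥ (S.Qy *ᵥ (S.C *ᵥ x ω))) P := i1.add (integrable_quad S.Qy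
      (hxs.mulVec S.C) (hxs.mulVec S.C))
  have i2 := integrable_quad S.Qy (hxs.mulVec S.C) (hxs.mulVec S.C)
  have i3 := integrable_quad S.Ru hus hus
  have i4 := integrable_quad X hxs hxs
  have hn := hus.sub (hxs.mulVec (riccatiGain S.A S.B S.Ru X))
  have i5 := integrable_quad (S.Ru + S.Bᵀ * X * S.B) hn hn
  have e3 := integral_congr_ae (μ := P) (Eventually.of_forall fun ω =>
    completion_of_squares hR hX (x ω) (u ω))
  rw [integral_add i12 i3, integral_add i1 i2, integral_add i4 i5] at e3
  rw [e1, e2, fixedCost]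
  linarith

/-- Expand the square and drop the nonnegative term in n. If n is uncorrelated with e, the error
alone gives the lower bound. -/
theorem integral_quad_sub_ge {Z : Matrix κ κ ℝ} (hZ : Z.PosSemidef) (F : Matrix κ ι ℝ)
    {n : Ω → κ → ℝ} {e : Ω → ι → ℝ} (hn : SqInt P n) (he : SqInt P e) :
    (F * mom P e e * Fᵀ * Zᵀ).trace - 2 * (mom P n e * (Z * F)ᵀ).trace
      ≤ ∫ ω, (n ω - F *ᵥ e ω) ⬝ᵥ (Z *ᵥ (n ω - F *ᵥ e ω)) ∂P := by
  have hZt : Zᵀ = Z := hZ.isHermitian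
  have hF := he.mulVec F
  have e1 : ∫ ω, (F *ᵥ e ω) ⬝ᵥ (Z *ᵥ (F *ᵥ e ω)) ∂P = (F * mom P e e * Fᵀ * Zᵀ).trace := by
    rw [integral_quad Z hF hF, mom_mulVec_left F he hF, mom_mulVec_right F he he,
      ← Matrix.mul_assoc]
  have e2 := integral_quad (Z * F) hn he
  have i1 := integrable_quad Z hF hF
  have i2 := (integrable_quad (Z * F) hn he).const_mul 2
  have hd := hn.sub hF
  rw [← e1, ← e2, ← integral_const_mul, ← integral_sub i1 i2]
  refine integral_mono (i1.sub i2) (integrable_quad Z hd hd) fun ω => ?_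
  have h1 := PosSemidef.quad_nonneg hZ (n ω)
  have h2 : (F *ᵥ e ω) ⬝ᵥ (Z *ᵥ n ω) = n ω ⬝ᵥ (Z *ᵥ (F *ᵥ e ω)) := by
    rw [Matrix.dotProduct_mulVec, ← Matrix.mulVec_transpose, hZt, dotProduct_comm]
  simp only [← Matrix.mulVec_mulVec, Matrix.mulVec_sub, dotProduct_sub, sub_dotProduct, h2]
  linarith

/-- The error of the state estimator with gains `K` and known initial state. -/
noncomputable def errProc (S : LQGData nx nu ny) (δ : ℕ → Ω → Fin nx ⊕ Fin ny → ℝ)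
    (K : ℕ → Matrix (Fin nx) (Fin ny) ℝ) : ℕ → Ω → Fin nx → ℝ
  | 0 => fun _ => 0
  | t + 1 => fun ω => (S.A - K t * S.C) *ᵥ errProc S δ K t ω
      + Matrix.fromCols 1 (-K t) *ᵥ δ t ω

variable {K : ℕ → Matrix (Fin nx) (Fin ny) ℝ}

theorem errProc_uncorr (hδ : IsWhiteNoise S P δ) (t : ℕ) :
    Uncorr P (future δ t) (errProc S δ K t) := by
  induction t with
  | zero => exact hδ.uncorr_const 0 0
  | succ t ih =>
    exact ((ih.mono (future_mono δ (Nat.le_succ t))).mulVec _).add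
      ((hδ.uncorr_succ t).mulVec _)

theorem errProc_mom_zero : mom P (errProc S δ K 0) (errProc S δ K 0) = 0 := by
  ext i j
  simp [mom, errProc]

theorem errProc_mom_succ (hδ : IsWhiteNoise S P δ) (t : ℕ) :
    mom P (errProc S δ K (t + 1)) (errProc S δ K (t + 1))
      = covStep S (K t) (mom P (errProc S δ K t) (errProc S δ K t)) := by
  have h := errProc_uncorr (K := K) hδ t
  rw [errProc, mom_add_noise hδ (h.mulVec _) (h.mulVec _), noiseGain_mul,
    mom_mulVec_left _ h.sqInt (h.sqInt.mulVec _), mom_mulVec_right _ h.sqInt h.sqInt, covStep]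
  simp [Matrix.mul_assoc]

theorem errProc_kalman_mom (hδ : IsWhiteNoise S P δ) (t : ℕ) :
    mom P (errProc S δ (fun t => filterGain S (kalmanCov S t)) t)
      (errProc S δ (fun t => filterGain S (kalmanCov S t)) t) = kalmanCov S t := by
  induction t with
  | zero => exact errProc_mom_zero
  | succ t ih => rw [errProc_mom_succ hδ, ih, kalmanCov]

theorem errProc_mom_tendsto (hδ : IsWhiteNoise S P δ) (hVv : S.Vv.PosDef)
    (hY : IsStabilizingRiccati S.Aᵀ S.Cᵀ S.Vw S.Vv Y) :
    Tendsto (fun t => mom P (errProc S δ (fun _ => filterGain S Y) t)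
      (errProc S δ (fun _ => filterGain S Y) t)) atTop (𝓝 Y) :=
  (schur_filter hVv hY).tendsto_sylvester_of_fixed (schur_filter hVv hY)
    (covStep_fixed hVv hY).symm tendsto_const_nhds fun t => errProc_mom_succ hδ t

/-- The error is driven by the noise alone, whatever the control; subtracting it from x leaves an
estimate driven by the input and the innovation. -/
theorem estimate_succ {x x' : Fin nx → ℝ} {u : Fin nu → ℝ} {t : ℕ} {ω : Ω}
    (hx : x' = S.A *ᵥ x + S.B *ᵥ u + δ t ω ∘ Sum.inl) :
    x' - errProc S δ K (t + 1) ω = S.A *ᵥ (x - errProc S δ K t ω) + S.B *ᵥ u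
      + K t *ᵥ (S.C *ᵥ errProc S δ K t ω + δ t ω ∘ Sum.inr) := by
  have h : (Matrix.fromCols 1 (-K t) : Matrix (Fin nx) (Fin nx ⊕ Fin ny) ℝ) *ᵥ δ t ω
      = δ t ω ∘ Sum.inl - K t *ᵥ (δ t ω ∘ Sum.inr) := by
    conv_lhs => rw [← Sum.elim_comp_inl_inr (δ t ω)]
    rw [Matrix.fromCols_mulVec_sumElim, Matrix.one_mulVec, Matrix.neg_mulVec, sub_eq_add_neg]
  rw [hx]
  change _ - ((S.A - K t * S.C) *ᵥ errProc S δ K t ω + Matrix.fromCols 1 (-K t) *ᵥ δ t ω) = _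
  rw [h]
  simp only [Matrix.mulVec_sub, Matrix.mulVec_add, Matrix.sub_mulVec, Matrix.mulVec_mulVec]
  abel

/-- This is the transposed normal equation of the Kalman gain for the actual covariance of the
error. -/
theorem innovation_uncorr (hδ : IsWhiteNoise S P δ) (hVv : S.Vv.PosDef) (t : ℕ)
    (hP : (mom P (errProc S δ K t) (errProc S δ K t)).PosSemidef)
    (hK : K t = filterGain S (mom P (errProc S δ K t) (errProc S δ K t))) :
    mom P (fun ω => S.C *ᵥ errProc S δ K t ω + δ t ω ∘ Sum.inr) (errProc S δ K (t + 1)) = 0 := by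
  have h := errProc_uncorr (K := K) hδ t
  have h1 := congrArg Matrix.transpose (filterGain_orth hVv hP)
  have hVt : S.Vvᵀ = S.Vv := hVv.isHermitian
  rw [← hK] at h1
  simp only [comp_inr_eq]
  rw [errProc, mom_add_noise hδ (h.mulVec _) (h.mulVec _), noiseGain_mul,
    mom_mulVec_left _ h.sqInt (h.sqInt.mulVec _), mom_mulVec_right _ h.sqInt h.sqInt]
  simp only [Matrix.transpose_mul, Matrix.transpose_transpose, hVt, mom_transpose] at h1
  rw [h1]
  simp

section Loop

variable {c : DynController ι nu ny} {x : ℕ → Ω → Fin nx → ℝ} {ξ : ℕ → Ω → ι → ℝ}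

theorem loop_succ (hx : ∀ t ω, x (t + 1) ω = S.A *ᵥ x t ω + S.B *ᵥ (c.F *ᵥ ξ t ω) + δ t ω ∘ Sum.inl)
    (hξ : ∀ t ω, ξ (t + 1) ω = c.G *ᵥ ξ t ω + c.H *ᵥ (S.C *ᵥ x t ω + δ t ω ∘ Sum.inr))
    (t : ℕ) (ω : Ω) : Sum.elim (x (t + 1) ω) (ξ (t + 1) ω)
      = Matrix.fromBlocks S.A (S.B * c.F) (c.H * S.C) c.G *ᵥ Sum.elim (x t ω) (ξ t ω)
        + Matrix.fromBlocks 1 0 0 c.H *ᵥ δ t ω := by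
  conv_rhs => rw [← Sum.elim_comp_inl_inr (δ t ω)]
  rw [Matrix.fromBlocks_mulVec, Matrix.fromBlocks_mulVec, sum_elim_add, hx, hξ]
  simp only [Sum.elim_comp_inl, Sum.elim_comp_inr, Matrix.mulVec_add, Matrix.mulVec_mulVec,
    Matrix.one_mulVec, Matrix.zero_mulVec, add_zero, zero_add]
  congr 1
  abel

/-- Convergence makes the telescoping term of `integral_stage_eq` vanish asymptotically. -/
theorem exists_loop_quad_limit (hδ : IsWhiteNoise S P δ) (hc : S.IsStabilizing c)
    (hx0 : SqInt P (x 0)) (hξ0 : SqInt P (ξ 0))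
    (hx : ∀ t ω, x (t + 1) ω = S.A *ᵥ x t ω + S.B *ᵥ (c.F *ᵥ ξ t ω) + δ t ω ∘ Sum.inl)
    (hξ : ∀ t ω, ξ (t + 1) ω = c.G *ᵥ ξ t ω + c.H *ᵥ (S.C *ᵥ x t ω + δ t ω ∘ Sum.inr))
    (X : Matrix (Fin nx) (Fin nx) ℝ) :
    ∃ β, Tendsto (fun t => ∫ ω, x t ω ⬝ᵥ (X *ᵥ x t ω) ∂P) atTop (𝓝 β) := by
  obtain ⟨Z, hZ⟩ := exists_mom_limit hδ hc (Matrix.fromBlocks 1 0 0 c.H)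
  obtain ⟨hsq, -, hlim⟩ := hZ 0 (fun t ω => Sum.elim (x t ω) (ξ t ω)) (hx0.elim hξ0) fun t ω => by
    rw [zero_add]; exact loop_succ hx hξ t ω
  set E : Matrix (Fin nx) (Fin nx ⊕ ι) ℝ := Matrix.fromCols 1 0 with hE
  have hc' : Continuous fun Z : Matrix (Fin nx ⊕ ι) (Fin nx ⊕ ι) ℝ => E * Z * Eᵀ * Xᵀ := by
    fun_prop
  refine ⟨_, ((hc'.matrix_trace.tendsto Z).comp hlim).congr fun t => ?_⟩
  have hxE : x t = fun ω => E *ᵥ Sum.elim (x t ω) (ξ t ω) := by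
    funext ω
    rw [hE, Matrix.fromCols_mulVec_sumElim, Matrix.one_mulVec, Matrix.zero_mulVec, add_zero]
  have h := hsq t
  rw [integral_quad X (hxE ▸ h.mulVec E) (hxE ▸ h.mulVec E)]
  simp only [Function.comp]
  rw [← mom_mulVec_left E h h, ← mom_mulVec_right E (h.mulVec E) h, ← hxE]

theorem loop_uncorr (hδ : IsWhiteNoise S P δ) (hx0 : ∀ ω, x 0 ω = 0) (hξ0 : ∀ ω, ξ 0 ω = 0)
    (hx : ∀ t ω, x (t + 1) ω = S.A *ᵥ x t ω + S.B *ᵥ (c.F *ᵥ ξ t ω) + δ t ω ∘ Sum.inl)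
    (hξ : ∀ t ω, ξ (t + 1) ω = c.G *ᵥ ξ t ω + c.H *ᵥ (S.C *ᵥ x t ω + δ t ω ∘ Sum.inr)) (t : ℕ) :
    Uncorr P (future δ t) (fun ω => Sum.elim (x t ω) (ξ t ω)) := by
  induction t with
  | zero =>
    have : (fun ω => Sum.elim (x 0 ω) (ξ 0 ω)) = fun _ => 0 := by
      funext ω i
      cases i <;> simp [hx0, hξ0]
    rw [this]
    exact hδ.uncorr_const 0 0
  | succ t ih =>
    rw [show (fun ω => Sum.elim (x (t + 1) ω) (ξ (t + 1) ω)) = _ from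
      funext fun ω => loop_succ hx hξ t ω]
    exact ((ih.mono (future_mono δ (Nat.le_succ t))).mulVec _).add ((hδ.uncorr_succ t).mulVec _)

variable (hδ : IsWhiteNoise S P δ) (hVv : S.Vv.PosDef) (hR : S.Ru.PosDef)
  (hX : IsStabilizingRiccati S.A S.B (S.Cᵀ * S.Qy * S.C) S.Ru X)
  (hY : IsStabilizingRiccati S.Aᵀ S.Cᵀ S.Vw S.Vv Y)
  (hx0 : ∀ ω, x 0 ω = 0) (hξ0 : ∀ ω, ξ 0 ω = 0)
include hδ hVv hR hX hY hx0 hξ0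

/-- No stabilizing controller beats the optimal cost. -/
theorem optimalCost_le_of_isStabilizing (hc : S.IsStabilizing c)
    (hx : ∀ t ω, x (t + 1) ω = S.A *ᵥ x t ω + S.B *ᵥ (c.F *ᵥ ξ t ω) + δ t ω ∘ Sum.inl)
    (hξ : ∀ t ω, ξ (t + 1) ω = c.G *ᵥ ξ t ω + c.H *ᵥ (S.C *ᵥ x t ω + δ t ω ∘ Sum.inr)) {ℓ : ℝ}
    (hl : Tendsto (fun t => ∫ ω, S.stage (S.C *ᵥ x t ω + δ t ω ∘ Sum.inr) (c.F *ᵥ ξ t ω) ∂P)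
      atTop (𝓝 ℓ)) : optimalCost S X Y ≤ ℓ := by
  set F := riccatiGain S.A S.B S.Ru X with hF
  set Z := S.Ru + S.Bᵀ * X * S.B with hZdef
  have hZ : Z.PosSemidef := by
    have := (innov_posDef hX.posSemidef hR S.Bᵀ).posSemidef
    rwa [Matrix.transpose_transpose, add_comm] at this
  set H := filterGain S Y with hH
  set e := errProc S δ (fun _ => H) with he
  set p : ℕ → Ω → Fin nx ⊕ ι → ℝ := fun t ω => Sum.elim (x t ω - e t ω) (ξ t ω) with hp
  set M := Matrix.fromBlocks S.A (S.B * c.F) (c.H * S.C) c.G with hM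
  set V : Matrix (Fin ny) (Fin nx ⊕ Fin ny) ℝ := Matrix.fromCols 0 1 with hV
  set D := Matrix.fromRows H c.H with hD
  have hps : ∀ t, p (t + 1) = fun ω => (M *ᵥ p t ω + (D * S.C) *ᵥ e t ω) + (D * V) *ᵥ δ t ω := by
    intro t
    funext ω
    have h1 := estimate_succ (K := fun _ => H) (hx t ω)
    simp only [hp, he]
    have h2 : (D * S.C) *ᵥ errProc S δ (fun _ => H) t ω + (D * V) *ᵥ δ t ω
        = D *ᵥ (S.C *ᵥ errProc S δ (fun _ => H) t ω + δ t ω ∘ Sum.inr) := by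
      rw [Matrix.mulVec_add, comp_inr_eq, Matrix.mulVec_mulVec, Matrix.mulVec_mulVec]
    rw [h1, hξ, hM, Matrix.fromBlocks_mulVec, add_assoc _ ((D * S.C) *ᵥ _), h2, hD, Matrix.fromRows_mulVec,
      sum_elim_add]
    simp only [Sum.elim_comp_inl, Sum.elim_comp_inr, Matrix.mulVec_add, Matrix.mulVec_mulVec,
      Matrix.mulVec_sub]
    congr 1
    abel
  have heU : ∀ t, Uncorr P (future δ t) (e t) := errProc_uncorr hδ
  have hpU : ∀ t, Uncorr P (future δ t) (p t) := by
    intro t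
    induction t with
    | zero =>
      have : p 0 = fun _ => 0 := by
        funext ω i
        cases i <;> simp [hp, hx0, hξ0, he, errProc]
      rw [this]
      exact hδ.uncorr_const 0 0
    | succ t ih =>
      rw [hps]
      have hm := future_mono δ (Nat.le_succ t)
      exact (((ih.mono hm).mulVec _).add (((heU t).mono hm).mulVec _)).add
        ((hδ.uncorr_succ t).mulVec _)
  have hLU := loop_uncorr hδ hx0 hξ0 hx hξ
  have hxU : ∀ t, Uncorr P (future δ t) (x t) := fun t i => hLU t (Sum.inl i)
  have huU : ∀ t, Uncorr P (future δ t) (fun ω => c.F *ᵥ ξ t ω) := fun t =>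
    Uncorr.mulVec (fun i => hLU t (Sum.inr i)) c.F
  have hPlim : Tendsto (fun t => mom P (e t) (e t)) atTop (𝓝 Y) := errProc_mom_tendsto hδ hVv hY
  -- With the stationary gain, e and p are orthogonal only in the limit. Their correlation obeys a
  -- stable Sylvester recursion whose forcing tends to 0 by the normal equation at Y.
  have hNlim : Tendsto (fun t => mom P (e t) (p t)) atTop (𝓝 0) := by
    refine (schur_filter hVv hY).tendsto_sylvester_of_fixed (V := 0) hc (by simp)
      (W := fun t => ((S.A - H * S.C) * mom P (e t) (e t) * S.Cᵀ - H * S.Vv) * Dᵀ) ?_ fun t => ?_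
    · have hcont : Continuous fun Q : Matrix (Fin nx) (Fin nx) ℝ =>
        ((S.A - H * S.C) * Q * S.Cᵀ - H * S.Vv) * Dᵀ := by fun_prop
      have := (hcont.tendsto Y).comp hPlim
      rwa [filterGain_orth hVv hY.posSemidef, sub_self, Matrix.zero_mul] at this
    · have h1 := (heU t).sqInt
      have h2 := (hpU t).sqInt
      have h3 : Matrix.fromCols (1 : Matrix (Fin nx) (Fin nx) ℝ) (-H) * Matrix.fromBlocks S.Vw 0 0 S.Vv * (D * V)ᵀ
          = -(H * S.Vv * Dᵀ) := by
        rw [Matrix.transpose_mul, ← Matrix.mul_assoc, hV, noiseGain_mul]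
        simp
      rw [hps, he, errProc, ← he, mom_add_noise hδ ((heU t).mulVec _)
        (((hpU t).mulVec _).add ((heU t).mulVec _)), h3,
        mom_add_right (h1.mulVec _) (h2.mulVec _) (h1.mulVec _),
        mom_mulVec_left _ h1 (h2.mulVec _), mom_mulVec_left _ h1 (h1.mulVec _),
        mom_mulVec_right _ h1 h2, mom_mulVec_right _ h1 h1, Matrix.transpose_mul D]
      simp only [Matrix.sub_mul, Matrix.mul_assoc]
      abel
  set T : Matrix (Fin nu) (Fin nx ⊕ ι) ℝ := Matrix.fromCols (-F) c.F with hT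
  have hn : ∀ t ω, c.F *ᵥ ξ t ω - F *ᵥ x t ω = T *ᵥ p t ω - F *ᵥ e t ω := by
    intro t ω
    simp only [hT, hp, Matrix.fromCols_mulVec_sumElim, Matrix.mulVec_sub, Matrix.neg_mulVec]
    abel
  -- The bound of `integral_quad_sub_ge` with the part of u - Fx known to the controller as n.
  set γ : ℕ → ℝ := fun t => (F * mom P (e t) (e t) * Fᵀ * Zᵀ).trace
    - 2 * (T * (mom P (e t) (p t))ᵀ * (Z * F)ᵀ).trace with hγ
  have hγlim : Tendsto γ atTop (𝓝 ((F * Y * Fᵀ * Zᵀ).trace)) := by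
    have hc1 : Continuous fun q : Matrix (Fin nx) (Fin nx) ℝ => F * q * Fᵀ * Zᵀ := by fun_prop
    have hc2 : Continuous fun q : Matrix (Fin nx) (Fin nx ⊕ ι) ℝ => T * qᵀ * (Z * F)ᵀ := by
      fun_prop
    have h1 := (hc1.matrix_trace.tendsto Y).comp hPlim
    have h2 := ((hc2.matrix_trace.tendsto 0).comp hNlim).const_mul 2
    rw [Matrix.transpose_zero, Matrix.mul_zero, Matrix.zero_mul, Matrix.trace_zero, mul_zero] at h2
    have h3 := h1.sub h2
    rwa [sub_zero] at h3
  obtain ⟨β, hβ⟩ := exists_loop_quad_limit hδ hc (hxU 0).sqInt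
    (by rw [show ξ 0 = fun _ => 0 from funext hξ0]; exact SqInt.const 0) hx hξ X
  have hlow := ((hβ.sub (hβ.comp (tendsto_add_atTop_nat 1))).const_add (fixedCost S X)).add hγlim
  rw [sub_self, add_zero] at hlow
  refine le_of_tendsto_of_tendsto' hlow hl fun t => ?_
  rw [integral_stage_eq hδ hR hX (hxU t) (huU t) (hx t)]
  simp only [Function.comp, hγ]
  have := integral_quad_sub_ge hZ F ((hpU t).sqInt.mulVec T) (heU t).sqInt
  rw [mom_mulVec_left T (hpU t).sqInt (heU t).sqInt, ← mom_transpose (e t) (p t)] at this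
  simp only [← hF, ← hZdef, hn]
  linarith

end Loop

/-- The LQG controller attains the optimal cost. -/
theorem tendsto_stage_lqgController (hδ : IsWhiteNoise S P δ) (hVv : S.Vv.PosDef)
    (hR : S.Ru.PosDef) (hX : IsStabilizingRiccati S.A S.B (S.Cᵀ * S.Qy * S.C) S.Ru X)
    (hY : IsStabilizingRiccati S.Aᵀ S.Cᵀ S.Vw S.Vv Y) {x ξ : ℕ → Ω → Fin nx → ℝ}
    (hx0 : ∀ ω, x 0 ω = 0) (hξ0 : ∀ ω, ξ 0 ω = 0)
    (hx : ∀ t ω, x (t + 1) ω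
      = S.A *ᵥ x t ω + S.B *ᵥ ((S.lqgController X Y).F *ᵥ ξ t ω) + δ t ω ∘ Sum.inl)
    (hξ : ∀ t ω, ξ (t + 1) ω = (S.lqgController X Y).G *ᵥ ξ t ω
      + (S.lqgController X Y).H *ᵥ (S.C *ᵥ x t ω + δ t ω ∘ Sum.inr)) :
    Tendsto (fun t => ∫ ω, S.stage (S.C *ᵥ x t ω + δ t ω ∘ Sum.inr)
      ((S.lqgController X Y).F *ᵥ ξ t ω) ∂P) atTop (𝓝 (optimalCost S X Y)) := by
  set e := errProc S δ (fun _ => filterGain S Y) with he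
  -- The controller state is exactly the Kalman estimate. Hence u - Fx = -Fe, and the lower bound
  -- becomes an equality.
  have hξe : ∀ t ω, ξ t ω = x t ω - e t ω := by
    intro t ω
    induction t with
    | zero => simp [hx0, hξ0, he, errProc]
    | succ t ih =>
      rw [he, estimate_succ (hx t ω), hξ, ← he, ← ih]
      have h1 : x t ω = ξ t ω + e t ω := by rw [ih]; abel
      rw [h1]
      change (S.A + S.B * riccatiGain S.A S.B S.Ru X - filterGain S Y * S.C) *ᵥ ξ t ω
        + filterGain S Y *ᵥ _ = S.A *ᵥ ξ t ω + S.B *ᵥ (riccatiGain S.A S.B S.Ru X *ᵥ ξ t ω) + _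
      simp only [Matrix.mulVec_add, Matrix.sub_mulVec, Matrix.add_mulVec, Matrix.mulVec_mulVec]
      abel
  have hLU := loop_uncorr hδ hx0 hξ0 hx hξ
  have hxU : ∀ t, Uncorr P (future δ t) (x t) := fun t i => hLU t (Sum.inl i)
  have huU : ∀ t, Uncorr P (future δ t) (fun ω => (S.lqgController X Y).F *ᵥ ξ t ω) := fun t =>
    Uncorr.mulVec (fun i => hLU t (Sum.inr i)) _
  have hc := isStabilizing_lqgController S hX hY hVv
  obtain ⟨β, hβ⟩ := exists_loop_quad_limit hδ hc (hxU 0).sqInt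
    (by rw [show ξ 0 = fun _ => 0 from funext hξ0]; exact SqInt.const 0) hx hξ X
  set F := riccatiGain S.A S.B S.Ru X with hF
  set Z := S.Ru + S.Bᵀ * X * S.B with hZ
  have hcont : Continuous fun Q : Matrix (Fin nx) (Fin nx) ℝ => F * Q * Fᵀ * Zᵀ := by fun_prop
  have hlow := ((hβ.sub (hβ.comp (tendsto_add_atTop_nat 1))).const_add (fixedCost S X)).add
    ((hcont.matrix_trace.tendsto Y).comp (errProc_mom_tendsto hδ hVv hY))
  rw [sub_self, add_zero] at hlow
  refine hlow.congr fun t => ?_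
  have heU := (errProc_uncorr (K := fun _ => filterGain S Y) hδ t).sqInt
  rw [integral_stage_eq hδ hR hX (hxU t) (huU t) (hx t)]
  simp only [Function.comp]
  congr 1
  have hn : ∀ ω, (S.lqgController X Y).F *ᵥ ξ t ω - F *ᵥ x t ω = (-F) *ᵥ e t ω := by
    intro ω
    change F *ᵥ ξ t ω - F *ᵥ x t ω = _
    rw [hξe, Matrix.mulVec_sub, Matrix.neg_mulVec]
    abel
  simp only [← hF, ← hZ, hn]
  rw [integral_quad Z (heU.mulVec _) (heU.mulVec _), mom_mulVec_left _ heU (heU.mulVec _),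
    mom_mulVec_right _ heU heU]
  simp [Matrix.mul_assoc]

section Causal

variable {x : ℕ → Ω → Fin nx → ℝ} {u : ℕ → Ω → Fin nu → ℝ}

/-- The control at each time is an affine function of the past outputs. -/
def IsCausal (S : LQGData nx nu ny) (δ : ℕ → Ω → Fin nx ⊕ Fin ny → ℝ) (x : ℕ → Ω → Fin nx → ℝ)
    (u : ℕ → Ω → Fin nu → ℝ) : Prop :=
  ∀ t i, (fun ω => u t ω i) ∈ Submodule.span ℝ
    (insert (1 : Ω → ℝ) (⋃ s < t, comps fun ω => S.C *ᵥ x s ω + δ s ω ∘ Sum.inr))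

variable (hδ : IsWhiteNoise S P δ) (hVw : S.Vw.PosSemidef) (hVv : S.Vv.PosDef)
  (hx0 : ∀ ω, x 0 ω = 0)
  (hx : ∀ t ω, x (t + 1) ω = S.A *ᵥ x t ω + S.B *ᵥ u t ω + δ t ω ∘ Sum.inl)
  (hu : IsCausal S δ x u)
include hδ hVw hVv hx0 hx hu

/-- The orthogonality principle, with linear spans in place of conditional expectations: the optimal
time-varying gains keep e(t) orthogonal to constants and to all past outputs, hence to the control
and to the estimate. -/
theorem IsCausal.uncorr_kalman (t : ℕ) :
    Uncorr P (future δ t ∪ comps (errProc S δ (fun t => filterGain S (kalmanCov S t)) t)) (u t) ∧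
    Uncorr P (future δ t ∪ comps (errProc S δ (fun t => filterGain S (kalmanCov S t)) t))
      (fun ω => x t ω - errProc S δ (fun t => filterGain S (kalmanCov S t)) t ω) := by
  set K : ℕ → Matrix (Fin nx) (Fin ny) ℝ := fun t => filterGain S (kalmanCov S t) with hK
  set e := errProc S δ K with he
  set y : ℕ → Ω → Fin ny → ℝ := fun s ω => S.C *ᵥ x s ω + δ s ω ∘ Sum.inr with hy
  have heU : ∀ t, Uncorr P (future δ t) (e t) := errProc_uncorr hδ
  -- The next error is a linear function of the present error and noise, so orthogonality is
  -- inherited; only the newest innovation needs an argument of its own.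
  have step : ∀ {κ : Type} [Fintype κ] [DecidableEq κ] (t : ℕ) (a : Ω → κ → ℝ),
      Uncorr P (future δ t ∪ comps (e t)) a → Uncorr P (future δ (t + 1) ∪ comps (e (t + 1))) a := by
    intro κ _ _ t a ha
    have h1 := ha.mono Set.subset_union_left
    refine (h1.mono (future_mono δ (Nat.le_succ t))).union (uncorr_comps ha.sqInt ?_)
    rw [he, errProc, ← he, mom_add_right ha.sqInt ((heU t).sqInt.mulVec _)
      ((hδ.sqInt t).mulVec _), mom_mulVec_right _ ha.sqInt (heU t).sqInt,
      mom_mulVec_right _ ha.sqInt (hδ.sqInt t),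
      ha.mom_eq_zero (heU t).sqInt Set.subset_union_right, h1.mom_future hδ.sqInt le_rfl]
    simp
  have base : ∀ {κ : Type} [Fintype κ] [DecidableEq κ] (v : κ → ℝ),
      Uncorr P (future δ 0 ∪ comps (e 0)) (fun _ => v) := by
    intro κ _ _ v
    refine (hδ.uncorr_const 0 v).union (uncorr_comps (SqInt.const v) ?_)
    ext i j
    simp [mom, he, errProc]
  have hone : ∀ t, Uncorr P (future δ t ∪ comps (e t)) (fun _ => fun _ : Unit => (1 : ℝ)) := by
    intro t
    induction t with
    | zero => exact base _
    | succ t ih => exact step t _ ih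
  have hν : ∀ t, Uncorr P (future δ (t + 1) ∪ comps (e (t + 1)))
      (fun ω => S.C *ᵥ e t ω + δ t ω ∘ Sum.inr) := by
    intro t
    have h1 : Uncorr P (future δ (t + 1)) (fun ω => S.C *ᵥ e t ω + δ t ω ∘ Sum.inr) := by
      simp only [comp_inr_eq]
      exact (((heU t).mono (future_mono δ (Nat.le_succ t))).mulVec _).add
        ((hδ.uncorr_succ t).mulVec _)
    refine h1.union (uncorr_comps h1.sqInt (innovation_uncorr hδ hVv t ?_ ?_))
    · exact mom_self_posSemidef (heU t).sqInt
    · rw [errProc_kalman_mom hδ]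
  have huO : ∀ t, (∀ s < t, Uncorr P (future δ t ∪ comps (e t)) (y s)) →
      Uncorr P (future δ t ∪ comps (e t)) (u t) := by
    intro t hyt i
    refine Submodule.span_le.2 ?_ (hu t i)
    refine Set.insert_subset (hone t ()) (Set.iUnion₂_subset fun s hs => ?_)
    rintro _ ⟨j, rfl⟩
    exact hyt s hs j
  have main : ∀ t, Uncorr P (future δ t ∪ comps (e t)) (fun ω => x t ω - e t ω) ∧
      ∀ s < t, Uncorr P (future δ t ∪ comps (e t)) (y s) := by
    intro t
    induction t with
    | zero =>
      refine ⟨?_, fun s hs => absurd hs (Nat.not_lt_zero s)⟩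
      rw [show (fun ω => x 0 ω - e 0 ω) = fun _ => 0 by funext ω; simp [hx0, he, errProc]]
      exact base 0
    | succ t ih =>
      have hxt := step t _ ih.1
      have hut := step t _ (huO t ih.2)
      constructor
      · rw [show (fun ω => x (t + 1) ω - e (t + 1) ω) = _ from
          funext fun ω => estimate_succ (K := K) (hx t ω)]
        exact ((hxt.mulVec _).add (hut.mulVec _)).add ((hν t).mulVec _)
      · intro s hs
        rcases Nat.lt_succ_iff_lt_or_eq.1 hs with h | rfl
        · exact step t _ (ih.2 s h)
        · rw [show y s = fun ω => S.C *ᵥ (x s ω - e s ω) + (S.C *ᵥ e s ω + δ s ω ∘ Sum.inr) by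
            funext ω; rw [Matrix.mulVec_sub, ← add_assoc, sub_add_cancel]]
          exact (hxt.mulVec _).add (hν s)
  exact ⟨huO t (main t).2, (main t).1⟩

theorem IsCausal.uncorr (t : ℕ) :
    Uncorr P (future δ t) (u t) ∧ Uncorr P (future δ t) (x t) := by
  obtain ⟨h1, h2⟩ := hu.uncorr_kalman hδ hVw hVv hx0 hx t
  refine ⟨h1.mono Set.subset_union_left, ?_⟩
  have := (h2.mono Set.subset_union_left).add
    (errProc_uncorr (K := fun t => filterGain S (kalmanCov S t)) hδ t)
  simpa using this

/-- Detectability: with the stationary filter gain H, x obeys the stable A - HC driven by Hy + Bu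
and noise. Since Q and R are positive definite, these signals are bounded by the running cost and
the noise energy, without any stability of the loop. -/
theorem IsCausal.sum_quad_le (hQ : S.Qy.PosDef) (hR : S.Ru.PosDef)
    (hY : IsStabilizingRiccati S.Aᵀ S.Cᵀ S.Vw S.Vv Y) (X : Matrix (Fin nx) (Fin nx) ℝ) :
    ∃ κ : ℝ, 0 ≤ κ ∧ ∃ c : ℝ, 0 ≤ c ∧ ∀ T : ℕ,
      ∑ t ∈ Finset.range (T + 1), ∫ ω, x t ω ⬝ᵥ (X *ᵥ x t ω) ∂P
        ≤ κ * (∑ t ∈ Finset.range T,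
          ∫ ω, S.stage (S.C *ᵥ x t ω + δ t ω ∘ Sum.inr) (u t ω) ∂P + c * T) := by
  obtain ⟨κ₀, hκ₀, hsum⟩ := (schur_filter hVv hY).exists_sum_sq_le
  obtain ⟨kX, hkX, hX⟩ := exists_quad_bound X
  obtain ⟨kQ, hkQ, hQb⟩ := posDef_exists_bound hQ
  obtain ⟨kR, hkR, hRb⟩ := posDef_exists_bound hR
  obtain ⟨kH, hkH, hHb⟩ := exists_mulVec_bound (filterGain S Y)
  obtain ⟨kB, hkB, hBb⟩ := exists_mulVec_bound S.B
  obtain ⟨kN, hkN, hNb⟩ := exists_mulVec_bound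
    (Matrix.fromCols (1 : Matrix (Fin nx) (Fin nx) ℝ) (-filterGain S Y))
  set κ₁ := 3 * (kH ^ 2 * kQ + kB ^ 2 * kR + kN ^ 2) with hκ₁
  have hκ₁0 : 0 ≤ κ₁ := by positivity
  have huS : ∀ t, SqInt P (u t) := fun t => (hu.uncorr hδ hVw hVv hx0 hx t).1.sqInt
  have hxS : ∀ t, SqInt P (x t) := fun t => (hu.uncorr hδ hVw hVv hx0 hx t).2.sqInt
  have hyS : ∀ t, SqInt P fun ω => S.C *ᵥ x t ω + δ t ω ∘ Sum.inr := fun t => by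
    simp only [comp_inr_eq]
    exact ((hxS t).mulVec _).add ((hδ.sqInt t).mulVec _)
  have hst := fun t => integrable_stage (S := S) (hyS t) (huS t)
  have hδi := fun t => integrable_quad (1 : Matrix (Fin nx ⊕ Fin ny) (Fin nx ⊕ Fin ny) ℝ)
    (hδ.sqInt t) (hδ.sqInt t)
  have hδe : ∀ t, ∫ ω, δ t ω ⬝ᵥ ((1 : Matrix _ _ ℝ) *ᵥ δ t ω) ∂P
      = (Matrix.fromBlocks S.Vw 0 0 S.Vv).trace := fun t => by
    rw [integral_quad _ (hδ.sqInt t) (hδ.sqInt t), hδ.cov]; simp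
  have hr : ∀ t ω, ‖filterGain S Y *ᵥ (S.C *ᵥ x t ω + δ t ω ∘ Sum.inr) + S.B *ᵥ u t ω
      + Matrix.fromCols 1 (-filterGain S Y) *ᵥ δ t ω‖ ^ 2
      ≤ κ₁ * (S.stage (S.C *ᵥ x t ω + δ t ω ∘ Sum.inr) (u t ω)
        + δ t ω ⬝ᵥ ((1 : Matrix _ _ ℝ) *ᵥ δ t ω)) := by
    intro t ω
    set y := S.C *ᵥ x t ω + δ t ω ∘ Sum.inr
    have h1 := hQb y
    have h2 := hRb (u t ω)
    have h3 := norm_sq_le_dotProduct (δ t ω)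
    have h4 := PosSemidef.quad_nonneg hQ.posSemidef y
    have h5 := PosSemidef.quad_nonneg hR.posSemidef (u t ω)
    have h6 : 0 ≤ δ t ω ⬝ᵥ δ t ω := (sq_nonneg _).trans h3
    rw [Matrix.one_mulVec, stage]
    set q := y ⬝ᵥ (S.Qy *ᵥ y)
    set r := u t ω ⬝ᵥ (S.Ru *ᵥ u t ω)
    set n := δ t ω ⬝ᵥ δ t ω
    calc _ ≤ (kH * ‖y‖ + kB * ‖u t ω‖ + kN * ‖δ t ω‖) ^ 2 := by
          gcongr
          exact (norm_add₃_le).trans (add_le_add (add_le_add (hHb _) (hBb _)) (hNb _))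
      _ ≤ 3 * ((kH * ‖y‖) ^ 2 + (kB * ‖u t ω‖) ^ 2 + (kN * ‖δ t ω‖) ^ 2) := by
          nlinarith [sq_nonneg (kH * ‖y‖ - kB * ‖u t ω‖), sq_nonneg (kH * ‖y‖ - kN * ‖δ t ω‖),
            sq_nonneg (kB * ‖u t ω‖ - kN * ‖δ t ω‖)]
      _ = 3 * (kH ^ 2 * ‖y‖ ^ 2 + kB ^ 2 * ‖u t ω‖ ^ 2 + kN ^ 2 * ‖δ t ω‖ ^ 2) := by ring
      _ ≤ 3 * (kH ^ 2 * (kQ * q) + kB ^ 2 * (kR * r) + kN ^ 2 * n) := by gcongr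
      _ ≤ _ := by
          have p1 : 0 ≤ kH ^ 2 * kQ := by positivity
          have p2 : 0 ≤ kB ^ 2 * kR := by positivity
          have p3 : 0 ≤ kN ^ 2 := by positivity
          rw [hκ₁]
          nlinarith [mul_nonneg p1 h5, mul_nonneg p1 h6, mul_nonneg p2 h4, mul_nonneg p2 h6,
            mul_nonneg p3 h4, mul_nonneg p3 h5]
  have hpath : ∀ ω T, ∑ t ∈ Finset.range (T + 1), x t ω ⬝ᵥ (X *ᵥ x t ω)
      ≤ kX * κ₀ * κ₁ * ∑ t ∈ Finset.range T, (S.stage (S.C *ᵥ x t ω + δ t ω ∘ Sum.inr) (u t ω)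
        + δ t ω ⬝ᵥ ((1 : Matrix _ _ ℝ) *ᵥ δ t ω)) := by
    intro ω T
    have h1 := hsum (fun t => x t ω) _ (hx0 ω) (fun t => by
      have h : (Matrix.fromCols 1 (-filterGain S Y) : Matrix (Fin nx) (Fin nx ⊕ Fin ny) ℝ) *ᵥ δ t ω
          = δ t ω ∘ Sum.inl - filterGain S Y *ᵥ (δ t ω ∘ Sum.inr) := by
        conv_lhs => rw [← Sum.elim_comp_inl_inr (δ t ω)]
        rw [Matrix.fromCols_mulVec_sumElim, Matrix.one_mulVec, Matrix.neg_mulVec, sub_eq_add_neg]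
      show x (t + 1) ω = (S.A - filterGain S Y * S.C) *ᵥ x t ω
        + (filterGain S Y *ᵥ (S.C *ᵥ x t ω + δ t ω ∘ Sum.inr) + S.B *ᵥ u t ω
          + Matrix.fromCols 1 (-filterGain S Y) *ᵥ δ t ω)
      rw [hx, h, Matrix.sub_mulVec, Matrix.mulVec_add, Matrix.mulVec_mulVec]
      abel) T
    calc _ ≤ ∑ t ∈ Finset.range (T + 1), kX * ‖x t ω‖ ^ 2 := Finset.sum_le_sum fun t _ => hX _
      _ = kX * ∑ t ∈ Finset.range (T + 1), ‖x t ω‖ ^ 2 := by rw [Finset.mul_sum]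
      _ ≤ kX * (κ₀ * (κ₁ * ∑ t ∈ Finset.range T,
          (S.stage (S.C *ᵥ x t ω + δ t ω ∘ Sum.inr) (u t ω)
            + δ t ω ⬝ᵥ ((1 : Matrix _ _ ℝ) *ᵥ δ t ω)))) := by
          refine mul_le_mul_of_nonneg_left (h1.trans (mul_le_mul_of_nonneg_left ?_ hκ₀)) hkX
          rw [Finset.mul_sum]
          exact Finset.sum_le_sum fun t _ => hr t ω
      _ = _ := by ring
  refine ⟨kX * κ₀ * κ₁, by positivity, (Matrix.fromBlocks S.Vw 0 0 S.Vv).trace, ?_, fun T => ?_⟩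
  · rw [← hδe 0]
    refine integral_nonneg fun ω => ?_
    simp only [Matrix.one_mulVec]
    exact (sq_nonneg _).trans (norm_sq_le_dotProduct _)
  · have hi : ∀ t ∈ Finset.range T, Integrable (fun ω =>
        S.stage (S.C *ᵥ x t ω + δ t ω ∘ Sum.inr) (u t ω)
          + δ t ω ⬝ᵥ ((1 : Matrix _ _ ℝ) *ᵥ δ t ω)) P := fun t _ => (hst t).add (hδi t)
    have hxi : ∀ t ∈ Finset.range (T + 1), Integrable (fun ω => x t ω ⬝ᵥ (X *ᵥ x t ω)) P :=
      fun t _ => integrable_quad X (hxS t) (hxS t)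
    have h1 := integral_mono (integrable_finsetSum _ hxi)
      ((integrable_finsetSum _ hi).const_mul (kX * κ₀ * κ₁)) fun ω => hpath ω T
    rw [integral_const_mul, integral_finsetSum _ hxi, integral_finsetSum _ hi] at h1
    refine h1.trans_eq ?_
    congr 1
    rw [Finset.sum_congr rfl fun t _ => integral_add (hst t) (hδi t), Finset.sum_add_distrib]
    simp only [hδe, Finset.sum_const, Finset.card_range, nsmul_eq_mul]
    ring

/-- No causal affine control beats the optimal cost, stabilizing or not, when the process noise
excites all unstable modes. -/
theorem IsCausal.eventually_le_sum (hQ : S.Qy.PosDef) (hR : S.Ru.PosDef)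
    (hX : IsStabilizingRiccati S.A S.B (S.Cᵀ * S.Qy * S.C) S.Ru X)
    (hY : IsStabilizingRiccati S.Aᵀ S.Cᵀ S.Vw S.Vv Y) (hs : IsStabilizable S.A S.Vw) {j : ℝ}
    (hj : j < optimalCost S X Y) : ∀ᶠ T : ℕ in atTop,
      j * T ≤ ∑ t ∈ Finset.range T,
        ∫ ω, S.stage (S.C *ᵥ x t ω + δ t ω ∘ Sum.inr) (u t ω) ∂P := by
  set F := riccatiGain S.A S.B S.Ru X with hF
  set Z := S.Ru + S.Bᵀ * X * S.B with hZdef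
  have hZ : Z.PosSemidef := by
    have := (innov_posDef hX.posSemidef hR S.Bᵀ).posSemidef
    rwa [Matrix.transpose_transpose, add_comm] at this
  obtain ⟨κ, hκ, c, hc, hsum⟩ := hu.sum_quad_le hδ hVw hVv hx0 hx hQ hR hY X
  have hcont : Continuous fun Q : Matrix (Fin nx) (Fin nx) ℝ => F * Q * Fᵀ * Zᵀ := by fun_prop
  -- The storage is E xᵀXx, and the loss is the optimal one with the covariance of the time-varying
  -- filter in place of Y.
  refine eventually_le_sum_of_dissipation (b := fun t => ∫ ω, x t ω ⬝ᵥ (X *ᵥ x t ω) ∂P)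
    (γ := fun t => fixedCost S X + (F * kalmanCov S t * Fᵀ * Zᵀ).trace)
    (fun t => integral_nonneg fun ω => stage_nonneg hQ hR _ _)
    (fun t => integral_nonneg fun ω => PosSemidef.quad_nonneg hX.posSemidef _) hκ hc (fun t => ?_)
    (((hcont.matrix_trace.tendsto Y).comp (kalmanCov_tendsto hVw hVv hY hs)).const_add _) hsum hj
  obtain ⟨hut, hxt⟩ := hu.uncorr_kalman hδ hVw hVv hx0 hx t
  obtain ⟨huU, hxU⟩ := hu.uncorr hδ hVw hVv hx0 hx t
  set e := errProc S δ (fun t => filterGain S (kalmanCov S t)) with he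
  have heS : SqInt P (e t) := (errProc_uncorr hδ t).sqInt
  have hn := hut.sub (hxt.mulVec F)
  have h1 := integral_quad_sub_ge hZ F hn.sqInt heS
  rw [hn.mom_eq_zero heS Set.subset_union_right, errProc_kalman_mom hδ] at h1
  have h2 : ∀ ω, u t ω - F *ᵥ (x t ω - e t ω) - F *ᵥ e t ω = u t ω - F *ᵥ x t ω := fun ω => by
    rw [Matrix.mulVec_sub]; abel
  simp only [h2, Matrix.zero_mul, Matrix.trace_zero, mul_zero, sub_zero] at h1
  rw [integral_stage_eq hδ hR hX hxU huU (hx t)]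
  simp only [← hF, ← hZdef]
  linarith

end Causal

end Estimation

/-! ### From expected running costs to the costs of controllers and gains. -/

section Costs

variable {Ω : Type*} [MeasurableSpace Ω] {P : Measure Ω} [IsProbabilityMeasure P]
  {nx nu ny L : ℕ} {S : LQGData nx nu ny}
  {ι : Type} [Fintype ι] [DecidableEq ι] {X Y : Matrix (Fin nx) (Fin nx) ℝ}

/-- The head of the sum before t₀ is absorbed by a slightly larger slope m, since (m - j) T exceeds
any constant. -/
theorem le_liminf_avgCost {r : Ω → ℕ → ℝ} {a : ℕ → ℝ} (h0 : ∀ ω t, 0 ≤ r ω t) {t₀ : ℕ}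
    (hi : ∀ t, t₀ ≤ t → Integrable (fun ω => r ω t) P) (ha : ∀ t, t₀ ≤ t → ∫ ω, r ω t ∂P = a t)
    (ha0 : ∀ t, 0 ≤ a t) {J : ℝ}
    (h : ∀ j < J, ∀ᶠ T : ℕ in atTop, j * T ≤ ∑ t ∈ Finset.range T, a t) :
    ENNReal.ofReal J ≤ liminf (avgCost P r t₀) atTop := by
  have hlim : ∀ j < J, ENNReal.ofReal j ≤ liminf (avgCost P r t₀) atTop := by
    intro j hj
    obtain ⟨m, hm1, hm2⟩ := exists_between hj
    refine le_liminf_of_le (by isBoundedDefault) ?_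
    have hlarge : Tendsto (fun T : ℕ => (m - j) * (T : ℝ)) atTop atTop :=
      tendsto_natCast_atTop_atTop.const_mul_atTop (by linarith)
    filter_upwards [h m hm2, hlarge.eventually_ge_atTop (∑ t ∈ Finset.range t₀, a t),
      eventually_ge_atTop t₀, eventually_gt_atTop 0] with T h1 h2 h3 h4
    rw [avgCost_eq h0 t₀ hi T]
    refine ENNReal.ofReal_le_ofReal ?_
    have hT : (0 : ℝ) < T := by exact_mod_cast h4
    have h5 : ∑ t ∈ Finset.Icc t₀ T, ∫ ω, r ω t ∂P
        = ∑ t ∈ Finset.range (T + 1), a t - ∑ t ∈ Finset.range t₀, a t := by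
      rw [Finset.sum_range_sub_sum_range (by omega)]
      refine Finset.sum_congr (by ext i; simp; omega) fun t ht => ha t ?_
      simp only [Finset.mem_filter, Finset.mem_range] at ht
      omega
    rw [h5, Finset.sum_range_succ, one_div, le_inv_mul_iff₀ hT]
    have := ha0 T
    linarith
  refine le_of_forall_lt fun c hc => ?_
  have hct : c ≠ ∞ := (hc.trans ENNReal.ofReal_lt_top).ne
  have h1 : c.toReal < J := by
    by_contra hcon
    push Not at hcon
    have := ENNReal.ofReal_le_ofReal hcon
    rw [ENNReal.ofReal_toReal hct] at this
    exact absurd hc this.not_gt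
  obtain ⟨m, hm1, hm2⟩ := exists_between h1
  refine lt_of_lt_of_le ?_ (hlim m hm2)
  rw [← ENNReal.ofReal_toReal hct]
  exact (ENNReal.ofReal_lt_ofReal_iff (ENNReal.toReal_nonneg.trans_lt hm1)).2 hm1

variable {d : ℕ → Ω → Noise nx ny}

section Dynamic

variable {c : DynController ι nu ny}

/-- The expected running cost of a stable loop converges, to a limit which does not depend on the
initial controller state. -/
theorem exists_tendsto_dynAvg (hδ : IsWhiteNoise S P (fun t ω => (d t ω).ofLp)) (hQ : S.Qy.PosDef)
    (hR : S.Ru.PosDef) (hc : S.IsStabilizing c) :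
    ∃ ℓ : ℝ, ∀ ξ₀ : Ω → ι → ℝ, SqInt P ξ₀ →
      Tendsto (fun t => ∫ ω, S.loopStage c (ξ₀ ω) (fun t => d t ω) t ∂P) atTop (𝓝 ℓ) ∧
      Tendsto (S.dynAvg c P d ξ₀) atTop (𝓝 (ENNReal.ofReal ℓ)) := by
  set Ψ : Matrix (Fin ny) (Fin nx ⊕ ι) ℝ := Matrix.fromCols S.C 0 with hΨ
  set Φ : Matrix (Fin nu) (Fin nx ⊕ ι) ℝ := Matrix.fromCols 0 c.F with hΦ
  set N : Matrix (Fin nx ⊕ ι) (Fin nx ⊕ Fin ny) ℝ := Matrix.fromBlocks 1 0 0 c.H with hN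
  obtain ⟨Z, hZ⟩ := exists_mom_limit hδ hc N
  obtain ⟨ℓ, hℓ⟩ := exists_stage_limit hδ hc N Ψ Φ
  refine ⟨ℓ, fun ξ₀ hξ₀ => ?_⟩
  set s : ℕ → Ω → Fin nx ⊕ ι → ℝ := fun t ω =>
    Sum.elim (S.loopState c (ξ₀ ω) (fun t => d t ω) t).1
      (S.loopState c (ξ₀ ω) (fun t => d t ω) t).2 with hs
  have hs0 : SqInt P (s 0) := (SqInt.const (0 : Fin nx → ℝ)).elim hξ₀
  have hsucc : ∀ t ω, s (t + 1) ω = Matrix.fromBlocks S.A (S.B * c.F) (c.H * S.C) c.G *ᵥ s t ω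
      + N *ᵥ (d (0 + t) ω).ofLp := fun t ω => by
    rw [zero_add]
    exact loop_succ (δ := fun t ω => (d t ω).ofLp)
      (x := fun t ω => (S.loopState c (ξ₀ ω) (fun t => d t ω) t).1)
      (ξ := fun t ω => (S.loopState c (ξ₀ ω) (fun t => d t ω) t).2)
      (fun _ _ => rfl) (fun _ _ => rfl) t ω
  have hst : ∀ t ω, S.loopStage c (ξ₀ ω) (fun t => d t ω) t
      = S.stage (Ψ *ᵥ s t ω + (d (0 + t) ω).ofLp ∘ Sum.inr) (Φ *ᵥ s t ω) := by
    intro t ω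
    rw [zero_add, hΨ, hΦ, hs, Matrix.fromCols_mulVec_sumElim, Matrix.fromCols_mulVec_sumElim,
      Matrix.zero_mulVec, Matrix.zero_mulVec, add_zero, zero_add]
    rfl
  have hsq := (hZ 0 s hs0 hsucc).1
  have hlim : Tendsto (fun t => ∫ ω, S.loopStage c (ξ₀ ω) (fun t => d t ω) t ∂P) atTop (𝓝 ℓ) := by
    simp only [hst]
    exact hℓ 0 s hs0 hsucc
  refine ⟨hlim, tendsto_avgCost (r := fun ω => S.loopStage c (ξ₀ ω) fun t => d t ω) (fun ω t => stage_nonneg hQ hR _ _) (fun t _ => ?_) hlim⟩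
  simp only [hst, comp_inr_eq]
  exact integrable_stage (((hsq t).mulVec Ψ).add ((hδ.sqInt _).mulVec _)) ((hsq t).mulVec Φ)

theorem optimalCost_le_dynCost_of_isStabilizing
    (hδ : IsWhiteNoise S P (fun t ω => (d t ω).ofLp)) (hVv : S.Vv.PosDef) (hR : S.Ru.PosDef)
    (hX : IsStabilizingRiccati S.A S.B (S.Cᵀ * S.Qy * S.C) S.Ru X)
    (hY : IsStabilizingRiccati S.Aᵀ S.Cᵀ S.Vw S.Vv Y) (hc : S.IsStabilizing c) {ℓ : ℝ}
    (hℓ : Tendsto (fun t => ∫ ω, S.loopStage c 0 (fun t => d t ω) t ∂P) atTop (𝓝 ℓ)) :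
    optimalCost S X Y ≤ ℓ :=
  optimalCost_le_of_isStabilizing hδ hVv hR hX hY
    (x := fun t ω => (S.loopState c 0 (fun t => d t ω) t).1)
    (ξ := fun t ω => (S.loopState c 0 (fun t => d t ω) t).2)
    (fun _ => rfl) (fun _ => rfl) hc (fun _ _ => rfl) (fun _ _ => rfl) hℓ

theorem isCausal_loop (c : DynController ι nu ny) (ξ₀ : ι → ℝ) :
    IsCausal S (fun t ω => (d t ω).ofLp) (fun t ω => (S.loopState c ξ₀ (fun t => d t ω) t).1)
      (fun t ω => c.F *ᵥ (S.loopState c ξ₀ (fun t => d t ω) t).2) := by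
  set x : ℕ → Ω → Fin nx → ℝ := fun t ω => (S.loopState c ξ₀ (fun t => d t ω) t).1
  set ξ : ℕ → Ω → ι → ℝ := fun t ω => (S.loopState c ξ₀ (fun t => d t ω) t).2
  set y : ℕ → Ω → Fin ny → ℝ := fun s ω => S.C *ᵥ x s ω + (d s ω).ofLp ∘ Sum.inr with hy
  have h : ∀ t i, (fun ω => ξ t ω i) ∈ Submodule.span ℝ (insert (1 : Ω → ℝ) (⋃ s < t, comps (y s))) := by
    intro t
    induction t with
    | zero =>
      intro i
      have : (fun ω => ξ 0 ω i) = ξ₀ i • (1 : Ω → ℝ) := by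
        funext ω
        change ξ₀ i = ξ₀ i * 1
        rw [mul_one]
      rw [this]
      exact Submodule.smul_mem _ _ (Submodule.subset_span (Set.mem_insert _ _))
    | succ t ih =>
      intro i
      refine Submodule.add_mem _ (mulVec_comp_mem (fun j => ?_) c.G i)
        (mulVec_comp_mem (a := y t) (fun j => Submodule.subset_span (Or.inr ?_)) c.H i)
      · refine Submodule.span_mono (Set.insert_subset_insert ?_) (ih j)
        exact Set.biUnion_subset_biUnion_left fun s hs => Nat.lt_succ_of_lt hs
      · exact Set.mem_iUnion₂.2 ⟨t, Nat.lt_succ_self t, j, rfl⟩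
  exact fun t i => mulVec_comp_mem (h t) c.F i

theorem optimalCost_le_dynCost (hδ : IsWhiteNoise S P (fun t ω => (d t ω).ofLp))
    (hVw : S.Vw.PosSemidef) (hVv : S.Vv.PosDef) (hQ : S.Qy.PosDef) (hR : S.Ru.PosDef)
    (hX : IsStabilizingRiccati S.A S.B (S.Cᵀ * S.Qy * S.C) S.Ru X)
    (hY : IsStabilizingRiccati S.Aᵀ S.Cᵀ S.Vw S.Vv Y) (hs : IsStabilizable S.A S.Vw)
    (c : DynController ι nu ny) (ξ₀ : ι → ℝ) :
    ENNReal.ofReal (optimalCost S X Y) ≤ S.dynCost c P d (fun _ => ξ₀) := by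
  have hc := isCausal_loop (S := S) (d := d) c ξ₀
  refine le_liminf_avgCost (fun ω t => stage_nonneg hQ hR _ _) (fun t _ => ?_)
    (a := fun t => ∫ ω, S.loopStage c ξ₀ (fun t => d t ω) t ∂P) (fun t _ => rfl)
    (fun t => integral_nonneg fun ω => stage_nonneg hQ hR _ _)
    fun j hj => hc.eventually_le_sum hδ hVw hVv (fun _ => rfl) (fun _ _ => rfl) hQ hR hX hY hs hj
  obtain ⟨h1, h2⟩ := hc.uncorr hδ hVw hVv (fun _ => rfl) (fun _ _ => rfl) t
  refine integrable_stage ((h2.sqInt.mulVec S.C).add ?_) h1.sqInt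
  exact fun i => hδ.sqInt t (Sum.inr i)

end Dynamic

section Gains

/-- The input sequence of the plant under the gain `K`. -/
noncomputable def gainInput (S : LQGData nx nu ny) (K : Matrix (Fin nu) (ZIdx L nu ny) ℝ)
    (u₀ : ℕ → Fin nu → ℝ) (d : ℕ → Noise nx ny) (t : ℕ) : Fin nu → ℝ :=
  if t < L then u₀ t else K *ᵥ (histGamma L nx nu ny *ᵥ S.histState K u₀ d (t - L))

theorem initState_congr {u u' : ℕ → Fin nu → ℝ} (d : ℕ → Noise nx ny) {T : ℕ}
    (h : ∀ t < T, u t = u' t) {t : ℕ} (ht : t ≤ T) : S.initState u d t = S.initState u' d t := by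
  induction t with
  | zero => rfl
  | succ t ih => rw [initState, initState, ih (by omega), h t (by omega)]

/-- The history dynamics started from a plant history is the history of an actual plant run, whether
the gain is stabilizing or not. So a gain can be treated as a causal control of the plant. -/
theorem histState_eq_histOf (hobs : IsStepObservable L S.A S.C)
    (K : Matrix (Fin nu) (ZIdx L nu ny) ℝ) (u₀ : ℕ → Fin nu → ℝ) (d : ℕ → Noise nx ny) (s : ℕ) :
    S.histState K u₀ d s = histOf L (gainInput S K u₀ d)
      (fun t => S.C *ᵥ S.initState (gainInput S K u₀ d) d t + (d t).v)
      (fun t => (d t).ofLp ∘ Sum.inl) (fun t => (d t).ofLp ∘ Sum.inr) s := by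
  induction s with
  | zero =>
    have h : ∀ k < L, gainInput S K u₀ d k = u₀ k := fun k hk => if_pos hk
    funext i
    rcases i with (⟨k, a⟩ | ⟨k, a⟩) | (⟨k, a⟩ | ⟨k, a⟩)
    · change u₀ k a = gainInput S K u₀ d (0 + k) a
      rw [zero_add, h k k.2]
    · change (S.C *ᵥ S.initState u₀ d k + (d k).v) a = (S.C *ᵥ S.initState (gainInput S K u₀ d) d
        (0 + k) + (d (0 + k)).v) a
      rw [zero_add, initState_congr d h k.2.le]
    · change (d k).w a = (d (0 + k)).w a
      rw [zero_add]
    · change (d k).v a = (d (0 + k)).v a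
      rw [zero_add]
  | succ s ih =>
    have hM := histM_mulVec_histOf S hobs (x := S.initState (gainInput S K u₀ d) d)
      (u := gainInput S K u₀ d)
      (y := fun t => S.C *ᵥ S.initState (gainInput S K u₀ d) d t + (d t).v)
      (w := fun t => (d t).ofLp ∘ Sum.inl) (v := fun t => (d t).ofLp ∘ Sum.inr)
      (fun _ => rfl) (fun _ => rfl) s
    rw [histOf_succ S (δ := fun t => (d t).ofLp) s (by
      rw [histPsi, ← Matrix.mulVec_mulVec, hM]; rfl), histState, ← ih, add_comm L s,
      show gainInput S K u₀ d (s + L) = K *ᵥ (histGamma L nx nu ny *ᵥ S.histState K u₀ d s) by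
        rw [gainInput, if_neg (by omega), Nat.add_sub_cancel]]

theorem gainInput_feedback (hobs : IsStepObservable L S.A S.C)
    (K : Matrix (Fin nu) (ZIdx L nu ny) ℝ) (u₀ : ℕ → Fin nu → ℝ) (d : ℕ → Noise nx ny) (t : ℕ) :
    gainInput S K u₀ d (t + L) = K *ᵥ Sum.elim (stack L (gainInput S K u₀ d) t)
      (stack L (fun t => S.C *ᵥ S.initState (gainInput S K u₀ d) d t + (d t).ofLp ∘ Sum.inr) t) := by
  conv_lhs => rw [gainInput, if_neg (by omega), Nat.add_sub_cancel, histState_eq_histOf hobs, histOf,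
    histGamma_mulVec]
  rfl

theorem histStage_eq (hobs : IsStepObservable L S.A S.C)
    (K : Matrix (Fin nu) (ZIdx L nu ny) ℝ) (u₀ : ℕ → Fin nu → ℝ) (d : ℕ → Noise nx ny) {t : ℕ}
    (ht : L ≤ t) : S.histStage K u₀ d t
      = S.stage (S.C *ᵥ S.initState (gainInput S K u₀ d) d t + (d t).ofLp ∘ Sum.inr)
        (gainInput S K u₀ d t) := by
  have hM := histM_mulVec_histOf S hobs (x := S.initState (gainInput S K u₀ d) d)
    (u := gainInput S K u₀ d)
    (y := fun t => S.C *ᵥ S.initState (gainInput S K u₀ d) d t + (d t).v)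
    (w := fun t => (d t).ofLp ∘ Sum.inl) (v := fun t => (d t).ofLp ∘ Sum.inr)
    (fun _ => rfl) (fun _ => rfl) (t - L)
  rw [← histState_eq_histOf hobs, Nat.sub_add_cancel ht] at hM
  rw [histStage, histPsi, ← Matrix.mulVec_mulVec, hM, gainInput, if_neg (by omega)]
  rfl

variable {K : Matrix (Fin nu) (ZIdx L nu ny) ℝ}

/-- The expected running costs of all runs of the plant under a stabilizing gain converge to the
same limit. -/
theorem exists_gain_limit (hδ : IsWhiteNoise S P (fun t ω => (d t ω).ofLp))
    (hobs : IsStepObservable L S.A S.C) (hK : K ∈ S.stabGains L) :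
    ∃ ℓ : ℝ, ∀ (x : ℕ → Ω → Fin nx → ℝ) (u : ℕ → Ω → Fin nu → ℝ), SqInt P (x 0) →
      (∀ t < L, SqInt P (u t)) →
      (∀ t ω, x (t + 1) ω = S.A *ᵥ x t ω + S.B *ᵥ u t ω + (d t ω).ofLp ∘ Sum.inl) →
      (∀ t ω, u (t + L) ω = K *ᵥ Sum.elim (stack L (fun t => u t ω) t)
        (stack L (fun t => S.C *ᵥ x t ω + (d t ω).ofLp ∘ Sum.inr) t)) →
      (∀ t, L ≤ t → Integrable
        (fun ω => S.stage (S.C *ᵥ x t ω + (d t ω).ofLp ∘ Sum.inr) (u t ω)) P) ∧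
      Tendsto (fun t => ∫ ω, S.stage (S.C *ᵥ x t ω + (d t ω).ofLp ∘ Sum.inr) (u t ω) ∂P) atTop
        (𝓝 ℓ) := by
  obtain ⟨Z, hZ⟩ := exists_mom_limit hδ hK (histPid L nx nu ny)
  obtain ⟨ℓ, hℓ⟩ := exists_stage_limit hδ hK (histPid L nx nu ny) (S.histPsi L)
    (K * histGamma L nx nu ny)
  refine ⟨ℓ, fun x u hx0 hu hx hfb => ?_⟩
  -- The histories of any such run obey one stable recursion driven by white noise, with the same
  -- output maps; only their initial value depends on the run.
  set s : ℕ → Ω → HIdx L nx nu ny → ℝ := fun t ω => histOf L (fun t => u t ω)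
    (fun t => S.C *ᵥ x t ω + (d t ω).ofLp ∘ Sum.inr) (fun t => (d t ω).ofLp ∘ Sum.inl)
    (fun t => (d t ω).ofLp ∘ Sum.inr) t with hs
  have hM : ∀ t ω, S.histM L *ᵥ s t ω = x (t + L) ω := fun t ω =>
    histM_mulVec_histOf S hobs (fun t => hx t ω) (fun _ => rfl) t
  have hy : ∀ t ω, S.histPsi L *ᵥ s t ω = S.C *ᵥ x (t + L) ω := fun t ω => by
    rw [histPsi, ← Matrix.mulVec_mulVec, hM]
  have hΓ : ∀ t ω, (K * histGamma L nx nu ny) *ᵥ s t ω = u (t + L) ω := fun t ω => by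
    have h : histGamma L nx nu ny *ᵥ s t ω = Sum.elim (stack L (fun t => u t ω) t)
        (stack L (fun t => S.C *ᵥ x t ω + (d t ω).ofLp ∘ Sum.inr) t) := histGamma_mulVec _ _
    rw [← Matrix.mulVec_mulVec, h, ← hfb]
  have hsucc : ∀ t ω, s (t + 1) ω
      = (S.histTheta L + histPiu L nx nu ny * K * histGamma L nx nu ny) *ᵥ s t ω
        + histPid L nx nu ny *ᵥ (d (L + t) ω).ofLp := by
    intro t ω
    have h := histOf_succ S (u := fun t => u t ω)
      (y := fun t => S.C *ᵥ x t ω + (d t ω).ofLp ∘ Sum.inr) (δ := fun t => (d t ω).ofLp) t (by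
        have := hy t ω
        simp only [hs] at this
        rw [this])
    rw [hs]
    simp only
    rw [h, Matrix.add_mulVec, Matrix.mul_assoc, ← Matrix.mulVec_mulVec _ (histPiu L nx nu ny)]
    have h2 := hΓ t ω
    simp only [hs] at h2
    rw [h2, add_comm L t]
    abel
  have hxs : ∀ t ≤ L, SqInt P (x t) := by
    intro t
    induction t with
    | zero => exact fun _ => hx0
    | succ t ih =>
      intro ht
      rw [show x (t + 1) = _ from funext fun ω => hx t ω]
      exact (((ih (by omega)).mulVec _).add ((hu t (by omega)).mulVec _)).add
        fun i => hδ.sqInt t (Sum.inl i)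
  have hs0 : SqInt P (s 0) := by
    rintro ((⟨k, a⟩ | ⟨k, a⟩) | (⟨k, a⟩ | ⟨k, a⟩))
    · exact hu (0 + k) (by have := k.2; omega) a
    · exact (((hxs (0 + k) (by have := k.2; omega)).mulVec S.C).add
        fun i => hδ.sqInt (0 + k) (Sum.inr i)) a
    · exact hδ.sqInt (0 + k) (Sum.inl a)
    · exact hδ.sqInt (0 + k) (Sum.inr a)
  have hsq := (hZ L s hs0 hsucc).1
  have hlim := hℓ L s hs0 hsucc
  simp only [hy, hΓ, add_comm L] at hlim
  refine ⟨fun t ht => ?_, (tendsto_add_atTop_iff_nat L).1 hlim⟩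
  obtain ⟨t, rfl⟩ := Nat.exists_eq_add_of_le' ht
  have h1 := (hsq t).mulVec (S.histPsi L)
  have h2 := (hsq t).mulVec (K * histGamma L nx nu ny)
  simp only [hy, hΓ] at h1 h2
  exact integrable_stage (h1.add fun i => hδ.sqInt (t + L) (Sum.inr i)) h2

/-- The limit of the costs of a stabilizing gain, which is also the limit of the costs of the
rebuilt controller, and of every run of the plant obeying the feedback law. -/
theorem exists_gain_cost (hδ : IsWhiteNoise S P (fun t ω => (d t ω).ofLp)) (hQ : S.Qy.PosDef)
    (hR : S.Ru.PosDef) (hobs : IsStepObservable L S.A S.C) (hK : K ∈ S.stabGains L)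
    (u₀ : ℕ → Fin nu → ℝ) :
    ∃ ℓ : ℝ, Tendsto (S.gainAvg P d u₀ K) atTop (𝓝 (ENNReal.ofReal ℓ)) ∧
      (∀ ξ₀ : Ω → Fin L × Fin nu → ℝ, SqInt P ξ₀ →
        Tendsto (fun t => ∫ ω, S.loopStage (DynController.ofGain K) (ξ₀ ω) (fun t => d t ω) t ∂P)
          atTop (𝓝 ℓ) ∧
        Tendsto (S.dynAvg (DynController.ofGain K) P d ξ₀) atTop (𝓝 (ENNReal.ofReal ℓ))) ∧
      ∀ {ι : Type} [Fintype ι] [DecidableEq ι] (c : DynController ι nu ny), S.IsStabilizing c →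
        (∀ (ξ : ℕ → ι → ℝ) (y : ℕ → Fin ny → ℝ), ξ 0 = 0 →
          (∀ t, ξ (t + 1) = c.G *ᵥ ξ t + c.H *ᵥ y t) → ∀ t,
          c.F *ᵥ ξ (t + L) = K *ᵥ Sum.elim (stack L (fun t => c.F *ᵥ ξ t) t) (stack L y t)) →
        Tendsto (fun t => ∫ ω, S.loopStage c 0 (fun t => d t ω) t ∂P) atTop (𝓝 ℓ) := by
  obtain ⟨ℓ, hℓ⟩ := exists_gain_limit hδ hobs hK
  have hsqξ : ∀ {ι : Type} [Fintype ι] [DecidableEq ι] (c : DynController ι nu ny)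
      (ξ₀ : Ω → ι → ℝ), SqInt P ξ₀ → ∀ t,
      SqInt P (fun ω => (S.loopState c (ξ₀ ω) (fun t => d t ω) t).1) ∧
      SqInt P (fun ω => (S.loopState c (ξ₀ ω) (fun t => d t ω) t).2) := by
    intro ι _ _ c ξ₀ hξ₀ t
    induction t with
    | zero => exact ⟨SqInt.const 0, hξ₀⟩
    | succ t ih =>
      exact ⟨((ih.1.mulVec _).add ((ih.2.mulVec _).mulVec _)).add
          fun i => hδ.sqInt t (Sum.inl i),
        (ih.2.mulVec _).add (((ih.1.mulVec S.C).add fun i => hδ.sqInt t (Sum.inr i)).mulVec _)⟩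
  refine ⟨ℓ, ?_, fun ξ₀ hξ₀ => ?_, fun c hc hfb => ?_⟩
  · obtain ⟨h1, h2⟩ := hℓ
      (fun t ω => S.initState (gainInput S K u₀ fun t => d t ω) (fun t => d t ω) t)
      (fun t ω => gainInput S K u₀ (fun t => d t ω) t) (SqInt.const 0)
      (fun t ht => by
        simp only [gainInput, if_pos ht]
        exact SqInt.const (u₀ t))
      (fun _ _ => rfl) fun t ω => gainInput_feedback hobs K u₀ (fun t => d t ω) t
    refine tendsto_avgCost (r := fun ω => S.histStage K u₀ fun t => d t ω) (fun ω t => stage_nonneg hQ hR _ _) (fun t ht => ?_) (h2.congr' ?_)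
    · simp only [histStage_eq hobs K u₀ _ ht]
      exact h1 t ht
    · filter_upwards [eventually_ge_atTop L] with t ht
      simp only [histStage_eq hobs K u₀ _ ht]
  · have h1 := (hℓ (fun t ω => (S.loopState (DynController.ofGain K) (ξ₀ ω) (fun t => d t ω) t).1)
      (fun t ω => (DynController.ofGain K).F *ᵥ
        (S.loopState (DynController.ofGain K) (ξ₀ ω) (fun t => d t ω) t).2) (SqInt.const 0)
      (fun t _ => (hsqξ _ ξ₀ hξ₀ t).2.mulVec _) (fun _ _ => rfl) fun t ω =>
        ofGain_run K (ξ := fun t =>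
          (S.loopState (DynController.ofGain K) (ξ₀ ω) (fun t => d t ω) t).2)
          (fun _ => rfl) (fun _ => rfl) t).2
    obtain ⟨ℓ', hℓ'⟩ := exists_tendsto_dynAvg hδ hQ hR (isStabilizing_ofGain S hobs hK)
    obtain ⟨h2, h3⟩ := hℓ' ξ₀ hξ₀
    have h4 : ℓ = ℓ' := tendsto_nhds_unique h1 h2
    exact h4 ▸ ⟨h2, h3⟩
  · exact (hℓ (fun t ω => (S.loopState c 0 (fun t => d t ω) t).1)
      (fun t ω => c.F *ᵥ (S.loopState c 0 (fun t => d t ω) t).2) (SqInt.const 0)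
      (fun t _ => (hsqξ c (fun _ => 0) (SqInt.const 0) t).2.mulVec _) (fun _ _ => rfl)
      fun t ω => hfb (fun t => (S.loopState c 0 (fun t => d t ω) t).2) _ rfl (fun _ => rfl) t).2

/-- Strong induction: the feedback law involves only earlier outputs and earlier inputs, and the
latter are affine in still earlier outputs; the open-loop inputs are constants. -/
theorem isCausal_gain (hobs : IsStepObservable L S.A S.C) (K : Matrix (Fin nu) (ZIdx L nu ny) ℝ)
    (u₀ : ℕ → Fin nu → ℝ) :
    IsCausal S (fun t ω => (d t ω).ofLp)
      (fun t ω => S.initState (gainInput S K u₀ fun t => d t ω) (fun t => d t ω) t)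
      (fun t ω => gainInput S K u₀ (fun t => d t ω) t) := by
  intro t
  induction t using Nat.strong_induction_on with
  | _ t ih =>
    intro i
    rcases lt_or_ge t L with ht | ht
    · have : (fun ω => gainInput S K u₀ (fun t => d t ω) t i) = u₀ t i • (1 : Ω → ℝ) := by
        funext ω
        simp [gainInput, ht]
      rw [this]
      exact Submodule.smul_mem _ _ (Submodule.subset_span (Set.mem_insert _ _))
    · obtain ⟨t, rfl⟩ := Nat.exists_eq_add_of_le' ht
      simp only [gainInput_feedback hobs]
      refine mulVec_comp_mem ?_ K i
      rintro (⟨k, a⟩ | ⟨k, a⟩)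
      · have hk := k.2
        refine Submodule.span_mono (Set.insert_subset_insert ?_) (ih (t + k) (by omega) a)
        refine Set.biUnion_subset_biUnion_left fun s (hs : s < t + k) => ?_
        change s < t + L
        omega
      · have hk := k.2
        refine Submodule.subset_span (Or.inr (Set.mem_iUnion₂.2 ⟨t + k, by omega, a, rfl⟩))

theorem optimalCost_le_gainCost (hδ : IsWhiteNoise S P (fun t ω => (d t ω).ofLp))
    (hVw : S.Vw.PosSemidef) (hVv : S.Vv.PosDef) (hQ : S.Qy.PosDef) (hR : S.Ru.PosDef)
    (hX : IsStabilizingRiccati S.A S.B (S.Cᵀ * S.Qy * S.C) S.Ru X)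
    (hY : IsStabilizingRiccati S.Aᵀ S.Cᵀ S.Vw S.Vv Y) (hs : IsStabilizable S.A S.Vw)
    (hobs : IsStepObservable L S.A S.C) (K : Matrix (Fin nu) (ZIdx L nu ny) ℝ)
    (u₀ : ℕ → Fin nu → ℝ) :
    ENNReal.ofReal (optimalCost S X Y) ≤ S.gainCost P d u₀ K := by
  have hc := isCausal_gain (S := S) (d := d) hobs K u₀
  refine le_liminf_avgCost (r := fun ω => S.histStage K u₀ fun t => d t ω)
    (fun ω t => stage_nonneg hQ hR _ _) (fun t ht => ?_)
    (fun t ht => integral_congr_ae (Eventually.of_forall fun ω => histStage_eq hobs K u₀ _ ht))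
    (fun t => integral_nonneg fun ω => stage_nonneg hQ hR _ _)
    fun j hj => hc.eventually_le_sum hδ hVw hVv (fun _ => rfl) (fun _ _ => rfl) hQ hR hX hY hs hj
  obtain ⟨h1, h2⟩ := hc.uncorr hδ hVw hVv (fun _ => rfl) (fun _ _ => rfl) t
  simp only [histStage_eq hobs K u₀ _ ht]
  exact integrable_stage ((h2.sqInt.mulVec S.C).add fun i => hδ.sqInt t (Sum.inr i)) h1.sqInt

end Gains

end Costs

end IOH

/-! ### The theorem. -/

open LQGData

theorem theorem1 {nx nu ny : ℕ} (L : ℕ) (S : LQGData nx nu ny)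
    (hAB : IsStabilizable S.A S.B)
    (hAC : IsObservable S.A S.C)
    (hVw : S.Vw.PosSemidef) (hVv : S.Vv.PosDef) (hQ : S.Qy.PosDef) (hR : S.Ru.PosDef)
    (hobs : IsStepObservable L S.A S.C)
    (hne : (S.stabGains L).Nonempty)
    {Ω : Type*} [MeasurableSpace Ω] (P : Measure Ω) [IsProbabilityMeasure P]
    (d : ℕ → Ω → Noise nx ny)
    (hd_meas : ∀ t, Measurable (d t))
    (hd_indep : iIndepFun d P)
    (hd_law : ∀ t, P.map (d t) = multivariateGaussian 0 (Matrix.fromBlocks S.Vw 0 0 S.Vv))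
    (X Y : Matrix (Fin nx) (Fin nx) ℝ)
    (hX : LQGData.IsStabilizingRiccati S.A S.B (S.Cᵀ * S.Qy * S.C) S.Ru X)
    (hY : LQGData.IsStabilizingRiccati S.Aᵀ S.Cᵀ S.Vw S.Vv Y)
    {m : ℕ} (cmin : DynController (Fin m) nu ny)
    (hmin : cmin.IsMinimalRealization (S.lqgController X Y))
    (hmin_obs : IsStepObservable L cmin.G cmin.F)
    (u₀ : ℕ → Fin nu → ℝ) :
    (∀ K ∈ S.stabGains L,
      Tendsto (S.gainAvg P d u₀ K) atTop (𝓝 (S.gainCost P d u₀ K)) ∧ S.gainCost P d u₀ K < ∞) ∧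
    (∃ Kstar ∈ S.stabGains L, ∀ K ∈ S.stabGains L,
      S.gainCost P d u₀ Kstar ≤ S.gainCost P d u₀ K) ∧
    ∀ Kstar ∈ S.stabGains L,
      (∀ K ∈ S.stabGains L, S.gainCost P d u₀ Kstar ≤ S.gainCost P d u₀ K) →
      (IsStabilizable S.A S.Vw →
        ∀ K : Matrix (Fin nu) (ZIdx L nu ny) ℝ,
          S.gainCost P d u₀ Kstar ≤ S.gainCost P d u₀ K) ∧
      ∀ (ξs : Ω → Fin L × Fin nu → ℝ) (ξq : Ω → Fin nx → ℝ),
        (∀ i, MemLp (fun ω => ξs ω i) 2 P) → (∀ i, MemLp (fun ω => ξq ω i) 2 P) →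
        Tendsto (S.dynAvg (DynController.ofGain Kstar) P d ξs) atTop
          (𝓝 (S.dynCost (DynController.ofGain Kstar) P d ξs)) ∧
        Tendsto (S.dynAvg (S.lqgController X Y) P d ξq) atTop
          (𝓝 (S.dynCost (S.lqgController X Y) P d ξq)) ∧
        S.gainCost P d u₀ Kstar = S.dynCost (DynController.ofGain Kstar) P d ξs ∧
        S.dynCost (DynController.ofGain Kstar) P d ξs = S.dynCost (S.lqgController X Y) P d ξq ∧
        (nu = 1 →
          Fintype.card (Fin L × Fin nu) = L ∧
          ∀ (ι : Type) [Fintype ι] [DecidableEq ι], Fintype.card ι = L →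
            ∀ (c : DynController ι nu ny) (ξ : ι → ℝ),
              (S.IsStabilizing c ∨ IsStabilizable S.A S.Vw) →
              S.dynCost (DynController.ofGain Kstar) P d ξs
                ≤ S.dynCost c P d (fun _ => ξ)) := by
  have hδ := isWhiteNoise_of_gaussian S hVw hVv hd_meas hd_indep hd_law
  have hlqg := isStabilizing_lqgController S hX hY hVv
  set J := optimalCost S X Y with hJ
  have hcost : ∀ K ∈ S.stabGains L, ∃ ℓ : ℝ, J ≤ ℓ ∧
      Tendsto (S.gainAvg P d u₀ K) atTop (𝓝 (ENNReal.ofReal ℓ)) ∧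
      ∀ ξ₀ : Ω → Fin L × Fin nu → ℝ, SqInt P ξ₀ →
        Tendsto (S.dynAvg (DynController.ofGain K) P d ξ₀) atTop (𝓝 (ENNReal.ofReal ℓ)) := by
    intro K hK
    obtain ⟨ℓ, h1, h2, -⟩ := exists_gain_cost hδ hQ hR hobs hK u₀
    exact ⟨ℓ, optimalCost_le_dynCost_of_isStabilizing hδ hVv hR hX hY
      (isStabilizing_ofGain S hobs hK) (h2 (fun _ => 0) (SqInt.const 0)).1, h1,
      fun ξ₀ hξ₀ => (h2 ξ₀ hξ₀).2⟩
  obtain ⟨ℓq, hℓq⟩ := exists_tendsto_dynAvg hδ hQ hR hlqg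
  have hqJ : Tendsto
      (fun t => ∫ ω, S.loopStage (S.lqgController X Y) 0 (fun t => d t ω) t ∂P) atTop (𝓝 J) :=
    tendsto_stage_lqgController hδ hVv hR hX hY
      (x := fun t ω => (S.loopState (S.lqgController X Y) 0 (fun t => d t ω) t).1)
      (ξ := fun t ω => (S.loopState (S.lqgController X Y) 0 (fun t => d t ω) t).2)
      (fun _ => rfl) (fun _ => rfl) (fun _ _ => rfl) (fun _ _ => rfl)
  -- The limit is the same for all initial controller states, so the run from 0 identifies it.
  obtain rfl : ℓq = J :=
    tendsto_nhds_unique (hℓq (fun _ => 0) (SqInt.const 0)).1 hqJ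
  -- The LQG loop started at 0 obeys the feedback law of `K₀`, so `K₀` has the LQG cost.
  obtain ⟨K₀, hK₀, hfb⟩ := exists_stabGain_realizing S hobs hne hlqg hmin.1 hmin_obs
  have hK₀J : Tendsto (S.gainAvg P d u₀ K₀) atTop (𝓝 (ENNReal.ofReal J)) := by
    obtain ⟨ℓ, h1, -, h3⟩ := exists_gain_cost hδ hQ hR hobs hK₀ u₀
    rwa [tendsto_nhds_unique (h3 _ hlqg hfb) hqJ] at h1
  have hK₀c : S.gainCost P d u₀ K₀ = ENNReal.ofReal J := hK₀J.liminf_eq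
  have hle : ∀ K ∈ S.stabGains L, ENNReal.ofReal J ≤ S.gainCost P d u₀ K := by
    intro K hK
    obtain ⟨ℓ, h1, h2, -⟩ := hcost K hK
    rw [gainCost, h2.liminf_eq]
    exact ENNReal.ofReal_le_ofReal h1
  refine ⟨fun K hK => ?_, ⟨K₀, hK₀, fun K hK => hK₀c.trans_le (hle K hK)⟩, fun K hK hKmin => ?_⟩
  · obtain ⟨ℓ, -, h2, -⟩ := hcost K hK
    have h3 : S.gainCost P d u₀ K = ENNReal.ofReal ℓ := h2.liminf_eq
    rw [h3]
    exact ⟨h2, ENNReal.ofReal_lt_top⟩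
  have hKJ : S.gainCost P d u₀ K = ENNReal.ofReal J :=
    le_antisymm ((hKmin K₀ hK₀).trans_eq hK₀c) (hle K hK)
  refine ⟨fun hs K' => hKJ.trans_le
    (optimalCost_le_gainCost hδ hVw hVv hQ hR hX hY hs hobs K' u₀), fun ξs ξq hξs hξq => ?_⟩
  obtain ⟨ℓ, -, h2, h3⟩ := hcost K hK
  have hℓ : ENNReal.ofReal ℓ = ENNReal.ofReal J := by
    rw [← hKJ]; exact h2.liminf_eq.symm
  have hs1 : Tendsto (S.dynAvg (DynController.ofGain K) P d ξs) atTop (𝓝 (ENNReal.ofReal J)) :=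
    hℓ ▸ h3 ξs hξs
  have hs2 : S.dynCost (DynController.ofGain K) P d ξs = ENNReal.ofReal J := hs1.liminf_eq
  have hq1 := (hℓq ξq hξq).2
  have hq2 : S.dynCost (S.lqgController X Y) P d ξq = ENNReal.ofReal J := hq1.liminf_eq
  rw [hs2, hq2]
  refine ⟨hs1, hq1, hKJ, rfl, fun hnu => ⟨by subst hnu; simp, ?_⟩⟩
  intro ι _ _ _ c ξ hor
  -- A stabilizing competitor is compared through its start at 0, which has the same limit;
  -- otherwise the bound for causal controls applies, a fixed initial state contributing only
  -- constants.
  rcases hor with hc | hs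
  · obtain ⟨ℓc, hℓc⟩ := exists_tendsto_dynAvg hδ hQ hR hc
    rw [dynCost, (hℓc (fun _ => ξ) (SqInt.const ξ)).2.liminf_eq]
    exact ENNReal.ofReal_le_ofReal (optimalCost_le_dynCost_of_isStabilizing hδ hVv hR hX hY hc
      (hℓc (fun _ => 0) (SqInt.const 0)).1)
  · exact optimalCost_le_dynCost hδ hVw hVv hQ hR hX hY hs c ξ
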